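/- **Setting.** $n\ge 1$ agents communicate over a connected undirected graph with symmetric weights $w_{ij}\ge 0$ and Laplacian $L=D-W$. They minimize $f(x)=\frac1n\sum_{i=1}^n f_i(x)$ over $x\in\mathbb R^d$, where $f_i(x)=\mathbb E_{\xi_i\sim\mathcal D_i}[F_i(x,\xi_i)]$, and $f^*=\inf f$. Assume: (1) each $f_i$ is differentiable and $\|\nabla f_i(x)-\nabla f_i(y)\|\le L_f\|x-y\|$ for all $x,y$, with $L_f>0$; (2) the samples $\xi_{i,k}\sim\mathcal D_i$ are independent, $\mathbb E[\nabla F_i(x,\xi_{i,k})]=\nabla f_i(x)$ and $\mathbb E\|\nabla F_i(x,\xi_{i,k})-\nabla f_i(x)\|^2\le\sigma^2$ for all $x$, with $\sigma>0$; (3) $f^*>-\infty$; (4) (Polyak–Łojasiewicz) $\frac12\|\nabla f(x)\|^2\ge\nu(f(x)-f^*)$ for all $x$, with a known $\nu>0$; (5) the stochastic compressor $\mathcal C:\mathbb R^d\to\mathbb R^d$ satisfies $\mathbb E_{\mathcal C}\|\mathcal C(x)/r-x\|^2\le(1-\varphi)\|x\|^2+\sigma_{\mathcal C}$ for all $x$,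 with $\varphi\in(0,1]$, $r>0$, $\sigma_{\mathcal C}\ge0$; its internal randomness is drawn afresh, independently for every agent and every step and independently of the data samples. RCP-SGD starts from arbitrary deterministic $x_{i,0}$ and $v_{i,0}=x^c_{i,0}=0$, and iterates, with $\hat x_{i,k}=x^c_{i,k}+h_k\,\mathcal C((x_{i,k}-x^c_{i,k})/h_k)$, $$x_{i,k+1}=x_{i,k}-\eta_k\Big(\gamma_k\sum_{j}L_{ij}\hat x_{j,k}+\omega_k v_{i,k}+\nabla F_i(x_{i,k},\xi_{i,k})\Big),$$ $$v_{i,k+1}=v_{i,k}+\eta_k\omega_k\sum_j L_{ij}\hat x_{j,k},\qquad x^c_{i,k+1}=(1-\alpha_x)x^c_{i,k}+\alpha_x\hat x_{i,k},$$ with $\alpha_x\in(0,1/r)$, $\omega_k=\beta_0(k+t_1)$, $\gamma_k=\beta_1\omega_k$, $\eta_k=\beta_2/\omega_k$, $h_k=h_0^k$. Let $\bar x_k=\frac1n\sum_i x_{i,k}$. Let $0<\underline\lambda\le\bar\lambda$ be such that all positive eigenvalues of $L$ lie in $[\underline\lambda,\bar\lambda]$ (for instance the smallest and the largest positive eigenvalue),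 and let $R$ be such that $\frac1n\sum_i(\|x_{i,0}\|^2+\|\nabla f_i(x_{i,0})\|^2)\le R$. **Theorem.** Put $\bar c_1=\frac{9}{2\underline\lambda}+1$ and let $\beta_1>\bar c_1$. There is a constant $\bar c_2>0$, depending only on $\underline\lambda,\bar\lambda,\varphi,r,\alpha_x,L_f,\beta_1$, such that for all $0<\beta_2<\bar c_2$, $\nu>0$, $\tilde c\in(0,1)$ and $\beta_0\in[\tilde c\nu\beta_2/4,\ \nu\beta_2/4)$ there is a constant $\bar c_5\ge2$, depending only on these quantities, such that for all $t_1>\bar c_5$ and $h_0\in(0,1/t_1)$ and every integer $T\ge1$, $$\mathbb E\Big[\frac1n\sum_{i=1}^n\|x_{i,T}-\bar x_T\|^2\Big]\le\frac{C_2}{T^2},\qquad \mathbb E\big[f(\bar x_T)-f^*\big]\le\frac{C_1}{nT}+\frac{C_2}{T^2},$$ both expectations being finite. Here $C_1$ depends only on $L_f,\sigma,\nu,\tilde c$, and $C_2$ depends only on $\underline\lambda,\bar\lambda,\varphi,r,\sigma_{\mathcal C},\alpha_x,L_f,\sigma,\nu,\tilde c,\beta_0,\beta_1,\beta_2,t_1,h_0,R$;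 in particular neither depends on $n$, $d$, $T$, nor otherwise on the graph, the cost functions, the data, the compressor or the initial points (linear speedup). -/

import Mathlib

open MeasureTheory ProbabilityTheory

universe u v w

noncomputable section

/-- The decision space `ℝ^d` with the `ℓ²` norm. -/
abbrev Vec (d : ℕ) := EuclideanSpace ℝ (Fin d)

/-! ### The communication network -/

/-- The undirected graph whose edges are the pairs of agents with positive coupling weight. -/
def commGraph {n : ℕ} (W : Matrix (Fin n) (Fin n) ℝ) : SimpleGraph (Fin n) :=
  SimpleGraph.fromRel (fun i j => 0 < W i j)

/-- `W` is the coupling weight matrix of a connected undirected graph. -/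
structure IsConnectedCoupling {n : ℕ} (W : Matrix (Fin n) (Fin n) ℝ) : Prop where
  symm : ∀ i j, W i j = W j i
  nonneg : ∀ i j, 0 ≤ W i j
  connected : (commGraph W).Connected

/-- The Laplacian matrix `L = D - W`, with `D` the diagonal matrix of the degrees. -/
def laplacian {n : ℕ} (W : Matrix (Fin n) (Fin n) ℝ) : Matrix (Fin n) (Fin n) ℝ :=
  Matrix.diagonal (fun i => ∑ j, W i j) - W

/-- All positive eigenvalues of `A` lie in `[lo, hi]`. -/
def PosEigenvaluesIn {n : ℕ} (A : Matrix (Fin n) (Fin n) ℝ) (lo hi : ℝ) : Prop :=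
  ∀ μ : ℝ, Module.End.HasEigenvalue (Matrix.toLin' A) μ → 0 < μ → lo ≤ μ ∧ μ ≤ hi

/-! ### The stochastic optimization problem -/

section Problem

variable {n d : ℕ} {Ξ : Fin n → Type u} [∀ i, MeasurableSpace (Ξ i)]

/-- The local cost `f_i(x) = 𝔼_{ξ ∼ 𝒟_i} F_i(x, ξ)`. -/
def localCost (𝒟 : ∀ i, Measure (Ξ i)) (F : ∀ i, Vec d → Ξ i → ℝ) (i : Fin n) (x : Vec d) : ℝ :=
  ∫ ξ, F i x ξ ∂(𝒟 i)

/-- The global cost `f = (1/n) ∑ f_i`. -/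
def globalCost (𝒟 : ∀ i, Measure (Ξ i)) (F : ∀ i, Vec d → Ξ i → ℝ) (x : Vec d) : ℝ :=
  (1 / (n : ℝ)) * ∑ i, localCost 𝒟 F i x

/-- The optimal value `f^*`. -/
def optValue (𝒟 : ∀ i, Measure (Ξ i)) (F : ∀ i, Vec d → Ξ i → ℝ) : ℝ :=
  ⨅ x, globalCost 𝒟 F x

/-- The stochastic gradient `∇F_i(x, ξ)`, taken with respect to `x`. -/
def stochGrad (F : ∀ i, Vec d → Ξ i → ℝ) (i : Fin n) (x : Vec d) (ξ : Ξ i) : Vec d :=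
  gradient (fun y => F i y ξ) x

/-- Every local cost is `Lf`-smooth. -/
structure IsSmoothProblem (𝒟 : ∀ i, Measure (Ξ i)) (F : ∀ i, Vec d → Ξ i → ℝ) (Lf : ℝ) :
    Prop where
  differentiable : ∀ i, Differentiable ℝ (localCost 𝒟 F i)
  lipschitz : ∀ i x y,
    ‖gradient (localCost 𝒟 F i) x - gradient (localCost 𝒟 F i) y‖ ≤ Lf * ‖x - y‖

/-- The local data follow probability distributions, the local costs are well defined, and the
stochastic gradients exist, are unbiased and have variance at most `σ ^ 2`. -/
structure IsGradientOracle (𝒟 : ∀ i, Measure (Ξ i)) (F : ∀ i, Vec d → Ξ i → ℝ) (σ : ℝ) :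
    Prop where
  prob : ∀ i, IsProbabilityMeasure (𝒟 i)
  integrable : ∀ i x, Integrable (F i x) (𝒟 i)
  differentiableAt : ∀ i x, ∀ᵐ ξ ∂(𝒟 i), DifferentiableAt ℝ (fun y => F i y ξ) x
  measurable : ∀ i, Measurable (fun p : Vec d × Ξ i => stochGrad F i p.1 p.2)
  memLp : ∀ i x, MemLp (stochGrad F i x) 2 (𝒟 i)
  unbiased : ∀ i x, ∫ ξ, stochGrad F i x ξ ∂(𝒟 i) = gradient (localCost 𝒟 F i) x
  variance : ∀ i x,
    ∫ ξ, ‖stochGrad F i x ξ - gradient (localCost 𝒟 F i) x‖ ^ 2 ∂(𝒟 i) ≤ σ ^ 2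

/-- The global cost is bounded below and satisfies the Polyak–Łojasiewicz condition with
constant `ν`. -/
structure IsPL (𝒟 : ∀ i, Measure (Ξ i)) (F : ∀ i, Vec d → Ξ i → ℝ) (ν : ℝ) : Prop where
  bddBelow : BddBelow (Set.range (globalCost 𝒟 F))
  pl : ∀ x, ν * (globalCost 𝒟 F x - optValue 𝒟 F) ≤ 1 / 2 * ‖gradient (globalCost 𝒟 F) x‖ ^ 2

end Problem

/-! ### The stochastic compressor -/

/-- A stochastic compressor `x ↦ 𝒞 x ζ`, with `ζ` a random seed of law `𝒬`, that has both a
relative and an absolute compression error. -/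
structure IsCompressor {d : ℕ} {Z : Type v} [MeasurableSpace Z] (𝒬 : Measure Z)
    (𝒞 : Vec d → Z → Vec d) (φ r σC : ℝ) : Prop where
  prob : IsProbabilityMeasure 𝒬
  measurable : Measurable (fun p : Vec d × Z => 𝒞 p.1 p.2)
  integrable : ∀ x, Integrable (fun ζ => ‖r⁻¹ • 𝒞 x ζ - x‖ ^ 2) 𝒬
  error : ∀ x, ∫ ζ, ‖r⁻¹ • 𝒞 x ζ - x‖ ^ 2 ∂𝒬 ≤ (1 - φ) * ‖x‖ ^ 2 + σC

/-! ### The algorithm -/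

/-- The variables `x_{i,k}`, `v_{i,k}` and `x^c_{i,k}` of all agents at one time step. -/
structure AgentState (n d : ℕ) where
  x : Fin n → Vec d
  v : Fin n → Vec d
  xc : Fin n → Vec d

/-- The estimate `x̂ = x^c + h 𝒞((x - x^c) / h)`. -/
def xhat {n d : ℕ} {Z : Type v} (𝒞 : Vec d → Z → Vec d) (h : ℝ) (ζ : Fin n → Z)
    (s : AgentState n d) (j : Fin n) : Vec d :=
  s.xc j + h • 𝒞 (h⁻¹ • (s.x j - s.xc j)) (ζ j)

/-- One iteration, with Laplacian `L`, stochastic gradients `g`, data samples `ξ` and compressor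
seeds `ζ`. -/
def rcpStep {n d : ℕ} {Ξ : Fin n → Type u} {Z : Type v} (L : Matrix (Fin n) (Fin n) ℝ)
    (g : ∀ i, Vec d → Ξ i → Vec d) (𝒞 : Vec d → Z → Vec d) (αx η γ ω h : ℝ)
    (ξ : ∀ i, Ξ i) (ζ : Fin n → Z) (s : AgentState n d) : AgentState n d where
  x i := s.x i - η • (γ • ∑ j, L i j • xhat 𝒞 h ζ s j + ω • s.v i + g i (s.x i) (ξ i))
  v i := s.v i + (η * ω) • ∑ j, L i j • xhat 𝒞 h ζ s j
  xc i := (1 - αx) • s.xc i + αx • xhat 𝒞 h ζ s i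

/-- The iterates of the robust compressed primal–dual stochastic gradient method, started from
`x_{i,0} = x₀ i`, `v_{i,0} = 0` and `x^c_{i,0} = 0`. -/
def rcpSGD {n d : ℕ} {Ξ : Fin n → Type u} {Z : Type v} (L : Matrix (Fin n) (Fin n) ℝ)
    (g : ∀ i, Vec d → Ξ i → Vec d) (𝒞 : Vec d → Z → Vec d) (αx : ℝ) (η γ ω h : ℕ → ℝ)
    (x₀ : Fin n → Vec d) (ξ : ∀ i, ℕ → Ξ i) (ζ : Fin n → ℕ → Z) : ℕ → AgentState n d
  | 0 => ⟨x₀, fun _ => 0, fun _ => 0⟩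
  | k + 1 => rcpStep L g 𝒞 αx (η k) (γ k) (ω k) (h k) (fun i => ξ i k) (fun i => ζ i k)
      (rcpSGD L g 𝒞 αx η γ ω h x₀ ξ ζ k)

/-- The average `x̄` of the agents' estimates. -/
def avg {n d : ℕ} (x : Fin n → Vec d) : Vec d := (1 / (n : ℝ)) • ∑ i, x i

/-- The consensus error `(1/n) ∑ ‖x_i - x̄‖²`. -/
def consensusError {n d : ℕ} (x : Fin n → Vec d) : ℝ :=
  (1 / (n : ℝ)) * ∑ i, ‖x i - avg x‖ ^ 2

/-- All the data samples `ξ i k` and all the compressor seeds `ζ i k` are independent, with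
`ξ i k ∼ 𝒟 i` and `ζ i k ∼ 𝒬` (the pairs `(ξ i k, ζ i k)` are independent of each other, and so
are the two entries of each pair). -/
structure IsFreshSampling {n : ℕ} {Ω : Type w} [MeasurableSpace Ω] {Ξ : Fin n → Type u}
    [∀ i, MeasurableSpace (Ξ i)] {Z : Type v} [MeasurableSpace Z] (P : Measure Ω)
    (𝒟 : ∀ i, Measure (Ξ i)) (𝒬 : Measure Z) (ξ : ∀ i, ℕ → Ω → Ξ i) (ζ : Fin n → ℕ → Ω → Z) :
    Prop where
  measurable_data : ∀ i k, Measurable (ξ i k)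
  measurable_seed : ∀ i k, Measurable (ζ i k)
  law_data : ∀ i k, P.map (ξ i k) = 𝒟 i
  law_seed : ∀ i k, P.map (ζ i k) = 𝒬
  indep_pairs : iIndepFun (β := fun p : Fin n × ℕ => Ξ p.1 × Z)
    (fun p ω => (ξ p.1 p.2 ω, ζ p.1 p.2 ω)) P
  indep_entries : ∀ i k, IndepFun (ξ i k) (ζ i k) P

end

/-! Since `η k = β₂ / ω k`, the products `η ω = β₂` and `η γ = β₁ β₂` are constant in time, while
the gradient step `η k` decays like `1 / s`, where `s = k + t₁`. Agreement is therefore driven with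
a constant gain, and the gradients disturb it only at order `1 / s`. Both rates come from this
separation of scales.

Consensus. Stack all agents; let `e` be the deviation of `x` from its average, `y = x - x^c` the
lag, and `m` the local gradients at the average. The dual variable tracks minus the deviation of `m
/ ω`, so the dual error is `q = v + ω⁻¹ (m - avg m)`. Up to disturbances `e` loses `b (β₁ L e + q)`
and `q` gains `b L e`, with `b = β₂`. In `⟨e, L e⟩ + ‖q‖²` the skew coupling cancels, and a small
cross term `2 ε ⟨e, q⟩` supplies decay in `q` (`exists_lyapunov_contraction`). The compressor
contracts `‖y‖²` in expectation, and for small `β₂` the feedback between lag and consensus is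
absorbed (`exists_step_contraction`, `exists_energy_step`).

Optimality. The columns of the Laplacian sum to zero and the dual variables have mean zero, so
neither compression nor the dual variables move the average: it performs gradient descent with
averaged noise of variance at most `σ² / n`. By the PL inequality and `β₀ < ν β₂ / 4` the gap
contracts by `1 - 4 / s`, up to the consensus error and noise of order `1 / (n s²)`
(`expected_gap_step`).

Closing the loop. The local gradients at the average are not assumed bounded. Their full size enters
the energy only through the change of `1 / ω`, with weight `s⁻⁴`, so their squares may grow like
`s²`. The recursions for energy `V`, squared gradients `M` and gap `a` are solved in
`exists_rate_bound`: `V + M / s² + a` stays bounded, hence `V = O(s⁻²)`, hence `a ≤ A / (n s) +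
O(s⁻²)`, where `A` stems from the averaged noise alone. This is the linear speedup. -/

noncomputable section

/-! ### Contraction of the consensus dynamics -/

/-- `A` is a symmetric operator whose restriction to the range of the projection `K` has spectrum in
`[lo, hi]`, and which vanishes on the kernel of `K`. -/
structure IsConsensusPair {E : Type*} [NormedAddCommGroup E] [InnerProductSpace ℝ E]
    (A K : E →ₗ[ℝ] E) (lo hi : ℝ) : Prop where
  symm : ∀ x y, inner ℝ (A x) y = inner ℝ x (A y)
  comp_right : ∀ x, A (K x) = A x
  comp_left : ∀ x, K (A x) = A x
  idem : ∀ x, K (K x) = K x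
  norm_le : ∀ x, ‖K x‖ ≤ ‖x‖
  norm_sub_le : ∀ x, ‖x - K x‖ ≤ ‖x‖
  coercive : ∀ x, lo * ‖K x‖ ^ 2 ≤ inner ℝ x (A x)
  bound : ∀ x, ‖A x‖ ≤ hi * ‖x‖

section Contraction

variable {E : Type*} [NormedAddCommGroup E] [InnerProductSpace ℝ E]

lemma inner_le_young (x y : E) {t : ℝ} (ht : 0 < t) :
    inner ℝ x y ≤ t * ‖x‖ ^ 2 + (4 * t)⁻¹ * ‖y‖ ^ 2 := by
  have h := real_inner_le_norm x y
  have : t * ‖x‖ ^ 2 + (4 * t)⁻¹ * ‖y‖ ^ 2 - ‖x‖ * ‖y‖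
      = t * (‖x‖ - (2 * t)⁻¹ * ‖y‖) ^ 2 := by
    field_simp
    ring
  have h2 : 0 ≤ t * (‖x‖ - (2 * t)⁻¹ * ‖y‖) ^ 2 := by positivity
  linarith

lemma neg_inner_le_young (x y : E) {t : ℝ} (ht : 0 < t) :
    -inner ℝ x y ≤ t * ‖x‖ ^ 2 + (4 * t)⁻¹ * ‖y‖ ^ 2 := by
  have h := inner_le_young (-x) y ht
  simpa using h

lemma norm_add_sq_le_young (x y : E) {t : ℝ} (ht : 0 < t) :
    ‖x + y‖ ^ 2 ≤ (1 + t) * ‖x‖ ^ 2 + (1 + t⁻¹) * ‖y‖ ^ 2 := by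
  rw [norm_add_sq_real]
  have h := inner_le_young x y (half_pos ht)
  have : (4 * (t / 2))⁻¹ = t⁻¹ / 2 := by field_simp; norm_num
  rw [this] at h
  linarith

lemma norm_add_sq_le_two (x y : E) : ‖x + y‖ ^ 2 ≤ 2 * ‖x‖ ^ 2 + 2 * ‖y‖ ^ 2 := by
  have h := norm_add_sq_le_young x y one_pos
  norm_num at h
  linarith

lemma norm_sub_sq_le_two (x y : E) : ‖x - y‖ ^ 2 ≤ 2 * ‖x‖ ^ 2 + 2 * ‖y‖ ^ 2 := by
  have h := norm_add_sq_le_two x (-y)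
  rwa [norm_neg, ← sub_eq_add_neg] at h

lemma norm_add_three_sq_le (x y z : E) :
    ‖x + y + z‖ ^ 2 ≤ 4 * (‖x‖ ^ 2 + ‖y‖ ^ 2 + ‖z‖ ^ 2) := by
  have h := norm_add_sq_le_two (x + y) z
  have h' := norm_add_sq_le_two x y
  nlinarith [sq_nonneg ‖z‖]

/-- The Lyapunov function of the primal-dual consensus dynamics. -/
def lyapunov (A : E →ₗ[ℝ] E) (ε : ℝ) (e q : E) : ℝ :=
  inner ℝ e (A e) + ‖q‖ ^ 2 + 2 * ε * inner ℝ e q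

lemma lyapunov_step_eq {A : E →ₗ[ℝ] E} (hA : ∀ x y, inner ℝ (A x) y = inner ℝ x (A y))
    (ε b : ℝ) (e q u w : E) :
    lyapunov A ε (e - b • u) (q + b • w) = lyapunov A ε e q
      + 2 * b * (-inner ℝ (A e) u + inner ℝ q w + ε * (inner ℝ e w - inner ℝ u q))
      + b ^ 2 * (inner ℝ u (A u) + ‖w‖ ^ 2 - 2 * ε * inner ℝ u w) := by
  have h1 : inner ℝ e (A u) = inner ℝ (A e) u := (hA e u).symm
  have h2 : inner ℝ u (A e) = inner ℝ (A e) u := real_inner_comm _ _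
  simp only [lyapunov, map_sub, map_smul, inner_sub_left, inner_sub_right, inner_add_right,
    inner_smul_left, inner_smul_right, norm_add_sq_real, norm_smul, mul_pow, Real.norm_eq_abs,
    sq_abs, h1, h2]
  simp
  ring

/-- The skew terms `-⟨A e, q⟩ + ⟨q, A e⟩` cancel. What remains is `-b₁ ‖A e‖²` together with `-ε
‖q‖²` from the cross term; smallness of `ε` lets the former pay for the other `ε`-terms in `A e`,
and Young's inequality splits off `d₁` and `d₂`. -/
lemma lyapunov_first_order {A : E →ₗ[ℝ] E} {lo b₁ ε : ℝ} (hlo : 0 < lo) (hb₁ : 0 < b₁)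
    (hε : 0 < ε) (hε1 : ε * (1 / lo + 1 / lo ^ 2 + b₁ ^ 2) ≤ b₁ / 4) {e : E}
    (he : lo * ‖e‖ ≤ ‖A e‖) (q d₁ d₂ : E) :
    -inner ℝ (A e) (b₁ • A e + q - d₁) + inner ℝ q (A e + d₂)
        + ε * (inner ℝ e (A e + d₂) - inner ℝ (b₁ • A e + q - d₁) q) ≤
      -(b₁ * lo ^ 2 / 2) * ‖e‖ ^ 2 - ε / 4 * ‖q‖ ^ 2
        + (1 / b₁ + ε) * ‖d₁‖ ^ 2 + (2 / ε + ε) * ‖d₂‖ ^ 2 := by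
  have hsq : lo ^ 2 * ‖e‖ ^ 2 ≤ ‖A e‖ ^ 2 := by
    rw [← mul_pow]; exact pow_le_pow_left₀ (by positivity) he 2
  have hsq' : ‖e‖ ^ 2 ≤ 1 / lo ^ 2 * ‖A e‖ ^ 2 := by
    rw [one_div, ← div_eq_inv_mul, le_div_iff₀ (by positivity)]; linarith
  have hen : ‖e‖ ≤ 1 / lo * ‖A e‖ := by
    rw [one_div, ← div_eq_inv_mul, le_div_iff₀ (by positivity)]; linarith
  have h1 := inner_le_young (A e) d₁ (t := b₁ / 4) (by positivity)
  have h2 := inner_le_young q d₂ (t := ε / 8) (by positivity)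
  have h3 : inner ℝ e (A e) ≤ 1 / lo * ‖A e‖ ^ 2 := by
    refine (real_inner_le_norm _ _).trans ?_
    nlinarith [norm_nonneg (A e)]
  have h4 := inner_le_young e d₂ (t := 1) (by positivity)
  have h5 := neg_inner_le_young (b₁ • A e) q (t := 1) (by positivity)
  have h6 := inner_le_young d₁ q (t := 1) (by positivity)
  rw [norm_smul, mul_pow, Real.norm_eq_abs, sq_abs] at h5
  have e1 : (4 * (b₁ / 4))⁻¹ = 1 / b₁ := by field_simp
  have e2 : (4 * (ε / 8))⁻¹ = 2 / ε := by field_simp; norm_num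
  rw [e1] at h1
  rw [e2] at h2
  have key : -inner ℝ (A e) (b₁ • A e + q - d₁) + inner ℝ q (A e + d₂)
        + ε * (inner ℝ e (A e + d₂) - inner ℝ (b₁ • A e + q - d₁) q)
      = -b₁ * ‖A e‖ ^ 2 + inner ℝ (A e) d₁ + inner ℝ q d₂ + ε * (inner ℝ e (A e)
        + inner ℝ e d₂ + -inner ℝ (b₁ • A e) q - ‖q‖ ^ 2 + inner ℝ d₁ q) := by
    simp only [inner_sub_left, inner_sub_right, inner_add_left, inner_add_right,
      inner_smul_right, real_inner_self_eq_norm_sq, real_inner_comm (A e) q]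
    ring
  rw [key]
  have h7 : ε * (inner ℝ e (A e) + inner ℝ e d₂ + -inner ℝ (b₁ • A e) q - ‖q‖ ^ 2 + inner ℝ d₁ q)
      ≤ ε * ((1 / lo + 1 / lo ^ 2 + b₁ ^ 2) * ‖A e‖ ^ 2 - 1 / 2 * ‖q‖ ^ 2 + ‖d₁‖ ^ 2
        + ‖d₂‖ ^ 2) := by
    apply mul_le_mul_of_nonneg_left _ hε.le
    norm_num at h4 h5 h6 ⊢
    norm_num at hsq' h3
    nlinarith [sq_nonneg ‖d₁‖, sq_nonneg ‖d₂‖]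
  have h8 := mul_le_mul_of_nonneg_right hε1 (sq_nonneg ‖A e‖)
  have h9 := mul_le_mul_of_nonneg_left hsq (by positivity : 0 ≤ b₁ / 2)
  have h10 : 0 ≤ ε * ‖q‖ ^ 2 := by positivity
  linarith

/-- A crude bound suffices for the `b ^ 2` remainder in `lyapunov_step_eq`, because the first-order
decay absorbs it for small `b`. -/
lemma lyapunov_second_order {A K : E →ₗ[ℝ] E} {lo hi b₁ ε : ℝ} (hAK : IsConsensusPair A K lo hi)
    (hhi : 0 < hi) (hε : 0 < ε) (e q d₁ d₂ : E) :
    inner ℝ (b₁ • A e + q - d₁) (A (b₁ • A e + q - d₁)) + ‖A e + d₂‖ ^ 2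
        - 2 * ε * inner ℝ (b₁ • A e + q - d₁) (A e + d₂) ≤
      (4 * (hi + ε) * (b₁ ^ 2 * hi ^ 2 + 1) + 2 * (1 + ε) * (hi ^ 2 + 1)) *
        (‖e‖ ^ 2 + ‖q‖ ^ 2 + (‖d₁‖ ^ 2 + ‖d₂‖ ^ 2)) := by
  have ha : ‖A e‖ ^ 2 ≤ hi ^ 2 * ‖e‖ ^ 2 := by
    rw [← mul_pow]; exact pow_le_pow_left₀ (norm_nonneg _) (hAK.bound e) 2
  have hun : ‖b₁ • A e + q - d₁‖ ^ 2 ≤ 4 * (b₁ ^ 2 * ‖A e‖ ^ 2 + ‖q‖ ^ 2 + ‖d₁‖ ^ 2) := by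
    have := norm_add_three_sq_le (b₁ • A e) q (-d₁)
    rwa [norm_smul, mul_pow, Real.norm_eq_abs, sq_abs, norm_neg, ← sub_eq_add_neg] at this
  have hwn : ‖A e + d₂‖ ^ 2 ≤ 2 * ‖A e‖ ^ 2 + 2 * ‖d₂‖ ^ 2 := norm_add_sq_le_two _ _
  generalize b₁ • A e + q - d₁ = u at *
  generalize A e + d₂ = w at *
  have huA : inner ℝ u (A u) ≤ hi * ‖u‖ ^ 2 := by
    refine (real_inner_le_norm _ _).trans ?_
    nlinarith [hAK.bound u, norm_nonneg u]
  have huw := mul_le_mul_of_nonneg_left (neg_inner_le_young u w (t := 1 / 2) (by norm_num)) hε.le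
  norm_num at huw
  have g1 := mul_le_mul_of_nonneg_left hun (by positivity : 0 ≤ hi + ε)
  have g2 := mul_le_mul_of_nonneg_left hwn (by positivity : 0 ≤ 1 + ε)
  have g3 := mul_le_mul_of_nonneg_left ha
    (by positivity : 0 ≤ 4 * (hi + ε) * b₁ ^ 2 + 2 * (1 + ε))
  have p1 : 0 ≤ (4 * (hi + ε) + 2 * (1 + ε)) * ‖e‖ ^ 2 := by positivity
  have p2 : 0 ≤ (4 * (hi + ε) * (b₁ ^ 2 * hi ^ 2) + 2 * (1 + ε) * (hi ^ 2 + 1)) * ‖q‖ ^ 2 := by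
    positivity
  have p3 : 0 ≤ (4 * (hi + ε) * (b₁ ^ 2 * hi ^ 2) + 2 * (1 + ε) * (hi ^ 2 + 1)) * ‖d₁‖ ^ 2 := by
    positivity
  have p4 : 0 ≤ (4 * (hi + ε) * (b₁ ^ 2 * hi ^ 2 + 1) + 2 * (1 + ε) * hi ^ 2) * ‖d₂‖ ^ 2 := by
    positivity
  linarith

/-- For small step sizes the Lyapunov function contracts up to the disturbances. -/
lemma exists_lyapunov_contraction {lo hi b₁ : ℝ} (hlo : 0 < lo) (hlh : lo ≤ hi) (hb₁ : 0 < b₁) :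
    ∃ ε c C b₀ : ℝ, 0 < ε ∧ ε ≤ 1 ∧ 4 * ε ^ 2 ≤ lo ∧ 0 < c ∧ 0 < C ∧ 0 < b₀ ∧
      ∀ (E : Type) [NormedAddCommGroup E] [InnerProductSpace ℝ E] (A K : E →ₗ[ℝ] E),
        IsConsensusPair A K lo hi → ∀ b : ℝ, 0 < b → b < b₀ → ∀ e q d₁ d₂ : E, K e = e →
        lyapunov A ε (e - b • (b₁ • A e + q - d₁)) (q + b • (A e + d₂)) ≤
          lyapunov A ε e q - b * c * (‖e‖ ^ 2 + ‖q‖ ^ 2) + b * C * (‖d₁‖ ^ 2 + ‖d₂‖ ^ 2) := by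
  have hhi : 0 < hi := hlo.trans_le hlh
  obtain ⟨ε, hε, hε1, hε2, hε3⟩ : ∃ ε : ℝ, 0 < ε ∧ ε ≤ 1 ∧ 4 * ε ^ 2 ≤ lo ∧
      ε * (1 / lo + 1 / lo ^ 2 + b₁ ^ 2) ≤ b₁ / 4 := by
    have hp : 0 < 1 / lo + 1 / lo ^ 2 + b₁ ^ 2 := by positivity
    refine ⟨min 1 (min (lo / 4) (b₁ / 4 / (1 / lo + 1 / lo ^ 2 + b₁ ^ 2))), by positivity,
      min_le_left _ _, ?_, ?_⟩
    · set m := min 1 (min (lo / 4) (b₁ / 4 / (1 / lo + 1 / lo ^ 2 + b₁ ^ 2)))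
      have m0 : 0 < m := by positivity
      have m1 : m ≤ 1 := min_le_left _ _
      have m2 : m ≤ lo / 4 := (min_le_right _ _).trans (min_le_left _ _)
      nlinarith
    · rw [← le_div_iff₀ hp]
      exact (min_le_right _ _).trans (min_le_right _ _)
  obtain ⟨S, hS⟩ : ∃ S : ℝ,
    S = 4 * (hi + ε) * (b₁ ^ 2 * hi ^ 2 + 1) + 2 * (1 + ε) * (hi ^ 2 + 1) := ⟨_, rfl⟩
  have hS0 : 0 < S := by rw [hS]; positivity
  -- The first-order rates, doubled by the factor `2 * b`, are `b₁ * lo ^ 2` and `ε / 2`, both at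
  -- least `2 * c`; one `c` is reserved for the remainder, through `b * S ≤ c`.
  obtain ⟨c, hc⟩ : ∃ c : ℝ, c = min (b₁ * lo ^ 2) (ε / 2) / 2 := ⟨_, rfl⟩
  have hc0 : 0 < c := by rw [hc]; positivity
  have hc1 : 2 * c ≤ b₁ * lo ^ 2 := by rw [hc]; linarith [min_le_left (b₁ * lo ^ 2) (ε / 2)]
  have hc2 : 2 * c ≤ ε / 2 := by rw [hc]; linarith [min_le_right (b₁ * lo ^ 2) (ε / 2)]
  refine ⟨ε, c, 2 * (1 / b₁ + ε + 2 / ε) + S, min 1 (c / S), hε, hε1, hε2, hc0, by positivity, by positivity, ?_⟩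
  intro E _ _ A K hAK b hb hbb e q d₁ d₂ he
  have hb1 : b ≤ 1 := hbb.le.trans (min_le_left _ _)
  have hbS : b * S ≤ c := by
    rw [← le_div_iff₀ hS0]; exact hbb.le.trans (min_le_right _ _)
  have hae : lo * ‖e‖ ≤ ‖A e‖ := by
    by_cases h0 : ‖e‖ = 0
    · rw [h0]; simp
    · have h1 := hAK.coercive e
      rw [he] at h1
      have h2 := real_inner_le_norm e (A e)
      have h3 : 0 < ‖e‖ := lt_of_le_of_ne (norm_nonneg e) (Ne.symm h0)
      nlinarith
  rw [lyapunov_step_eq hAK.symm]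
  have h1 := lyapunov_first_order (A := A) hlo hb₁ hε hε3 hae q d₁ d₂
  have h3 := lyapunov_second_order (b₁ := b₁) hAK hhi hε e q d₁ d₂
  rw [← hS] at h3
  have h4 := mul_le_mul_of_nonneg_left h1 (by positivity : 0 ≤ 2 * b)
  have h5 := mul_le_mul_of_nonneg_left h3 (by positivity : 0 ≤ b ^ 2)
  have q1 : b * (b * S) * (‖e‖ ^ 2 + ‖q‖ ^ 2) ≤ b * c * (‖e‖ ^ 2 + ‖q‖ ^ 2) := by gcongr
  have q2 : b * (b * S) * (‖d₁‖ ^ 2 + ‖d₂‖ ^ 2) ≤ b * (1 * S) * (‖d₁‖ ^ 2 + ‖d₂‖ ^ 2) := by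
    gcongr
  have q3 : b * (2 * c) * ‖e‖ ^ 2 ≤ b * (b₁ * lo ^ 2) * ‖e‖ ^ 2 := by gcongr
  have q4 : b * (2 * c) * ‖q‖ ^ 2 ≤ b * (ε / 2) * ‖q‖ ^ 2 := by gcongr
  have q5 : 0 ≤ b * (2 * (2 / ε)) * ‖d₁‖ ^ 2 := by positivity
  have q6 : 0 ≤ b * (2 * (1 / b₁)) * ‖d₂‖ ^ 2 := by positivity
  linarith

/-- By Young's inequality the cross term costs at most `2 ε² ‖e‖² + ‖q‖² / 2`, which is half of the
coercive part when `4 ε² ≤ lo`. -/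
lemma le_lyapunov {A K : E →ₗ[ℝ] E} {lo hi ε : ℝ} (hAK : IsConsensusPair A K lo hi)
    (hε2 : 4 * ε ^ 2 ≤ lo) {e : E} (he : K e = e) (q : E) :
    lo / 2 * ‖e‖ ^ 2 + 1 / 2 * ‖q‖ ^ 2 ≤ lyapunov A ε e q := by
  have h1 := hAK.coercive e
  rw [he] at h1
  have h2 := neg_inner_le_young ((2 * ε) • e) q (t := 1 / 2) (by norm_num)
  rw [norm_smul, mul_pow, Real.norm_eq_abs, sq_abs, inner_smul_left] at h2
  norm_num at h2
  have h3 := mul_le_mul_of_nonneg_right hε2 (sq_nonneg ‖e‖)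
  simp only [lyapunov]
  linarith

lemma lyapunov_le {A K : E →ₗ[ℝ] E} {lo hi ε : ℝ} (hAK : IsConsensusPair A K lo hi)
    (hε0 : 0 < ε) (hε1 : ε ≤ 1) (hhi : 0 ≤ hi) (e q : E) :
    lyapunov A ε e q ≤ (hi + 2) * (‖e‖ ^ 2 + ‖q‖ ^ 2) := by
  have h1 : inner ℝ e (A e) ≤ hi * ‖e‖ ^ 2 := by
    refine (real_inner_le_norm _ _).trans ?_
    nlinarith [hAK.bound e, norm_nonneg e]
  have h2 := inner_le_young e q (t := 1 / 2) (by norm_num)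
  norm_num at h2
  have h3 : 2 * ε * inner ℝ e q ≤ ‖e‖ ^ 2 + ‖q‖ ^ 2 := by
    have := mul_le_mul_of_nonneg_left h2 hε0.le
    nlinarith [sq_nonneg ‖e‖, sq_nonneg ‖q‖]
  have h4 : 0 ≤ hi * ‖q‖ ^ 2 := by positivity
  simp only [lyapunov]
  nlinarith [sq_nonneg ‖e‖, sq_nonneg ‖q‖]

end Contraction

/-! ### One step of consensus, dual and compression errors together -/

section OneStep

variable {E : Type*} [NormedAddCommGroup E] [InnerProductSpace ℝ E]

lemma norm_smul_sq (t : ℝ) (x : E) : ‖t • x‖ ^ 2 = t ^ 2 * ‖x‖ ^ 2 := by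
  rw [norm_smul, mul_pow, Real.norm_eq_abs, sq_abs]

lemma norm_convex_comb_sq_le (y z : E) {t : ℝ} (ht0 : 0 ≤ t) (ht1 : t ≤ 1) :
    ‖(1 - t) • y - t • z‖ ^ 2 ≤ (1 - t) * ‖y‖ ^ 2 + t * ‖z‖ ^ 2 := by
  have h : (1 - t) * ‖y‖ ^ 2 + t * ‖z‖ ^ 2 - ‖(1 - t) • y - t • z‖ ^ 2
      = t * (1 - t) * ‖y + z‖ ^ 2 := by
    rw [norm_sub_sq_real, norm_add_sq_real, norm_smul_sq, norm_smul_sq, inner_smul_left,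
      inner_smul_right]
    simp
    ring
  have : 0 ≤ t * (1 - t) * ‖y + z‖ ^ 2 :=
    mul_nonneg (mul_nonneg ht0 (by linarith)) (sq_nonneg _)
  linarith

variable {A K : E →ₗ[ℝ] E} {lo hi : ℝ}

lemma IsConsensusPair.bound_sq (hAK : IsConsensusPair A K lo hi) (x : E) :
    ‖A x‖ ^ 2 ≤ hi ^ 2 * ‖x‖ ^ 2 := by
  rw [← mul_pow]
  exact pow_le_pow_left₀ (norm_nonneg _) (hAK.bound x) 2

lemma IsConsensusPair.norm_sq_le (hAK : IsConsensusPair A K lo hi) (x : E) :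
    ‖K x‖ ^ 2 ≤ ‖x‖ ^ 2 :=
  pow_le_pow_left₀ (norm_nonneg _) (hAK.norm_le x) 2

/-- The compressor is accurate only after rescaling by `r`, but the network exchanges the unscaled
output; this bounds the resulting residual. -/
lemma compression_residual_sq_le {r : ℝ} (hr : r ≠ 0) (c y : E) :
    ‖c - y‖ ^ 2 ≤ (2 * r ^ 2 + 2 * (r - 1) ^ 2) * (‖y‖ ^ 2 + ‖r⁻¹ • c - y‖ ^ 2) := by
  have h : c - y = r • (r⁻¹ • c - y) + (r - 1) • y := by
    rw [smul_sub, smul_smul, mul_inv_cancel₀ hr, one_smul, sub_smul, one_smul]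
    abel
  have h2 := norm_add_sq_le_two (r • (r⁻¹ • c - y)) ((r - 1) • y)
  rw [← h, norm_smul_sq, norm_smul_sq] at h2
  have p1 : 0 ≤ 2 * r ^ 2 * ‖y‖ ^ 2 := by positivity
  have p2 : 0 ≤ 2 * (r - 1) ^ 2 * ‖r⁻¹ • c - y‖ ^ 2 := by positivity
  linarith

/-- The factor `b⁻¹` appears because the shift `p` of the dual target is not multiplied by the gain
`b`, whereas the disturbances in `exists_lyapunov_contraction` are. -/
lemma consensus_disturbance_sq_le (hAK : IsConsensusPair A K lo hi) {b : ℝ}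
    (b₁ t : ℝ) (δ g p : E) :
    ‖-(b₁ • A δ + t • K g)‖ ^ 2 + ‖A δ + b⁻¹ • p‖ ^ 2 ≤
      2 * (b₁ ^ 2 + 1) * hi ^ 2 * ‖δ‖ ^ 2 + 2 * (1 + (b⁻¹) ^ 2) * (t ^ 2 * ‖g‖ ^ 2 + ‖p‖ ^ 2) := by
  have h1 := norm_add_sq_le_two (b₁ • A δ) (t • K g)
  have h2 := norm_add_sq_le_two (A δ) (b⁻¹ • p)
  rw [norm_smul_sq, norm_smul_sq] at h1
  rw [norm_smul_sq] at h2
  rw [norm_neg]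
  have h3 := hAK.bound_sq δ
  have h4 := mul_le_mul_of_nonneg_left (hAK.norm_sq_le g) (sq_nonneg t)
  have h5 := mul_le_mul_of_nonneg_left h3 (by positivity : 0 ≤ 2 * b₁ ^ 2 + 2)
  have p1 : 0 ≤ (b⁻¹) ^ 2 * (t ^ 2 * ‖g‖ ^ 2) := by positivity
  have p2 := sq_nonneg ‖p‖
  linarith

lemma increment_sq_le (hAK : IsConsensusPair A K lo hi) (b b₁ t : ℝ) (e q δ g m : E) :
    ‖b • (b₁ • A e + q + (b₁ • A δ + t • g + t • m))‖ ^ 2 ≤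
      16 * b ^ 2 * ((b₁ ^ 2 * hi ^ 2 + 1) * (‖e‖ ^ 2 + ‖q‖ ^ 2 + ‖δ‖ ^ 2)
        + t ^ 2 * ‖g‖ ^ 2 + t ^ 2 * ‖m‖ ^ 2) := by
  have h1 := norm_add_three_sq_le (b₁ • A e) q (b₁ • A δ + t • g + t • m)
  have h2 := norm_add_three_sq_le (b₁ • A δ) (t • g) (t • m)
  simp only [norm_smul_sq] at h1 h2 ⊢
  have h3 := mul_le_mul_of_nonneg_left (hAK.bound_sq e) (sq_nonneg b₁)
  have h4 := mul_le_mul_of_nonneg_left (hAK.bound_sq δ) (sq_nonneg b₁)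
  have p1 : 0 ≤ b₁ ^ 2 * hi ^ 2 * ‖q‖ ^ 2 := by positivity
  have p2 := sq_nonneg ‖e‖
  have p3 := sq_nonneg ‖δ‖
  have p4 := sq_nonneg ‖q‖
  rw [mul_comm (16 : ℝ), mul_assoc]
  apply mul_le_mul_of_nonneg_left _ (sq_nonneg b)
  have p5 : 0 ≤ b₁ ^ 2 * hi ^ 2 * ‖e‖ ^ 2 := by positivity
  linarith

/-- One iteration contracts the joint Lyapunov function of the consensus error, the dual error and
the compression error, up to the disturbances. -/
lemma exists_step_contraction {lo hi b₁ φ r α : ℝ} (hlo : 0 < lo) (hlh : lo ≤ hi) (hb₁ : 0 < b₁)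
    (hφ : 0 < φ) (hφ1 : φ ≤ 1) (hr : 0 < r) (hα : 0 < α) (hαr : α < 1 / r) :
    ∃ ε b₀ : ℝ, 0 < ε ∧ ε ≤ 1 ∧ 4 * ε ^ 2 ≤ lo ∧ 0 < b₀ ∧ ∀ b : ℝ, 0 < b → b < b₀ →
      ∃ θ C ρ₁ ρ₂ : ℝ, 0 < θ ∧ θ ≤ 1 ∧ 0 < C ∧ 0 ≤ ρ₂ ∧ ρ₁ + ρ₂ * (1 - φ) ≤ 1 - θ ∧
      ∀ (E : Type) [NormedAddCommGroup E] [InnerProductSpace ℝ E] (A K : E →ₗ[ℝ] E),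
        IsConsensusPair A K lo hi → ∀ (t t' : ℝ) (x v y c g m m' x' v' y' : E), K v = v →
        x' = x - b • (b₁ • A (x - y + c) + v + t • g) → v' = v + b • A (x - y + c) →
        y' = x' - (x - y + α • c) →
        lyapunov A ε (K x') (v' + t' • K m') + ‖y'‖ ^ 2 ≤
          lyapunov A ε (K x) (v + t • K m) - θ * (‖K x‖ ^ 2 + ‖v + t • K m‖ ^ 2)
            + ρ₁ * ‖y‖ ^ 2 + ρ₂ * ‖r⁻¹ • c - y‖ ^ 2
            + C * (t ^ 2 * ‖g - m‖ ^ 2 + t ^ 2 * ‖m - K m‖ ^ 2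
              + ‖t' • K m' - t • K m‖ ^ 2) := by
  have hhi : 0 < hi := hlo.trans_le hlh
  obtain ⟨ε, c₁, C₁, b₂, hε, hε1, hε2, hc₁, hC₁, hb₂, hstep⟩ :=
    exists_lyapunov_contraction hlo hlh hb₁
  have hαr1 : α * r < 1 := by rwa [lt_div_iff₀ hr] at hαr
  -- The lag contracts in expectation by `1 - α r φ = 1 - 2 τ`; Young's inequality with weight `τ`
  -- spends half of this rate on the motion of `x`.
  obtain ⟨τ, hτ⟩ : ∃ τ : ℝ, τ = α * r * φ / 2 := ⟨_, rfl⟩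
  have hτ0 : 0 < τ := by rw [hτ]; positivity
  have hτ1 : τ ≤ 1 / 2 := by
    have : α * r * φ ≤ 1 * 1 := by gcongr
    linarith
  obtain ⟨Sr, hSr⟩ : ∃ Sr : ℝ, Sr = 2 * r ^ 2 + 2 * (r - 1) ^ 2 := ⟨_, rfl⟩
  have hSr0 : 0 < Sr := by rw [hSr]; positivity
  obtain ⟨S₁, hS₁⟩ : ∃ S₁ : ℝ, S₁ = (1 + τ⁻¹) * 16 * (b₁ ^ 2 * hi ^ 2 + 1) := ⟨_, rfl⟩
  have hS₁0 : 0 < S₁ := by rw [hS₁]; positivity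
  obtain ⟨N, hN⟩ : ∃ N : ℝ, N = C₁ * (2 * (b₁ ^ 2 + 1) * hi ^ 2) := ⟨_, rfl⟩
  have hN0 : 0 < N := by rw [hN]; positivity
  obtain ⟨S₂, hS₂⟩ : ∃ S₂ : ℝ, S₂ = (N + S₁) * Sr := ⟨_, rfl⟩
  have hS₂0 : 0 < S₂ := by rw [hS₂]; positivity
  -- Besides `b₂`, the bound `c₁ / (2 * S₁)` makes the motion of `x` cost at most half of the
  -- consensus decay, and `τ / (4 * S₂)` makes the compression residual cost at most half of the
  -- remaining lag decay `τ`.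
  refine ⟨ε, min (min 1 b₂) (min (c₁ / (2 * S₁)) (τ / (4 * S₂))), hε, hε1, hε2, by positivity, ?_⟩
  intro b hb hbb
  have hb1 : b ≤ 1 := hbb.le.trans ((min_le_left _ _).trans (min_le_left _ _))
  have hbb₂ : b < b₂ := hbb.trans_le ((min_le_left _ _).trans (min_le_right _ _))
  have hbS₁ : b * (2 * S₁) ≤ c₁ := by
    rw [← le_div_iff₀ (by positivity)]
    exact hbb.le.trans ((min_le_right _ _).trans (min_le_left _ _))
  have hbS₂ : b * (4 * S₂) ≤ τ := by
    rw [← le_div_iff₀ (by positivity)]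
    exact hbb.le.trans ((min_le_right _ _).trans (min_le_right _ _))
  obtain ⟨Q, hQ⟩ : ∃ Q : ℝ, Q = b * C₁ * (2 * (1 + (b⁻¹) ^ 2)) := ⟨_, rfl⟩
  have hQ0 : 0 < Q := by rw [hQ]; positivity
  obtain ⟨C, hC⟩ : ∃ C : ℝ, C = Q + S₁ := ⟨_, rfl⟩
  have hC0 : 0 < C := by rw [hC]; positivity
  refine ⟨min (b * c₁ / 2) (τ / 2), C, (1 + τ) * (1 - α * r) + b * S₂, (1 + τ) * (α * r) + b * S₂,
    by positivity, (min_le_right _ _).trans (by linarith), hC0, by positivity, ?_, ?_⟩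
  · have h1 := min_le_right (b * c₁ / 2) (τ / 2)
    have h2 : 0 ≤ b * S₂ * φ := by positivity
    have h3 : (1 + τ) * (1 - α * r) + b * S₂ + ((1 + τ) * (α * r) + b * S₂) * (1 - φ)
      = (1 + τ) * (1 - 2 * τ) + 2 * (b * S₂) - b * S₂ * φ := by rw [hτ]; ring
    rw [h3]
    nlinarith
  intro E _ _ A K hAK t t' x v y c g m m' x' v' y' hv hx' hv' hy'
  obtain ⟨δ, hδ⟩ : ∃ δ : E, δ = c - y := ⟨_, rfl⟩
  have hxδ : x - y + c = x + δ := by rw [hδ]; abel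
  rw [hxδ] at hx' hv'
  have hδn : ‖δ‖ ^ 2 ≤ Sr * (‖y‖ ^ 2 + ‖r⁻¹ • c - y‖ ^ 2) := by
    rw [hδ, hSr]; exact compression_residual_sq_le hr.ne' c y
  obtain ⟨p, hp⟩ : ∃ p : E, p = t' • K m' - t • K m := ⟨_, rfl⟩
  have hAx : A x = A (K x) := (hAK.comp_right x).symm
  -- Splitting `K g = K m + K (g - m)` joins `t • K m` to `v`: the pair `(K x, v + t • K m)` then
  -- follows the dynamics of `exists_lyapunov_contraction`.
  have e1 : K x' = K x - b • (b₁ • A (K x) + (v + t • K m) - -(b₁ • A δ + t • K (g - m))) := by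
    rw [hx']
    simp only [map_sub, map_smul, map_add, hv, hAK.comp_left, hAK.comp_right]
    module
  have e2 : v' + t' • K m' = v + t • K m + b • (A (K x) + (A δ + b⁻¹ • p)) := by
    rw [hv', map_add, hAx, smul_add b (A (K x)), smul_add b (A (K x)), smul_add b (A δ), smul_inv_smul₀ hb.ne', hp]
    module
  have h1 := hstep E A K hAK b hb hbb₂ (K x) (v + t • K m) (-(b₁ • A δ + t • K (g - m)))
    (A δ + b⁻¹ • p) (hAK.idem x)
  rw [← e1, ← e2] at h1
  have h2 := consensus_disturbance_sq_le hAK (b := b) b₁ t δ (g - m) p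
  -- The new lag is a convex-type combination of the old lag and the rescaled compression error,
  -- plus the increment of `x`.
  have e3 : y' = ((1 - α * r) • y - (α * r) • (r⁻¹ • c - y))
      + -(b • (b₁ • A (K x) + (v + t • K m) + (b₁ • A δ + t • (g - m) + t • (m - K m)))) := by
    have hc : (α * r) • (r⁻¹ • c) = α • c := by
      rw [smul_smul, mul_assoc, mul_inv_cancel₀ hr.ne', mul_one]
    rw [hy', hx', map_add, hAx, smul_sub (α * r), hc]
    module
  have h3 := norm_add_sq_le_young ((1 - α * r) • y - (α * r) • (r⁻¹ • c - y))
    (-(b • (b₁ • A (K x) + (v + t • K m) + (b₁ • A δ + t • (g - m) + t • (m - K m))))) hτ0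
  rw [← e3, norm_neg] at h3
  have h4 := increment_sq_le hAK b b₁ t (K x) (v + t • K m) δ (g - m) (m - K m)
  have h5 := norm_convex_comb_sq_le y (r⁻¹ • c - y) (t := α * r) (by positivity) hαr1.le
  rw [← hp]
  have n1 := sq_nonneg ‖K x‖
  have n2 := sq_nonneg ‖v + t • K m‖
  have n3 := sq_nonneg ‖y‖
  have n4 := sq_nonneg ‖r⁻¹ • c - y‖
  have n5 := sq_nonneg ‖δ‖
  have n6 : 0 ≤ t ^ 2 * ‖g - m‖ ^ 2 := by positivity
  have n7 : 0 ≤ t ^ 2 * ‖m - K m‖ ^ 2 := by positivity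
  have n8 := sq_nonneg ‖p‖
  generalize lyapunov A ε (K x') (v' + t' • K m') = V' at *
  generalize lyapunov A ε (K x) (v + t • K m) = V at *
  generalize ‖-(b₁ • A δ + t • K (g - m))‖ ^ 2 + ‖A δ + b⁻¹ • p‖ ^ 2 = X₁ at *
  generalize ‖b • (b₁ • A (K x) + (v + t • K m) + (b₁ • A δ + t • (g - m) + t • (m - K m)))‖ ^ 2
    = X₂ at *
  generalize ‖(1 - α * r) • y - (α * r) • (r⁻¹ • c - y)‖ ^ 2 = X₃ at *
  generalize ‖K x‖ ^ 2 = X₄ at *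
  generalize ‖v + t • K m‖ ^ 2 = X₅ at *
  generalize ‖y‖ ^ 2 = X₆ at *
  generalize ‖r⁻¹ • c - y‖ ^ 2 = X₇ at *
  generalize ‖δ‖ ^ 2 = X₈ at *
  generalize t ^ 2 * ‖g - m‖ ^ 2 = X₉ at *
  generalize t ^ 2 * ‖m - K m‖ ^ 2 = X₁₀ at *
  generalize ‖p‖ ^ 2 = X₁₁ at *
  have k1 : b * C₁ * X₁ ≤ b * N * X₈ + Q * (X₉ + X₁₁) := by
    have := mul_le_mul_of_nonneg_left h2 (by positivity : 0 ≤ b * C₁)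
    rw [hN, hQ]
    linarith
  have k2 := mul_le_mul_of_nonneg_left h4 (by positivity : 0 ≤ 1 + τ⁻¹)
  have k3 := mul_le_mul_of_nonneg_left h5 (by positivity : 0 ≤ 1 + τ)
  have k4 : (1 + τ⁻¹) * (16 * b ^ 2 * ((b₁ ^ 2 * hi ^ 2 + 1) * (X₄ + X₅ + X₈) + X₉ + X₁₀)) ≤
      S₁ * b ^ 2 * (X₄ + X₅ + X₈) + S₁ * (X₉ + X₁₀) := by
    have k5 : (1 + τ⁻¹) * 16 * b ^ 2 * (X₉ + X₁₀) ≤ S₁ * (X₉ + X₁₀) := by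
      apply mul_le_mul_of_nonneg_right _ (by linarith)
      rw [hS₁]
      have hb2 : b ^ 2 ≤ 1 := pow_le_one₀ hb.le hb1
      have : 1 ≤ b₁ ^ 2 * hi ^ 2 + 1 := by have : 0 ≤ b₁ ^ 2 * hi ^ 2 := by positivity
                                           linarith
      gcongr
      exact hb2.trans this
    rw [hS₁] at k5 ⊢
    linarith only [k5]
  have k6 : S₁ * b ^ 2 * (X₄ + X₅) ≤ b * c₁ / 2 * (X₄ + X₅) := by
    apply mul_le_mul_of_nonneg_right _ (add_nonneg n1 n2)
    have := mul_le_mul_of_nonneg_left hbS₁ hb.le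
    linarith only [this]
  have k7 : b * N * X₈ + S₁ * b ^ 2 * X₈ ≤ b * S₂ * (X₆ + X₇) := by
    have l1 : b ^ 2 ≤ b := by rw [sq]; exact mul_le_of_le_one_left hb.le hb1
    have l2 : S₁ * b ^ 2 * X₈ ≤ S₁ * b * X₈ := by gcongr
    have l3 := mul_le_mul_of_nonneg_left hδn
      (by positivity : 0 ≤ b * (N + S₁))
    rw [hS₂]
    linarith only [l2, l3]
  have k8 : min (b * c₁ / 2) (τ / 2) * (X₄ + X₅) ≤ b * c₁ / 2 * (X₄ + X₅) :=
    mul_le_mul_of_nonneg_right (min_le_left _ _) (add_nonneg n1 n2)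
  have k9 : 0 ≤ S₁ * X₁₁ := by positivity
  have k10 : 0 ≤ Q * X₁₀ := by positivity
  rw [hC]
  linarith only [h1, h3, k1, k2, k3, k4, k6, k7, k8, k9, k10]

end OneStep

/-! ### Coupled scalar recursions and their rates -/

section Rates

/-- A bound `B / s ^ 2` therefore survives any recursion with contraction factor `1 - 3 / s`. -/
lemma inv_sq_sub_le {s : ℝ} (hs : 4 ≤ s) : (1 - 3 / s) * (1 / s ^ 2) ≤ 1 / (s + 1) ^ 2 := by
  have hs0 : 0 < s := by linarith
  have e : (1 - 3 / s) * (1 / s ^ 2) = (s - 3) / s ^ 3 := by field_simp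
  rw [e, div_le_div_iff₀ (by positivity) (by positivity)]
  nlinarith [sq_nonneg s]

/-- A nonnegative sequence that grows by the factors `1 + c / s ^ 2` is bounded. -/
lemma le_exp_of_growth {t c : ℝ} (ht : 4 ≤ t) (hc : 0 ≤ c) (U : ℕ → ℝ) (hU : ∀ k, 0 ≤ U k)
    (h : ∀ k : ℕ, U (k + 1) ≤ (1 + c / ((k : ℝ) + t) ^ 2) * U k) (k : ℕ) :
    U k ≤ U 0 * Real.exp (c / (t - 1)) := by
  have key : ∀ k : ℕ, U k ≤ U 0 * Real.exp (c * (1 / (t - 1) - 1 / ((k : ℝ) + t - 1))) := by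
    intro k
    induction k with
    | zero => simp
    | succ k ih =>
      have hs : 4 ≤ (k : ℝ) + t := by have : (0 : ℝ) ≤ k := k.cast_nonneg
                                      linarith
      push_cast
      set s := (k : ℝ) + t
      have e : (k : ℝ) + 1 + t - 1 = s := by simp only [s]; ring
      rw [e]
      refine (h k).trans ?_
      have h1 : 1 + c / s ^ 2 ≤ Real.exp (c / s ^ 2) := by
        rw [add_comm]; exact Real.add_one_le_exp _
      have h2 : c / s ^ 2 + c * (1 / (t - 1) - 1 / (s - 1)) ≤ c * (1 / (t - 1) - 1 / s) := by
        -- The exponents `c / s ^ 2` are summed by this telescoping bound.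
        have h3 : 1 / s ^ 2 ≤ 1 / (s - 1) - 1 / s := by
          have : 0 < s - 1 := by linarith
          have h0 : 0 < s := by linarith
          rw [div_sub_div _ _ this.ne' h0.ne', div_le_div_iff₀ (by positivity) (by positivity)]
          nlinarith
        have h4 := mul_le_mul_of_nonneg_left h3 hc
        rw [mul_one_div] at h4
        linarith
      calc (1 + c / s ^ 2) * U k
          ≤ Real.exp (c / s ^ 2) * (U 0 * Real.exp (c * (1 / (t - 1) - 1 / (s - 1)))) := by
            apply mul_le_mul h1 ih (hU k) (Real.exp_nonneg _)
        _ = U 0 * Real.exp (c / s ^ 2 + c * (1 / (t - 1) - 1 / (s - 1))) := by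
            rw [Real.exp_add]; ring
        _ ≤ _ := mul_le_mul_of_nonneg_left (Real.exp_le_exp.2 h2) (hU 0)
  refine (key k).trans (mul_le_mul_of_nonneg_left (Real.exp_le_exp.2 ?_) (hU 0))
  have h0 : 0 ≤ 1 / ((k : ℝ) + t - 1) := by
    have : (0 : ℝ) ≤ k := k.cast_nonneg
    exact div_nonneg zero_le_one (by linarith)
  rw [← mul_one_div c (t - 1)]
  exact mul_le_mul_of_nonneg_left (by linarith) hc

/-- The decay `θ V` absorbs the term `C / s * V` of the gap recursion, and the weight `1 / s ^ 2`
absorbs the growth `1 + 1 / s` of `M`, so only relative changes of order `1 / s ^ 2` remain. The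
summand `1` turns the additive forcing into a multiplicative one. -/
lemma growth_of_coupled {θ C D A s n V M a V' M' a' : ℝ} (hs : 4 ≤ s)
    (hC : 0 ≤ C) (hD : 0 ≤ D) (hA : 0 ≤ A) (hn : 1 ≤ n) (hCs : C ≤ θ * s) (hV : 0 ≤ V)
    (hM : 0 ≤ M) (ha : 0 ≤ a)
    (h1 : V' ≤ (1 - θ) * V + C / s ^ 2 * (a + V) + C / s ^ 4 * M + D / s ^ 2)
    (h2 : M' ≤ (1 + 1 / s) * M + (1 + s) / s ^ 2 * (C * (V + a) + D))
    (h3 : a' ≤ (1 - 4 / s) * a + C / s * V + A / (n * s ^ 2)) :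
    V' + M' / (s + 1) ^ 2 + a' + 1 ≤
      (1 + (2 * C + 2 * D + A) / s ^ 2) * (V + M / s ^ 2 + a + 1) := by
  have hs0 : 0 < s := by linarith
  have g1 : C / s * V ≤ θ * V := by
    apply mul_le_mul_of_nonneg_right _ hV
    rwa [div_le_iff₀ hs0]
  have g2 : 0 ≤ 4 / s * a := by positivity
  have g3 : A / (n * s ^ 2) ≤ A / s ^ 2 := by
    apply div_le_div_of_nonneg_left hA (by positivity)
    exact le_mul_of_one_le_left (by positivity) hn
  have g4 : M' / (s + 1) ^ 2 ≤ M / s ^ 2 + 1 / s ^ 2 * (C * (V + a) + D) := by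
    have e1 : (1 + 1 / s) / (s + 1) ^ 2 ≤ 1 / s ^ 2 := by
      rw [div_le_div_iff₀ (by positivity) (by positivity)]
      have : (1 + 1 / s) * s ^ 2 = s ^ 2 + s := by field_simp
      rw [this]; nlinarith
    have e2 : ((1 + s) / s ^ 2) / (s + 1) ^ 2 ≤ 1 / s ^ 2 := by
      rw [div_div, div_le_div_iff₀ (by positivity) (by positivity)]
      nlinarith [sq_nonneg s, pow_pos hs0 3]
    have w : 0 ≤ C * (V + a) + D := by positivity
    have e3 := mul_le_mul_of_nonneg_right e1 hM
    have e4 := mul_le_mul_of_nonneg_right e2 w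
    have e5 : M' / (s + 1) ^ 2 ≤
        ((1 + 1 / s) * M + (1 + s) / s ^ 2 * (C * (V + a) + D)) / (s + 1) ^ 2 := by gcongr
    have e6 : ((1 + 1 / s) * M + (1 + s) / s ^ 2 * (C * (V + a) + D)) / (s + 1) ^ 2
      = (1 + 1 / s) / (s + 1) ^ 2 * M + ((1 + s) / s ^ 2) / (s + 1) ^ 2 * (C * (V + a) + D) := by
      ring
    have e7 : 1 / s ^ 2 * M = M / s ^ 2 := by ring
    linarith
  have g5 : C / s ^ 4 * M = C / s ^ 2 * (M / s ^ 2) := by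
    field_simp
  have hm : 0 ≤ M / s ^ 2 := by positivity
  generalize M' / (s + 1) ^ 2 = m' at *
  generalize M / s ^ 2 = m at *
  have e8 : (1 + (2 * C + 2 * D + A) / s ^ 2) * (V + m + a + 1) = V + m + a + 1
      + (2 * (C / s ^ 2) + 2 * (D / s ^ 2) + A / s ^ 2) * (V + m + a + 1) := by ring
  have e9 : 1 / s ^ 2 * (C * (V + a) + D) = C / s ^ 2 * (V + a) + D / s ^ 2 := by ring
  rw [e8]
  rw [e9] at g4
  have p1 : 0 ≤ C / s ^ 2 * m := by positivity
  have p2 : 0 ≤ C / s ^ 2 := by positivity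
  have p3 : 0 ≤ (2 * (D / s ^ 2) + A / s ^ 2) * (V + m + a) := by positivity
  rw [g5] at h1
  linarith only [h1, g4, h3, g1, g2, g3, p1, p2, p3]

/-- The rates of the coupled recursions of consensus error `V`, squared gradients `M` and
optimality gap `a`. -/
lemma exists_rate_bound {θ C D A t : ℝ} (hθ : 0 < θ) (hθ1 : θ ≤ 1) (hC : 0 ≤ C)
    (hD : 0 ≤ D) (hA : 0 ≤ A) (ht : 4 ≤ t) (hCt : C ≤ θ * t) (ht6 : 6 ≤ θ * t) :
    ∃ B : ℝ, 0 ≤ B ∧ ∀ (n : ℝ) (V M a : ℕ → ℝ), 1 ≤ n → (∀ k, 0 ≤ V k) → (∀ k, 0 ≤ M k) →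
      (∀ k, 0 ≤ a k) → V 0 ≤ D → M 0 ≤ D → a 0 ≤ D →
      (∀ k : ℕ, V (k + 1) ≤ (1 - θ) * V k + C / ((k : ℝ) + t) ^ 2 * (a k + V k)
        + C / ((k : ℝ) + t) ^ 4 * M k + D / ((k : ℝ) + t) ^ 2) →
      (∀ k : ℕ, M (k + 1) ≤ (1 + 1 / ((k : ℝ) + t)) * M k
        + (1 + ((k : ℝ) + t)) / ((k : ℝ) + t) ^ 2 * (C * (V k + a k) + D)) →
      (∀ k : ℕ, a (k + 1) ≤ (1 - 4 / ((k : ℝ) + t)) * a k + C / ((k : ℝ) + t) * V k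
        + A / (n * ((k : ℝ) + t) ^ 2)) →
      ∀ k : ℕ, V k ≤ B / ((k : ℝ) + t) ^ 2 ∧
        a k ≤ A / (n * ((k : ℝ) + t)) + B / ((k : ℝ) + t) ^ 2 := by
  -- `3 * D + 1` bounds the initial value of `V + M / s ^ 2 + a + 1`; the exponential comes from
  -- `le_exp_of_growth`.
  obtain ⟨U, hU⟩ : ∃ U : ℝ, U = (3 * D + 1) * Real.exp ((2 * C + 2 * D + A) / (t - 1)) := ⟨_, rfl⟩
  have hU0 : 0 ≤ U := by rw [hU]; positivity
  obtain ⟨G, hG⟩ : ∃ G : ℝ, G = 3 * C * U + D := ⟨_, rfl⟩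
  have hG0 : 0 ≤ G := by rw [hG]; positivity
  -- With forcing at most `G / s ^ 2`, half of the decay `θ` balances it at level `2 * G / θ`; the
  -- other half exceeds `3 / s` and pays for the decrease of `1 / s ^ 2`. The term `D * t ^ 2`
  -- covers `k = 0`.
  obtain ⟨B₁, hB₁⟩ : ∃ B₁ : ℝ, B₁ = 2 * G / θ + D * t ^ 2 := ⟨_, rfl⟩
  have hB₁0 : 0 ≤ B₁ := by rw [hB₁]; positivity
  have ht0 : 0 < t := by linarith
  refine ⟨C * B₁ + B₁ + D * t ^ 2, by positivity, ?_⟩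
  intro n V M a hn hV hM ha V0 M0 a0 h1 h2 h3
  have hs : ∀ k : ℕ, t ≤ (k : ℝ) + t := fun k => by
    have : (0 : ℝ) ≤ k := k.cast_nonneg
    linarith
  have hbd : ∀ k : ℕ, V k + M k / ((k : ℝ) + t) ^ 2 + a k ≤ U := by
    intro k
    have h := le_exp_of_growth (c := 2 * C + 2 * D + A) ht (by positivity)
      (fun k => V k + M k / ((k : ℝ) + t) ^ 2 + a k + 1)
      (fun k => by have := hV k; have := hM k; have := ha k; positivity) (fun k => ?_) k
    · have h0 : M 0 / t ^ 2 ≤ D := by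
        refine (div_le_self (hM 0) ?_).trans M0
        exact one_le_pow₀ (by linarith)
      have h4 : V k + M k / ((k : ℝ) + t) ^ 2 + a k + 1 ≤ U := by
        refine h.trans ?_
        rw [hU]
        apply mul_le_mul_of_nonneg_right _ (Real.exp_nonneg _)
        simp only [Nat.cast_zero, zero_add]
        linarith
      linarith
    · have h4 := growth_of_coupled (ht.trans (hs k)) hC hD hA hn
        (hCt.trans (mul_le_mul_of_nonneg_left (hs k) hθ.le)) (hV k) (hM k) (ha k)
        (h1 k) (h2 k) (h3 k)
      have e : ((k + 1 : ℕ) : ℝ) + t = (k : ℝ) + t + 1 := by push_cast; ring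
      simpa only [e] using h4
  have hVr : ∀ k : ℕ, V k ≤ B₁ / ((k : ℝ) + t) ^ 2 := by
    intro k
    induction k with
    | zero =>
      rw [Nat.cast_zero, zero_add, le_div_iff₀ (by positivity)]
      have : V 0 * t ^ 2 ≤ D * t ^ 2 := by gcongr
      have : 0 ≤ 2 * G / θ := by positivity
      rw [hB₁]; linarith
    | succ k ih =>
      have e : ((k + 1 : ℕ) : ℝ) + t = (k : ℝ) + t + 1 := by push_cast; ring
      rw [e]
      have hk := h1 k
      have hb := hbd k
      have hts := hs k
      have v0 := hV k
      have m0 := hM k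
      have a0' := ha k
      generalize (k : ℝ) + t = s at *
      have hs4 : 4 ≤ s := ht.trans hts
      have hs0 : 0 < s := by linarith
      have g5 : C / s ^ 4 * M k = C / s ^ 2 * (M k / s ^ 2) := by field_simp
      have hm : 0 ≤ M k / s ^ 2 := by positivity
      have g6 : C / s ^ 2 * (a k + V k) + C / s ^ 2 * (M k / s ^ 2) ≤ C / s ^ 2 * U := by
        rw [← mul_add]; gcongr; linarith
      have g7 : (1 - θ) * V k ≤ (1 - θ) * (B₁ / s ^ 2) :=
        mul_le_mul_of_nonneg_left ih (by linarith)
      have g8 : C / s ^ 2 * U + D / s ^ 2 ≤ G / s ^ 2 := by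
        have : C / s ^ 2 * U + D / s ^ 2 = (C * U + D) / s ^ 2 := by ring
        rw [this, hG]; gcongr
        have : 0 ≤ C * U := by positivity
        linarith
      have g9 : G ≤ θ / 2 * B₁ := by
        have : θ / 2 * B₁ = G + θ / 2 * (D * t ^ 2) := by rw [hB₁]; field_simp
        rw [this]
        have : 0 ≤ θ / 2 * (D * t ^ 2) := by positivity
        linarith
      have g10 : G / s ^ 2 ≤ θ / 2 * (B₁ / s ^ 2) := by
        rw [← mul_div_assoc]; gcongr
      have g11 : 3 / s ≤ θ / 2 := by
        rw [div_le_iff₀ hs0]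
        have := mul_le_mul_of_nonneg_left hts hθ.le
        linarith
      have g12 : (1 - 3 / s) * (B₁ / s ^ 2) ≤ B₁ / (s + 1) ^ 2 := by
        have := mul_le_mul_of_nonneg_left (inv_sq_sub_le hs4) hB₁0
        have e1 : B₁ * ((1 - 3 / s) * (1 / s ^ 2)) = (1 - 3 / s) * (B₁ / s ^ 2) := by ring
        have e2 : B₁ * (1 / (s + 1) ^ 2) = B₁ / (s + 1) ^ 2 := by ring
        linarith
      have hBs : 0 ≤ B₁ / s ^ 2 := by positivity
      have g13 : 3 / s * (B₁ / s ^ 2) ≤ θ / 2 * (B₁ / s ^ 2) := by gcongr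
      linarith
  intro k
  refine ⟨(hVr k).trans ?_, ?_⟩
  · gcongr
    have : 0 ≤ C * B₁ + D * t ^ 2 := by positivity
    linarith
  induction k with
  | zero =>
    rw [Nat.cast_zero, zero_add]
    have h4 : a 0 ≤ (C * B₁ + B₁ + D * t ^ 2) / t ^ 2 := by
      rw [le_div_iff₀ (by positivity)]
      have : a 0 * t ^ 2 ≤ D * t ^ 2 := by gcongr
      have : 0 ≤ C * B₁ + B₁ := by positivity
      linarith
    have h5 : 0 ≤ A / (n * t) := by positivity
    linarith
  | succ k ih =>
    have e : ((k + 1 : ℕ) : ℝ) + t = (k : ℝ) + t + 1 := by push_cast; ring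
    rw [e]
    have hk := h3 k
    have hv := hVr k
    have hts := hs k
    generalize (k : ℝ) + t = s at *
    have hs4 : 4 ≤ s := ht.trans hts
    have hs0 : 0 < s := by linarith
    obtain ⟨B, hB⟩ : ∃ B : ℝ, B = C * B₁ + B₁ + D * t ^ 2 := ⟨_, rfl⟩
    rw [← hB] at ih ⊢
    have hB0 : 0 ≤ B := by rw [hB]; positivity
    have hCB : C * B₁ ≤ B := by
      rw [hB]
      have : 0 ≤ B₁ + D * t ^ 2 := by positivity
      linarith
    have hn0 : 0 < n := by linarith
    have h41 : 4 / s ≤ 1 := by rw [div_le_one hs0]; exact hs4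
    have g1 := mul_le_mul_of_nonneg_left ih (by linarith : 0 ≤ 1 - 4 / s)
    have g2 : C / s * V k ≤ 1 / s * (B / s ^ 2) := by
      calc C / s * V k ≤ C / s * (B₁ / s ^ 2) := by gcongr
        _ = 1 / s * ((C * B₁) / s ^ 2) := by ring
        _ ≤ _ := by gcongr
    have g12 : (1 - 3 / s) * (B / s ^ 2) ≤ B / (s + 1) ^ 2 := by
      have := mul_le_mul_of_nonneg_left (inv_sq_sub_le hs4) hB0
      have e1 : B * ((1 - 3 / s) * (1 / s ^ 2)) = (1 - 3 / s) * (B / s ^ 2) := by ring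
      have e2 : B * (1 / (s + 1) ^ 2) = B / (s + 1) ^ 2 := by ring
      linarith
    -- The leading term reproduces itself with the same constant `A`, since `(s - 3) * (s + 1) ≤ s ^
    -- 2`. Nothing from the consensus error leaks into it.
    have g13 : (1 - 4 / s) * (A / (n * s)) + A / (n * s ^ 2) ≤ A / (n * (s + 1)) := by
      have e1 : (1 - 4 / s) * (A / (n * s)) + A / (n * s ^ 2) = A / n * ((s - 3) / s ^ 2) := by
        field_simp; ring
      have e2 : A / (n * (s + 1)) = A / n * (1 / (s + 1)) := by field_simp
      rw [e1, e2]
      apply mul_le_mul_of_nonneg_left _ (by positivity)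
      rw [div_le_div_iff₀ (by positivity) (by positivity)]
      nlinarith
    have e3 : (1 - 4 / s) * (B / s ^ 2) + 1 / s * (B / s ^ 2) = (1 - 3 / s) * (B / s ^ 2) := by ring
    linarith

end Rates

/-! ### The stacked space and the spectrum of the Laplacian -/

section Network

variable {n d : ℕ}

/-- The stacked decision space of all agents. -/
abbrev Net (n d : ℕ) := PiLp 2 (fun _ : Fin n => Vec d)

/-- The stacked vector of a family of vectors. -/
abbrev stack (u : Fin n → Vec d) : Net n d := WithLp.toLp 2 u

/-- A matrix acting on the agent index. -/
def agentOp (L : Matrix (Fin n) (Fin n) ℝ) : Net n d →ₗ[ℝ] Net n d where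
  toFun u := stack fun i => ∑ j, L i j • u j
  map_add' u v := by
    ext i c
    simp [Finset.sum_add_distrib]
  map_smul' t u := by
    ext i c
    simp [Finset.mul_sum, mul_left_comm]

/-- The deviation from the average of the agents. -/
def deviation : Net n d →ₗ[ℝ] Net n d where
  toFun u := stack fun i => u i - avg u.ofLp
  map_add' u v := by
    ext i c
    simp [avg, Finset.sum_add_distrib]
    ring
  map_smul' t u := by
    ext i c
    simp [avg, Finset.mul_sum, mul_sub, mul_left_comm]

@[simp] lemma agentOp_apply (L : Matrix (Fin n) (Fin n) ℝ) (u : Net n d) (i : Fin n) :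
    agentOp L u i = ∑ j, L i j • u j := rfl

@[simp] lemma deviation_apply (u : Net n d) (i : Fin n) : deviation u i = u i - avg u.ofLp := rfl

lemma net_norm_sq (u : Net n d) : ‖u‖ ^ 2 = ∑ i, ‖u i‖ ^ 2 := PiLp.norm_sq_eq_of_L2 _ u

lemma net_norm_sq_coord (u : Net n d) : ‖u‖ ^ 2 = ∑ c, ∑ i, u i c ^ 2 := by
  rw [net_norm_sq, Finset.sum_comm]
  exact Finset.sum_congr rfl fun i _ => EuclideanSpace.real_norm_sq_eq (u i)

lemma net_inner_coord (u v : Net n d) : inner ℝ u v = ∑ c, ∑ i, u i c * v i c := by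
  rw [PiLp.inner_apply, Finset.sum_comm]
  refine Finset.sum_congr rfl fun i _ => ?_
  rw [PiLp.inner_apply]
  exact Finset.sum_congr rfl fun c _ => by simp [mul_comm]

lemma laplacian_mulVec (W : Matrix (Fin n) (Fin n) ℝ) (u : Fin n → ℝ) (i : Fin n) :
    ∑ j, laplacian W i j * u j = ∑ j, W i j * (u i - u j) := by
  simp [laplacian, sub_mul, mul_sub, Finset.sum_sub_distrib, Matrix.diagonal_apply,
    Finset.sum_mul]

lemma laplacian_quadratic {W : Matrix (Fin n) (Fin n) ℝ} (hW : ∀ i j, W i j = W j i)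
    (u : Fin n → ℝ) :
    ∑ i, u i * ∑ j, laplacian W i j * u j = 1 / 2 * ∑ i, ∑ j, W i j * (u i - u j) ^ 2 := by
  have h1 : ∑ i, u i * ∑ j, laplacian W i j * u j = ∑ i, ∑ j, W i j * (u i * (u i - u j)) := by
    refine Finset.sum_congr rfl fun i _ => ?_
    rw [laplacian_mulVec, Finset.mul_sum]
    exact Finset.sum_congr rfl fun j _ => by ring
  have h2 : ∑ i, ∑ j, W i j * (u i * (u i - u j)) = ∑ i, ∑ j, W i j * (u j * (u j - u i)) := by
    rw [Finset.sum_comm]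
    exact Finset.sum_congr rfl fun i _ => Finset.sum_congr rfl fun j _ => by rw [hW j i]
  have h3 : ∑ i, ∑ j, W i j * (u i - u j) ^ 2 =
      ∑ i, ∑ j, W i j * (u i * (u i - u j)) + ∑ i, ∑ j, W i j * (u j * (u j - u i)) := by
    rw [← Finset.sum_add_distrib]
    refine Finset.sum_congr rfl fun i _ => ?_
    rw [← Finset.sum_add_distrib]
    exact Finset.sum_congr rfl fun j _ => by ring
  rw [h1, h3, ← h2]
  ring

/-- The quadratic form is half the sum of `W i j * (u i - u j) ^ 2`, so its vanishing equates `u`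
across every edge, and connectedness propagates this along walks. -/
lemma eq_of_laplacian_quadratic_eq_zero {W : Matrix (Fin n) (Fin n) ℝ}
    (hW : IsConnectedCoupling W) {u : Fin n → ℝ}
    (hu : ∑ i, u i * ∑ j, laplacian W i j * u j = 0) (i j : Fin n) : u i = u j := by
  have hnn : ∀ i j, 0 ≤ W i j * (u i - u j) ^ 2 := fun i j =>
    mul_nonneg (hW.nonneg i j) (sq_nonneg _)
  have h0 : ∑ i, ∑ j, W i j * (u i - u j) ^ 2 = 0 := by
    have := laplacian_quadratic hW.symm u
    linarith
  have h1 : ∀ i j, W i j * (u i - u j) ^ 2 = 0 := by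
    intro i j
    have h2 := (Finset.sum_eq_zero_iff_of_nonneg
      (fun i _ => Finset.sum_nonneg fun j _ => hnn i j)).1 h0 i (Finset.mem_univ _)
    exact (Finset.sum_eq_zero_iff_of_nonneg (fun j _ => hnn i j)).1 h2 j (Finset.mem_univ _)
  have hadj : ∀ i j, (commGraph W).Adj i j → u i = u j := by
    intro i j hij
    rw [commGraph, SimpleGraph.fromRel_adj] at hij
    have hp : 0 < W i j := by
      rcases hij.2 with h | h
      · exact h
      · rwa [hW.symm i j]
    have := h1 i j
    rcases mul_eq_zero.1 this with h | h
    · exact absurd h hp.ne'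
    · exact sub_eq_zero.1 (pow_eq_zero_iff (two_ne_zero) |>.1 h)
  obtain ⟨p⟩ := hW.connected.preconnected i j
  induction p with
  | nil => rfl
  | cons h _ ih => exact (hadj _ _ h).trans ih

lemma laplacian_isHermitian {W : Matrix (Fin n) (Fin n) ℝ} (hW : ∀ i j, W i j = W j i) :
    (laplacian W).IsHermitian := by
  ext i j
  simp only [laplacian, Matrix.conjTranspose_apply, Matrix.sub_apply, star_trivial, hW j i,
    Matrix.diagonal_apply]
  by_cases h : i = j
  · subst h; simp
  · simp [h, Ne.symm h]

/-- The positive part of the spectrum controls the Laplacian quadratic form and norm. -/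
lemma laplacian_spectral_bounds {W : Matrix (Fin n) (Fin n) ℝ} {lo hi : ℝ}
    (hlo : 0 < lo) (hlh : lo ≤ hi) (hW : IsConnectedCoupling W)
    (hev : PosEigenvaluesIn (laplacian W) lo hi) (u : Fin n → ℝ) :
    (∑ i, u i = 0 → lo * ∑ i, u i ^ 2 ≤ ∑ i, u i * ∑ j, laplacian W i j * u j) ∧
      ∑ i, (∑ j, laplacian W i j * u j) ^ 2 ≤ hi ^ 2 * ∑ i, u i ^ 2 := by
  have hL := laplacian_isHermitian hW.symm
  set b := hL.eigenvectorBasis with hb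
  set ev := hL.eigenvalues with hev'
  have hmul : ∀ j, (laplacian W).mulVec (b j).ofLp = ev j • (b j).ofLp :=
    hL.mulVec_eigenvectorBasis
  have hmul' : ∀ j i, ∑ k, laplacian W i k * b j k = ev j * b j i := by
    intro j i
    have := congrFun (hmul j) i
    simpa [Matrix.mulVec, dotProduct] using this
  have hbn : ∀ j, ∑ i, b j i ^ 2 = 1 := by
    intro j
    rw [← EuclideanSpace.real_norm_sq_eq, b.orthonormal.1 j, one_pow]
  have hquad : ∀ j, ∑ i, b j i * ∑ k, laplacian W i k * b j k = ev j := by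
    intro j
    simp_rw [hmul', mul_left_comm _ (ev j)]
    rw [← Finset.mul_sum]
    simp_rw [← sq]
    rw [hbn, mul_one]
  have hnn : ∀ j, 0 ≤ ev j := by
    intro j
    rw [← hquad, laplacian_quadratic hW.symm]
    have : 0 ≤ ∑ i, ∑ k, W i k * (b j i - b j k) ^ 2 :=
      Finset.sum_nonneg fun i _ => Finset.sum_nonneg fun k _ =>
        mul_nonneg (hW.nonneg i k) (sq_nonneg _)
    positivity
  have hrange : ∀ j, ev j = 0 ∨ lo ≤ ev j ∧ ev j ≤ hi := by
    intro j
    rcases (hnn j).eq_or_lt with h | h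
    · exact Or.inl h.symm
    · refine Or.inr (hev _ ?_ h)
      refine Module.End.hasEigenvalue_of_hasEigenvector (x := (b j).ofLp) ⟨?_, ?_⟩
      · rw [Module.End.mem_eigenspace_iff, Matrix.toLin'_apply]
        exact hmul j
      · intro h0
        have := hbn j
        simp [h0] at this
  set U : EuclideanSpace ℝ (Fin n) := WithLp.toLp 2 u with hU
  set LU : EuclideanSpace ℝ (Fin n) := WithLp.toLp 2 (fun i => ∑ j, laplacian W i j * u j) with hLU
  have hsymm : ∀ i k, laplacian W i k = laplacian W k i := fun i k => by
    have := congrFun (congrFun hL k) i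
    simpa using this
  have hc : ∀ j, inner ℝ (b j) LU = ev j * inner ℝ (b j) U := by
    intro j
    simp only [PiLp.inner_apply, hLU, hU, RCLike.inner_apply, conj_trivial]
    simp_rw [Finset.sum_mul]
    rw [Finset.sum_comm, Finset.mul_sum]
    refine Finset.sum_congr rfl fun k _ => ?_
    have := hmul' j k
    rw [mul_left_comm, ← this, Finset.mul_sum]
    exact Finset.sum_congr rfl fun i _ => by rw [hsymm i k]; ring
  have hUn : ∑ i, u i ^ 2 = ∑ j, (inner ℝ (b j) U) ^ 2 := by
    have := b.sum_sq_norm_inner_right U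
    simp only [Real.norm_eq_abs, sq_abs] at this
    rw [this, EuclideanSpace.real_norm_sq_eq]
  have hLUn : ∑ i, (∑ j, laplacian W i j * u j) ^ 2 = ∑ j, (ev j * inner ℝ (b j) U) ^ 2 := by
    have := b.sum_sq_norm_inner_right LU
    simp only [Real.norm_eq_abs, sq_abs, hc] at this
    rw [this, EuclideanSpace.real_norm_sq_eq]
  have hULU : ∑ i, u i * ∑ j, laplacian W i j * u j = ∑ j, ev j * (inner ℝ (b j) U) ^ 2 := by
    have := b.sum_inner_mul_inner U LU
    have e : inner ℝ U LU = ∑ i, u i * ∑ j, laplacian W i j * u j := by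
      simp only [PiLp.inner_apply, hLU, hU, RCLike.inner_apply, conj_trivial, mul_comm]
    rw [← e, ← this]
    refine Finset.sum_congr rfl fun j _ => ?_
    rw [hc, real_inner_comm]
    ring
  constructor
  · intro hsum
    rw [hULU, hUn, Finset.mul_sum]
    refine Finset.sum_le_sum fun j _ => ?_
    rcases hrange j with h | h
    -- An eigenvector for the eigenvalue `0` is constant, hence orthogonal to every vector of zero
    -- sum.
    · have hconst := eq_of_laplacian_quadratic_eq_zero hW ((hquad j).trans h)
      have h0 : inner ℝ (b j) U = 0 := by
        simp only [PiLp.inner_apply, hU, RCLike.inner_apply, conj_trivial]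
        rcases isEmpty_or_nonempty (Fin n) with _ | ⟨⟨i₀⟩⟩
        · simp
        · simp_rw [hconst _ i₀]
          rw [← Finset.sum_mul, hsum, zero_mul]
      rw [h0, h]; simp
    · exact mul_le_mul_of_nonneg_right h.1 (sq_nonneg _)
  · rw [hLUn, hUn, Finset.mul_sum]
    refine Finset.sum_le_sum fun j _ => ?_
    rw [mul_pow]
    apply mul_le_mul_of_nonneg_right _ (sq_nonneg _)
    have : ev j ≤ hi := by
      rcases hrange j with h | h
      · rw [h]; linarith
      · exact h.2
    exact pow_le_pow_left₀ (hnn j) this 2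

lemma sum_sub_avg (hn : n ≠ 0) (u : Fin n → Vec d) : ∑ i, (u i - avg u) = 0 := by
  have : (n : ℝ) ≠ 0 := Nat.cast_ne_zero.2 hn
  rw [Finset.sum_sub_distrib, Finset.sum_const, Finset.card_univ, Fintype.card_fin, avg,
    ← Nat.cast_smul_eq_nsmul ℝ, smul_smul, mul_one_div_cancel this, one_smul, sub_self]

lemma avg_sub_avg (hn : n ≠ 0) (u : Fin n → Vec d) : avg (fun i => u i - avg u) = 0 := by
  rw [avg, sum_sub_avg hn, smul_zero]

lemma sum_norm_sub_avg_sq (hn : n ≠ 0) (u : Fin n → Vec d) :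
    ∑ i, ‖u i‖ ^ 2 = ∑ i, ‖u i - avg u‖ ^ 2 + n * ‖avg u‖ ^ 2 := by
  have h : ∀ i, ‖u i‖ ^ 2 = ‖u i - avg u‖ ^ 2 + 2 * inner ℝ (u i - avg u) (avg u)
      + ‖avg u‖ ^ 2 := by
    intro i
    rw [← norm_add_sq_real, sub_add_cancel]
  simp_rw [h]
  rw [Finset.sum_add_distrib, Finset.sum_add_distrib, ← Finset.mul_sum, ← sum_inner,
    sum_sub_avg hn]
  simp

lemma net_norm_sub_deviation_sq (u : Net n d) :
    ‖u - deviation u‖ ^ 2 = n * ‖avg u.ofLp‖ ^ 2 := by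
  rw [net_norm_sq]
  simp

lemma net_norm_deviation_sq (hn : n ≠ 0) (u : Net n d) :
    ‖u‖ ^ 2 = ‖deviation u‖ ^ 2 + n * ‖avg u.ofLp‖ ^ 2 := by
  rw [net_norm_sq, net_norm_sq, sum_norm_sub_avg_sq hn]
  simp

lemma laplacian_row_sum (W : Matrix (Fin n) (Fin n) ℝ) (i : Fin n) :
    ∑ j, laplacian W i j = 0 := by
  simpa using laplacian_mulVec W (fun _ => 1) i

lemma avg_agentOp_laplacian {W : Matrix (Fin n) (Fin n) ℝ} (hW : ∀ i j, W i j = W j i)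
    (u : Fin n → Vec d) : avg (fun i => ∑ j, laplacian W i j • u j) = 0 := by
  have hL := laplacian_isHermitian hW
  have hsymm : ∀ i k, laplacian W i k = laplacian W k i := fun i k => by
    have := congrFun (congrFun hL k) i
    simpa using this
  rw [avg, Finset.sum_comm]
  have : ∀ j, ∑ i, laplacian W i j • u j = 0 := by
    intro j
    rw [← Finset.sum_smul]
    simp_rw [hsymm _ j]
    rw [laplacian_row_sum, zero_smul]
  simp [this]

/-- The Laplacian of a connected network and the deviation operator form a consensus pair. -/
lemma isConsensusPair_laplacian {W : Matrix (Fin n) (Fin n) ℝ} {lo hi : ℝ}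
    (hlo : 0 < lo) (hlh : lo ≤ hi) (hW : IsConnectedCoupling W)
    (hev : PosEigenvaluesIn (laplacian W) lo hi) :
    IsConsensusPair (agentOp (laplacian W) : Net n d →ₗ[ℝ] Net n d) deviation lo hi := by
  have hn : n ≠ 0 := by
    rintro rfl
    exact hW.connected.nonempty.elim fun i => i.elim0
  have hL := laplacian_isHermitian hW.symm
  have hsymm : ∀ i k, laplacian W i k = laplacian W k i := fun i k => by
    have := congrFun (congrFun hL k) i
    simpa using this
  have hcr : ∀ x : Net n d, agentOp (laplacian W) (deviation x) = agentOp (laplacian W) x := by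
    intro x
    refine PiLp.ext fun i => ?_
    simp only [agentOp_apply, deviation_apply, smul_sub, Finset.sum_sub_distrib]
    rw [← Finset.sum_smul, laplacian_row_sum, zero_smul, sub_zero]
  have hcoord : ∀ (x : Net n d) i c,
      agentOp (laplacian W) x i c = ∑ j, laplacian W i j * x j c := by
    intro x i c
    simp
  have hsy : ∀ x y : Net n d, inner ℝ (agentOp (laplacian W) x) y
      = inner ℝ x (agentOp (laplacian W) y) := by
    intro x y
    rw [net_inner_coord, net_inner_coord]
    refine Finset.sum_congr rfl fun c _ => ?_
    simp_rw [hcoord, Finset.sum_mul, Finset.mul_sum]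
    rw [Finset.sum_comm]
    exact Finset.sum_congr rfl fun i _ => Finset.sum_congr rfl fun j _ => by
      rw [hsymm i j]; ring
  refine ⟨hsy, hcr, ?_, ?_, ?_, ?_, ?_, ?_⟩
  · intro x
    refine PiLp.ext fun i => ?_
    rw [deviation_apply]
    have : avg (agentOp (laplacian W) x).ofLp = 0 := avg_agentOp_laplacian hW.symm _
    rw [this, sub_zero]
  · intro x
    refine PiLp.ext fun i => ?_
    rw [deviation_apply]
    have : avg (deviation x).ofLp = 0 := avg_sub_avg hn _
    rw [this, sub_zero]
  · intro x
    refine abs_le_of_sq_le_sq' ?_ (norm_nonneg _) |>.2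
    rw [net_norm_deviation_sq hn x]
    have : 0 ≤ (n : ℝ) * ‖avg x.ofLp‖ ^ 2 := by positivity
    linarith
  · intro x
    refine abs_le_of_sq_le_sq' ?_ (norm_nonneg _) |>.2
    rw [net_norm_deviation_sq hn x, net_norm_sub_deviation_sq]
    have := sq_nonneg ‖deviation x‖
    linarith
  · intro x
    -- Passing to the deviation gives every coordinate zero sum, as the spectral lower bound
    -- requires.
    have e : inner ℝ x (agentOp (laplacian W) x)
        = inner ℝ (deviation x) (agentOp (laplacian W) (deviation x)) := by
      rw [hcr, ← hsy, ← hcr x, hsy, hcr]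
    rw [e, net_inner_coord, net_norm_sq_coord, Finset.mul_sum]
    refine Finset.sum_le_sum fun c _ => ?_
    simp_rw [hcoord]
    refine (laplacian_spectral_bounds hlo hlh hW hev fun i => deviation x i c).1 ?_
    have := congrArg (fun v : Vec d => v c) (sum_sub_avg hn x.ofLp)
    simpa using this
  · intro x
    refine abs_le_of_sq_le_sq' ?_ (mul_nonneg (by linarith) (norm_nonneg _)) |>.2
    rw [mul_pow, net_norm_sq_coord, net_norm_sq_coord, Finset.mul_sum]
    refine Finset.sum_le_sum fun c _ => ?_
    simp_rw [hcoord]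
    exact (laplacian_spectral_bounds hlo hlh hW hev fun i => x i c).2

end Network

/-! ### Descent for functions with Lipschitz gradient -/

section Smooth

variable {d : ℕ}

lemma hasDerivAt_along {f : Vec d → ℝ} (hf : Differentiable ℝ f) (x w : Vec d) (t : ℝ) :
    HasDerivAt (fun t : ℝ => f (x + t • w)) (inner ℝ (gradient f (x + t • w)) w) t := by
  have h1 : HasFDerivAt f (InnerProductSpace.toDual ℝ (Vec d) (gradient f (x + t • w)))
      (x + t • w) := (hf _).hasGradientAt.hasFDerivAt
  have h2 : HasDerivAt (fun t : ℝ => x + t • w) w t := by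
    simpa using ((hasDerivAt_id t).smul_const w).const_add x
  have h3 := h1.comp_hasDerivAt t h2
  simpa [Function.comp_def] using h3

/-- The quadratic upper bound of a function with Lipschitz gradient. -/
lemma le_quadratic_of_lipschitz_gradient {f : Vec d → ℝ} {L : ℝ} (hf : Differentiable ℝ f)
    (hL : ∀ x y, ‖gradient f x - gradient f y‖ ≤ L * ‖x - y‖) (x w : Vec d) :
    f (x + w) ≤ f x + inner ℝ (gradient f x) w + L / 2 * ‖w‖ ^ 2 := by
  -- The claim is `ψ 1 ≤ ψ 0`; Lipschitz continuity of the gradient makes `ψ` decreasing on the unit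
  -- interval.
  set ψ : ℝ → ℝ := fun t => f (x + t • w) - t * inner ℝ (gradient f x) w
    - L / 2 * ‖w‖ ^ 2 * t ^ 2 with hψ
  have hd : ∀ t, HasDerivAt ψ (inner ℝ (gradient f (x + t • w)) w - inner ℝ (gradient f x) w
      - L * ‖w‖ ^ 2 * t) t := by
    intro t
    have h1 := hasDerivAt_along hf x w t
    have h2 : HasDerivAt (fun t : ℝ => t * inner ℝ (gradient f x) w)
        (inner ℝ (gradient f x) w) t := by
      simpa using (hasDerivAt_id t).mul_const (inner ℝ (gradient f x) w)
    have h3 : HasDerivAt (fun t : ℝ => L / 2 * ‖w‖ ^ 2 * t ^ 2) (L * ‖w‖ ^ 2 * t) t := by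
      have e : L * ‖w‖ ^ 2 * t = L / 2 * ‖w‖ ^ 2 * (((2 : ℕ) : ℝ) * t ^ (2 - 1)) := by
        norm_num; ring
      rw [e]
      exact (hasDerivAt_pow 2 t).const_mul (L / 2 * ‖w‖ ^ 2)
    exact (h1.sub h2).sub h3
  have hanti : AntitoneOn ψ (Set.Icc 0 1) := by
    refine antitoneOn_of_deriv_nonpos (convex_Icc 0 1)
      (fun t _ => (hd t).continuousAt.continuousWithinAt)
      (fun t _ => (hd t).differentiableAt.differentiableWithinAt) fun t ht => ?_
    rw [interior_Icc] at ht
    rw [(hd t).deriv, ← inner_sub_left]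
    have h1 := real_inner_le_norm (gradient f (x + t • w) - gradient f x) w
    have h2 := hL (x + t • w) x
    rw [add_sub_cancel_left, norm_smul, Real.norm_eq_abs, abs_of_pos ht.1] at h2
    have h3 := mul_le_mul_of_nonneg_right h2 (norm_nonneg w)
    nlinarith
  have := hanti (Set.left_mem_Icc.2 zero_le_one) (Set.right_mem_Icc.2 zero_le_one) zero_le_one
  simp only [hψ, one_smul, zero_smul, add_zero] at this
  linarith

/-- A gradient step of length `L⁻¹` cannot go below the infimum. -/
lemma norm_gradient_sq_le {f : Vec d → ℝ} {L : ℝ} (hL0 : 0 < L) (hf : Differentiable ℝ f)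
    (hL : ∀ x y, ‖gradient f x - gradient f y‖ ≤ L * ‖x - y‖) (hb : BddBelow (Set.range f))
    (x : Vec d) : ‖gradient f x‖ ^ 2 ≤ 2 * L * (f x - ⨅ y, f y) := by
  have h1 := le_quadratic_of_lipschitz_gradient hf hL x (-(L⁻¹) • gradient f x)
  have h2 := ciInf_le hb (x + -(L⁻¹) • gradient f x)
  rw [norm_smul_sq, inner_smul_right, real_inner_self_eq_norm_sq] at h1
  have h3 : -L⁻¹ * ‖gradient f x‖ ^ 2 + L / 2 * ((-L⁻¹) ^ 2 * ‖gradient f x‖ ^ 2)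
      = -(1 / (2 * L)) * ‖gradient f x‖ ^ 2 := by
    field_simp; ring
  have h4 : 1 / (2 * L) * ‖gradient f x‖ ^ 2 ≤ f x - ⨅ y, f y := by linarith
  calc ‖gradient f x‖ ^ 2 = 2 * L * (1 / (2 * L) * ‖gradient f x‖ ^ 2) := by field_simp
    _ ≤ _ := mul_le_mul_of_nonneg_left h4 (by positivity)

/-- The descent inequality for a perturbed gradient step. -/
lemma perturbed_descent {f : Vec d → ℝ} {L η : ℝ} (hf : Differentiable ℝ f)
    (hL : ∀ x y, ‖gradient f x - gradient f y‖ ≤ L * ‖x - y‖) (hη : 0 ≤ η) (hηL : η * L ≤ 1)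
    (x p w : Vec d) :
    f (x - η • (p + w)) ≤ f x - η / 2 * ‖gradient f x‖ ^ 2 + η / 2 * ‖gradient f x - p‖ ^ 2
      + inner ℝ ((L * η ^ 2) • p - η • gradient f x) w + L * η ^ 2 / 2 * ‖w‖ ^ 2 := by
  have h1 := le_quadratic_of_lipschitz_gradient hf hL x (-(η • (p + w)))
  rw [← sub_eq_add_neg, norm_neg, norm_smul_sq, inner_neg_right, inner_smul_right,
    inner_add_right, norm_add_sq_real] at h1
  rw [norm_sub_sq_real, inner_sub_left, inner_smul_left, inner_smul_left]
  simp only [conj_trivial]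
  -- Polarization of `⟨∇f, p⟩` leaves a spare `-(η / 2) ‖p‖²`, which pays for the quadratic term
  -- because `η * L ≤ 1`.
  have h2 : L * η ^ 2 / 2 * ‖p‖ ^ 2 ≤ η / 2 * ‖p‖ ^ 2 := by
    apply mul_le_mul_of_nonneg_right _ (sq_nonneg _)
    nlinarith
  linarith

end Smooth

/-! ### Local and global gradients -/

section Costs

variable {n d : ℕ} {Ξ : Fin n → Type u} [∀ i, MeasurableSpace (Ξ i)]

/-- The optimality gap `f(x) - f^*`. -/
def gap (𝒟 : ∀ i, Measure (Ξ i)) (F : ∀ i, Vec d → Ξ i → ℝ) (x : Vec d) : ℝ :=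
  globalCost 𝒟 F x - optValue 𝒟 F

/-- All local gradients at a common point. -/
def gradStack (𝒟 : ∀ i, Measure (Ξ i)) (F : ∀ i, Vec d → Ξ i → ℝ) (x : Vec d) : Net n d :=
  stack fun i => gradient (localCost 𝒟 F i) x

/-- The local gradients at the estimates of the agents. -/
def localGrads (𝒟 : ∀ i, Measure (Ξ i)) (F : ∀ i, Vec d → Ξ i → ℝ) (x : Net n d) : Net n d :=
  stack fun i => gradient (localCost 𝒟 F i) (x i)

variable {𝒟 : ∀ i, Measure (Ξ i)} {F : ∀ i, Vec d → Ξ i → ℝ} {Lf ν : ℝ}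

lemma hasGradientAt_globalCost (hS : IsSmoothProblem 𝒟 F Lf) (x : Vec d) :
    HasGradientAt (globalCost 𝒟 F) (avg fun i => gradient (localCost 𝒟 F i) x) x := by
  rw [hasGradientAt_iff_hasFDerivAt]
  have h := (HasFDerivAt.fun_sum (u := Finset.univ) fun i _ =>
    (hS.differentiable i x).hasGradientAt.hasFDerivAt).const_mul (1 / (n : ℝ))
  have e : InnerProductSpace.toDual ℝ (Vec d) (avg fun i => gradient (localCost 𝒟 F i) x)
      = (1 / (n : ℝ)) • ∑ i, InnerProductSpace.toDual ℝ (Vec d) (gradient (localCost 𝒟 F i) x) := by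
    simp only [avg, map_smul, map_sum]
  rw [e]
  exact h

lemma gradient_globalCost (hS : IsSmoothProblem 𝒟 F Lf) (x : Vec d) :
    gradient (globalCost 𝒟 F) x = avg (gradStack 𝒟 F x).ofLp :=
  (hasGradientAt_globalCost hS x).gradient

lemma differentiable_globalCost (hS : IsSmoothProblem 𝒟 F Lf) :
    Differentiable ℝ (globalCost 𝒟 F) := fun x =>
  (hasGradientAt_globalCost hS x).hasFDerivAt.differentiableAt

lemma card_mul_norm_avg_sq_le (hn : n ≠ 0) (u : Net n d) : n * ‖avg u.ofLp‖ ^ 2 ≤ ‖u‖ ^ 2 := by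
  have := net_norm_deviation_sq hn u
  have := sq_nonneg ‖deviation u‖
  linarith

lemma avg_sub (u v : Net n d) : avg (u - v).ofLp = avg u.ofLp - avg v.ofLp := by
  simp [avg, Finset.sum_sub_distrib, smul_sub]

lemma avg_add (u v : Net n d) : avg (u + v).ofLp = avg u.ofLp + avg v.ofLp := by
  simp [avg, Finset.sum_add_distrib]

lemma norm_gradStack_sub_sq_le (hS : IsSmoothProblem 𝒟 F Lf) (x y : Vec d) :
    ‖gradStack 𝒟 F x - gradStack 𝒟 F y‖ ^ 2 ≤ n * (Lf ^ 2 * ‖x - y‖ ^ 2) := by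
  rw [net_norm_sq]
  have : ∀ i ∈ Finset.univ, ‖(gradStack 𝒟 F x - gradStack 𝒟 F y) i‖ ^ 2 ≤ Lf ^ 2 * ‖x - y‖ ^ 2 := by
    intro i _
    rw [← mul_pow]
    exact pow_le_pow_left₀ (norm_nonneg _) (hS.lipschitz i x y) 2
  simpa using Finset.sum_le_sum this

lemma norm_localGrads_sub_sq_le (hS : IsSmoothProblem 𝒟 F Lf) (x : Net n d) :
    ‖localGrads 𝒟 F x - gradStack 𝒟 F (avg x.ofLp)‖ ^ 2 ≤ Lf ^ 2 * ‖deviation x‖ ^ 2 := by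
  rw [net_norm_sq, net_norm_sq, Finset.mul_sum]
  refine Finset.sum_le_sum fun i _ => ?_
  rw [← mul_pow]
  exact pow_le_pow_left₀ (norm_nonneg _) (hS.lipschitz i _ _) 2

lemma lipschitz_gradient_globalCost (hn : n ≠ 0) (hLf : 0 < Lf) (hS : IsSmoothProblem 𝒟 F Lf)
    (x y : Vec d) :
    ‖gradient (globalCost 𝒟 F) x - gradient (globalCost 𝒟 F) y‖ ≤ Lf * ‖x - y‖ := by
  have h1 := card_mul_norm_avg_sq_le hn (gradStack 𝒟 F x - gradStack 𝒟 F y)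
  rw [avg_sub, ← gradient_globalCost hS, ← gradient_globalCost hS] at h1
  have h2 := h1.trans (norm_gradStack_sub_sq_le hS x y)
  have hn0 : (0 : ℝ) < n := Nat.cast_pos.2 (Nat.pos_of_ne_zero hn)
  have h3 := le_of_mul_le_mul_left h2 hn0
  rw [← mul_pow] at h3
  exact (abs_le_of_sq_le_sq' h3 (by positivity)).2

lemma gap_nonneg (hP : IsPL 𝒟 F ν) (x : Vec d) : 0 ≤ gap 𝒟 F x :=
  sub_nonneg.2 (ciInf_le hP.bddBelow x)

lemma norm_gradient_globalCost_sq_le (hn : n ≠ 0) (hLf : 0 < Lf) (hS : IsSmoothProblem 𝒟 F Lf)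
    (hP : IsPL 𝒟 F ν) (x : Vec d) :
    ‖gradient (globalCost 𝒟 F) x‖ ^ 2 ≤ 2 * Lf * gap 𝒟 F x :=
  norm_gradient_sq_le hLf (differentiable_globalCost hS) (lipschitz_gradient_globalCost hn hLf hS)
    hP.bddBelow x

/-- PL bounds the gap by gradients alone. This gives both its integrability and its initial bound
without further assumptions on the cost values. -/
lemma gap_le_norm_gradStack (hn : n ≠ 0) (hν : 0 < ν) (hS : IsSmoothProblem 𝒟 F Lf)
    (hP : IsPL 𝒟 F ν) (x : Vec d) : gap 𝒟 F x ≤ 1 / (2 * ν * n) * ‖gradStack 𝒟 F x‖ ^ 2 := by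
  have h1 := hP.pl x
  have h2 := card_mul_norm_avg_sq_le hn (gradStack 𝒟 F x)
  rw [← gradient_globalCost hS] at h2
  have hn0 : (0 : ℝ) < n := Nat.cast_pos.2 (Nat.pos_of_ne_zero hn)
  rw [one_div, ← div_eq_inv_mul, le_div_iff₀ (by positivity), gap]
  nlinarith

/-- The deviation of stochastic gradients from the gradients at the average. -/
lemma norm_sub_gradStack_sq_le (hS : IsSmoothProblem 𝒟 F Lf) (x g : Net n d) :
    ‖g - gradStack 𝒟 F (avg x.ofLp)‖ ^ 2 ≤
      2 * ‖g - localGrads 𝒟 F x‖ ^ 2 + 2 * (Lf ^ 2 * ‖deviation x‖ ^ 2) := by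
  have h := norm_add_sq_le_two (g - localGrads 𝒟 F x)
    (localGrads 𝒟 F x - gradStack 𝒟 F (avg x.ofLp))
  rw [sub_add_sub_cancel] at h
  linarith [norm_localGrads_sub_sq_le hS x]

/-- The non-deviating part of the stacked gradients is `∇f` repeated `n` times. The dual variables,
having mean zero, cannot cancel it; the optimality gap controls it instead. -/
lemma card_mul_norm_gradient_sq_le (hn : n ≠ 0) (hLf : 0 < Lf) (hS : IsSmoothProblem 𝒟 F Lf)
    (hP : IsPL 𝒟 F ν) (x : Vec d) :
    ‖gradStack 𝒟 F x - deviation (gradStack 𝒟 F x)‖ ^ 2 ≤ n * (2 * Lf * gap 𝒟 F x) := by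
  rw [net_norm_sub_deviation_sq, ← gradient_globalCost hS]
  exact mul_le_mul_of_nonneg_left (norm_gradient_globalCost_sq_le hn hLf hS hP x) n.cast_nonneg

/-- The change of the local gradients at the average during one iteration. -/
lemma norm_gradStack_step_sq_le (hn : n ≠ 0) (hLf : 0 < Lf) (hS : IsSmoothProblem 𝒟 F Lf)
    (hP : IsPL 𝒟 F ν) (η : ℝ) (x g : Net n d) :
    ‖gradStack 𝒟 F (avg x.ofLp - η • avg g.ofLp) - gradStack 𝒟 F (avg x.ofLp)‖ ^ 2 ≤
      Lf ^ 2 * η ^ 2 * (4 * ‖g - localGrads 𝒟 F x‖ ^ 2 + 4 * Lf ^ 2 * ‖deviation x‖ ^ 2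
        + 4 * Lf * (n * gap 𝒟 F (avg x.ofLp))) := by
  have h1 := norm_gradStack_sub_sq_le hS (avg x.ofLp - η • avg g.ofLp) (avg x.ofLp)
  rw [sub_sub_cancel_left, norm_neg, norm_smul_sq] at h1
  have h2 := norm_sub_gradStack_sq_le hS x g
  have h3 := card_mul_norm_avg_sq_le hn (g - gradStack 𝒟 F (avg x.ofLp))
  have h4 := norm_gradient_globalCost_sq_le hn hLf hS hP (avg x.ofLp)
  rw [avg_sub, ← gradient_globalCost hS] at h3
  have h5 := norm_add_sq_le_two (avg g.ofLp - gradient (globalCost 𝒟 F) (avg x.ofLp))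
    (gradient (globalCost 𝒟 F) (avg x.ofLp))
  rw [sub_add_cancel] at h5
  have hn0 : (0 : ℝ) ≤ n := n.cast_nonneg
  have h6 := mul_le_mul_of_nonneg_left h5 hn0
  have h7 := mul_le_mul_of_nonneg_left h4 hn0
  have h8 : n * ‖avg g.ofLp‖ ^ 2 ≤ 4 * ‖g - localGrads 𝒟 F x‖ ^ 2
      + 4 * Lf ^ 2 * ‖deviation x‖ ^ 2 + 4 * Lf * (n * gap 𝒟 F (avg x.ofLp)) := by linarith
  have h9 := mul_le_mul_of_nonneg_left h8 (by positivity : 0 ≤ Lf ^ 2 * η ^ 2)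
  linarith

end Costs

/-! ### Moments of functions of independent pairs, by Fubini -/

section Freezing

variable {Ω : Type*} [MeasurableSpace Ω] {P : Measure Ω}
  {V : Type*} [NormedAddCommGroup V] [InnerProductSpace ℝ V]

lemma integrable_inner_of_memLp_two {f g : Ω → V} (hf : MemLp f 2 P) (hg : MemLp g 2 P) :
    Integrable (fun s => (inner ℝ (f s) (g s) : ℝ)) P := by
  refine ((hf.integrable_norm_pow two_ne_zero).add (hg.integrable_norm_pow two_ne_zero)).mono'
    (hf.aestronglyMeasurable.inner hg.aestronglyMeasurable) (Filter.Eventually.of_forall fun s => ?_)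
  have h := norm_inner_le_norm (𝕜 := ℝ) (f s) (g s)
  simp only [Pi.add_apply]
  nlinarith [sq_nonneg (‖f s‖ - ‖g s‖), norm_nonneg (f s), norm_nonneg (g s),
    sq_nonneg ‖f s‖, sq_nonneg ‖g s‖]

variable [IsProbabilityMeasure P] [MeasurableSpace V] [BorelSpace V] [SecondCountableTopology V]
  {S T : Type*} [MeasurableSpace S] [MeasurableSpace T]

/-- Second moments of a function of an independent pair, from its moments with the first entry
frozen. -/
lemma memLp_two_of_frozen {H : Type*} [NormedAddCommGroup H] [MeasurableSpace H] [BorelSpace H]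
    [SecondCountableTopology H] {X : Ω → S} {Y : Ω → T} (hX : Measurable X) (hY : Measurable Y)
    (hind : IndepFun X Y P) {G : S → T → H} (hG : Measurable fun p : S × T => G p.1 p.2)
    {q : S → ℝ} (hq : Measurable q) (hqX : Integrable (fun s => q (X s)) P)
    (hint : ∀ x, Integrable (fun y => ‖G x y‖ ^ 2) (P.map Y))
    (hle : ∀ x, ∫ y, ‖G x y‖ ^ 2 ∂(P.map Y) ≤ q x) :
    MemLp (fun s => G (X s) (Y s)) 2 P ∧ ∫ s, ‖G (X s) (Y s)‖ ^ 2 ∂P ≤ ∫ s, q (X s) ∂P := by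
  have hXY : Measurable fun s => (X s, Y s) := hX.prodMk hY
  have hmap := hind.map_prod_eq_prod_map_map hX.aemeasurable hY.aemeasurable
  have : IsProbabilityMeasure (P.map X) := Measure.isProbabilityMeasure_map hX.aemeasurable
  have : IsProbabilityMeasure (P.map Y) := Measure.isProbabilityMeasure_map hY.aemeasurable
  have hGm : Measurable fun p : S × T => ‖G p.1 p.2‖ ^ 2 := hG.norm.pow_const 2
  have hqi : Integrable q (P.map X) :=
    (integrable_map_measure hq.aestronglyMeasurable hX.aemeasurable).2 hqX
  have hinner : Integrable (fun x => ∫ y, ‖G x y‖ ^ 2 ∂(P.map Y)) (P.map X) := by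
    refine hqi.mono' ?_ (Filter.Eventually.of_forall fun x => ?_)
    · exact (hGm.stronglyMeasurable.integral_prod_right').aestronglyMeasurable
    · rw [Real.norm_eq_abs, abs_of_nonneg (integral_nonneg fun y => sq_nonneg _)]
      exact hle x
  have hprod : Integrable (fun p : S × T => ‖G p.1 p.2‖ ^ 2) ((P.map X).prod (P.map Y)) := by
    rw [integrable_prod_iff hGm.aestronglyMeasurable]
    refine ⟨Filter.Eventually.of_forall hint, ?_⟩
    simpa using hinner
  have hpm : Integrable (fun p : S × T => ‖G p.1 p.2‖ ^ 2) (P.map fun s => (X s, Y s)) := by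
    rw [hmap]; exact hprod
  constructor
  · exact (memLp_two_iff_integrable_sq_norm (f := fun s => G (X s) (Y s))
      (hG.comp hXY).aestronglyMeasurable).2 (hpm.comp_measurable hXY)
  · calc ∫ s, ‖G (X s) (Y s)‖ ^ 2 ∂P
        = ∫ p, ‖G p.1 p.2‖ ^ 2 ∂(P.map fun s => (X s, Y s)) :=
          (integral_map hXY.aemeasurable hGm.aestronglyMeasurable).symm
      _ = ∫ x, ∫ y, ‖G x y‖ ^ 2 ∂(P.map Y) ∂(P.map X) := by
          rw [hmap, integral_prod _ hprod]
      _ ≤ ∫ x, q x ∂(P.map X) := integral_mono hinner hqi hle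
      _ = ∫ s, q (X s) ∂P := integral_map hX.aemeasurable hq.aestronglyMeasurable

variable [CompleteSpace V]

/-- A function of an independent pair that is centered with the first entry frozen is orthogonal to
everything that is independent of the second entry. -/
lemma integral_inner_eq_zero_of_frozen {B : Ω → V} {X : Ω → S} {Y : Ω → T} (hB : Measurable B)
    (hX : Measurable X) (hY : Measurable Y) (hind : IndepFun (fun s => (B s, X s)) Y P)
    {G : S → T → V} (hG : Measurable fun p : S × T => G p.1 p.2)
    (hint : ∀ x, Integrable (G x) (P.map Y)) (hzero : ∀ x, ∫ y, G x y ∂(P.map Y) = 0)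
    (hB2 : MemLp B 2 P) (hG2 : MemLp (fun s => G (X s) (Y s)) 2 P) :
    ∫ s, (inner ℝ (B s) (G (X s) (Y s)) : ℝ) ∂P = 0 := by
  have hBX : Measurable fun s => (B s, X s) := hB.prodMk hX
  have hXY : Measurable fun s => ((B s, X s), Y s) := hBX.prodMk hY
  have hmap := hind.map_prod_eq_prod_map_map hBX.aemeasurable hY.aemeasurable
  have : IsProbabilityMeasure (P.map fun s => (B s, X s)) :=
    Measure.isProbabilityMeasure_map hBX.aemeasurable
  have : IsProbabilityMeasure (P.map Y) := Measure.isProbabilityMeasure_map hY.aemeasurable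
  have hm : Measurable fun p : (V × S) × T => (inner ℝ p.1.1 (G p.1.2 p.2) : ℝ) :=
    (measurable_fst.comp measurable_fst).inner
      (hG.comp ((measurable_snd.comp measurable_fst).prodMk measurable_snd))
  have hi : Integrable (fun p : (V × S) × T => (inner ℝ p.1.1 (G p.1.2 p.2) : ℝ))
      (P.map fun s => ((B s, X s), Y s)) :=
    (integrable_map_measure hm.aestronglyMeasurable hXY.aemeasurable).2
      (integrable_inner_of_memLp_two hB2 hG2)
  rw [← integral_map (φ := fun s => ((B s, X s), Y s))
    (f := fun p : (V × S) × T => (inner ℝ p.1.1 (G p.1.2 p.2) : ℝ)) hXY.aemeasurable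
    hm.aestronglyMeasurable, hmap, integral_prod _ (by rwa [hmap] at hi)]
  have : ∀ p : V × S, ∫ y, (inner ℝ p.1 (G p.2 y) : ℝ) ∂(P.map Y) = 0 := by
    intro p
    rw [integral_inner (hint p.2), hzero, inner_zero_right]
  simp [this]

end Freezing

/-! ### Independence of past and fresh samples -/

section Sampling

variable {n : ℕ} {Ω : Type w} {Ξ : Fin n → Type u} [∀ i, MeasurableSpace (Ξ i)]
  {Z : Type v} [MeasurableSpace Z]

/-- The `σ`-algebra of the samples and seeds with index in `S`. -/
@[reducible] def sampleField (ξ : ∀ i, ℕ → Ω → Ξ i) (ζ : Fin n → ℕ → Ω → Z) (S : Set (Fin n × ℕ)) :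
    MeasurableSpace Ω :=
  ⨆ p ∈ S, MeasurableSpace.comap (fun s => (ξ p.1 p.2 s, ζ p.1 p.2 s)) inferInstance

variable {ξ : ∀ i, ℕ → Ω → Ξ i} {ζ : Fin n → ℕ → Ω → Z}

lemma sampleField_mono {S T : Set (Fin n × ℕ)} (h : S ⊆ T) :
    sampleField ξ ζ S ≤ sampleField ξ ζ T :=
  biSup_mono h

lemma measurable_pair_sampleField {S : Set (Fin n × ℕ)} {p : Fin n × ℕ} (hp : p ∈ S) :
    Measurable[sampleField ξ ζ S] fun s => (ξ p.1 p.2 s, ζ p.1 p.2 s) := by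
  rw [measurable_iff_comap_le]
  exact le_biSup (fun p : Fin n × ℕ =>
    MeasurableSpace.comap (fun s => (ξ p.1 p.2 s, ζ p.1 p.2 s)) inferInstance) hp

lemma measurable_data_sampleField {S : Set (Fin n × ℕ)} {i : Fin n} {k : ℕ} (hp : (i, k) ∈ S) :
    Measurable[sampleField ξ ζ S] (ξ i k) :=
  measurable_fst.comp (measurable_pair_sampleField hp)

lemma measurable_seed_sampleField {S : Set (Fin n × ℕ)} {i : Fin n} {k : ℕ} (hp : (i, k) ∈ S) :
    Measurable[sampleField ξ ζ S] (ζ i k) :=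
  measurable_snd.comp (measurable_pair_sampleField hp)

variable [mΩ : MeasurableSpace Ω] {P : Measure Ω} {𝒟 : ∀ i, Measure (Ξ i)} {𝒬 : Measure Z}

lemma sampleField_le (hs : IsFreshSampling P 𝒟 𝒬 ξ ζ) (S : Set (Fin n × ℕ)) :
    sampleField ξ ζ S ≤ mΩ :=
  iSup₂_le fun p _ => ((hs.measurable_data p.1 p.2).prodMk (hs.measurable_seed p.1 p.2)).comap_le

lemma indep_sampleField (hs : IsFreshSampling P 𝒟 𝒬 ξ ζ) {S T : Set (Fin n × ℕ)}
    (hST : Disjoint S T) : Indep (sampleField ξ ζ S) (sampleField ξ ζ T) P := by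
  have h : iIndep (fun p : Fin n × ℕ =>
      MeasurableSpace.comap (fun s => (ξ p.1 p.2 s, ζ p.1 p.2 s)) inferInstance) P :=
    (iIndepFun_iff_iIndep (β := fun p : Fin n × ℕ => Ξ p.1 × Z) (fun _ => inferInstance)
      (fun p s => (ξ p.1 p.2 s, ζ p.1 p.2 s)) P).1 hs.indep_pairs
  exact indep_iSup_of_disjoint (m := fun p : Fin n × ℕ =>
      MeasurableSpace.comap (fun s => (ξ p.1 p.2 s, ζ p.1 p.2 s)) inferInstance)
    (fun p => ((hs.measurable_data p.1 p.2).prodMk (hs.measurable_seed p.1 p.2)).comap_le) h hST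

/-- Quantities computed from disjoint sets of indices are independent; combined with the Fubini
lemmas this plays the role of conditional expectations. -/
lemma indepFun_of_measurable_sampleField (hs : IsFreshSampling P 𝒟 𝒬 ξ ζ)
    {S T : Set (Fin n × ℕ)} (hST : Disjoint S T) {A B : Type*} [MeasurableSpace A]
    [MeasurableSpace B] {X : Ω → A} {Y : Ω → B} (hX : Measurable[sampleField ξ ζ S] X)
    (hY : Measurable[sampleField ξ ζ T] Y) : IndepFun X Y P :=
  (IndepFun_iff_Indep _ _ _).2 (indep_of_indep_of_le_left (indep_of_indep_of_le_right
    (indep_sampleField hs hST) hY.comap_le) hX.comap_le)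

end Sampling

/-! ### Measurability of the iterates -/

section Iterates

variable {n d : ℕ} {Ω : Type w} {Ξ : Fin n → Type u} [∀ i, MeasurableSpace (Ξ i)]
  {Z : Type v} [MeasurableSpace Z]

/-- The `σ`-algebra on `Ω` is arbitrary and only samples before time `k` need be measurable, so it
can be taken to be the one generated by the past. -/
lemma measurable_rcpSGD [MeasurableSpace Ω] {L : Matrix (Fin n) (Fin n) ℝ}
    {g : ∀ i, Vec d → Ξ i → Vec d} {𝒞 : Vec d → Z → Vec d}
    (hg : ∀ i, Measurable fun p : Vec d × Ξ i => g i p.1 p.2)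
    (h𝒞 : Measurable fun p : Vec d × Z => 𝒞 p.1 p.2) (αx : ℝ) (η γ ω h : ℕ → ℝ)
    (x₀ : Fin n → Vec d) {ξ : ∀ i, ℕ → Ω → Ξ i} {ζ : Fin n → ℕ → Ω → Z} (k : ℕ)
    (hξ : ∀ i, ∀ j < k, Measurable (ξ i j)) (hζ : ∀ i, ∀ j < k, Measurable (ζ i j)) (i : Fin n) :
    Measurable (fun s => (rcpSGD L g 𝒞 αx η γ ω h x₀ (fun i k => ξ i k s)
        (fun i k => ζ i k s) k).x i) ∧
      Measurable (fun s => (rcpSGD L g 𝒞 αx η γ ω h x₀ (fun i k => ξ i k s)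
        (fun i k => ζ i k s) k).v i) ∧
      Measurable (fun s => (rcpSGD L g 𝒞 αx η γ ω h x₀ (fun i k => ξ i k s)
        (fun i k => ζ i k s) k).xc i) := by
  induction k generalizing i with
  | zero => exact ⟨measurable_const, measurable_const, measurable_const⟩
  | succ k ih =>
    have ih' := fun i => ih (fun i j hj => hξ i j (hj.trans k.lt_succ_self))
      (fun i j hj => hζ i j (hj.trans k.lt_succ_self)) i
    have hxh : ∀ i, Measurable fun s => xhat 𝒞 (h k) (fun i => ζ i k s)
        (rcpSGD L g 𝒞 αx η γ ω h x₀ (fun i k => ξ i k s) (fun i k => ζ i k s) k) i := by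
      intro i
      have h1 : Measurable fun s => (h k)⁻¹ • ((rcpSGD L g 𝒞 αx η γ ω h x₀ (fun i k => ξ i k s)
          (fun i k => ζ i k s) k).x i - (rcpSGD L g 𝒞 αx η γ ω h x₀ (fun i k => ξ i k s)
          (fun i k => ζ i k s) k).xc i) := ((ih' i).1.sub (ih' i).2.2).fun_const_smul _
      exact (ih' i).2.2.add ((h𝒞.comp (h1.prodMk (hζ i k k.lt_succ_self))).fun_const_smul _)
    have hL : ∀ i, Measurable fun s => ∑ j, L i j • xhat 𝒞 (h k) (fun i => ζ i k s)
        (rcpSGD L g 𝒞 αx η γ ω h x₀ (fun i k => ξ i k s) (fun i k => ζ i k s) k) j :=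
      fun i => Finset.measurable_sum _ fun j _ => (hxh j).fun_const_smul _
    refine ⟨?_, ?_, ?_⟩
    · exact (ih' i).1.sub (((((hL i).fun_const_smul _).add ((ih' i).2.1.fun_const_smul _)).add
        ((hg i).comp ((ih' i).1.prodMk (hξ i k k.lt_succ_self)))).fun_const_smul _)
    · exact (ih' i).2.1.add ((hL i).fun_const_smul _)
    · exact ((ih' i).2.2.fun_const_smul _).add ((hxh i).fun_const_smul _)

end Iterates

/-! ### Moments of gradient noise and compression error -/

section Moments

variable {n d : ℕ} {Ξ : Fin n → Type u} [∀ i, MeasurableSpace (Ξ i)] {Z : Type v}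
  [MeasurableSpace Z] {Ω : Type w} [MeasurableSpace Ω] {P : Measure Ω} [IsProbabilityMeasure P]
  {𝒟 : ∀ i, Measure (Ξ i)} {F : ∀ i, Vec d → Ξ i → ℝ} {𝒬 : Measure Z} {𝒞 : Vec d → Z → Vec d}
  {ξ : ∀ i, ℕ → Ω → Ξ i} {ζ : Fin n → ℕ → Ω → Z} {Lf σ φ r σC : ℝ}

lemma continuous_gradient_localCost (hS : IsSmoothProblem 𝒟 F Lf) (i : Fin n) :
    Continuous (gradient (localCost 𝒟 F i)) := by
  refine (LipschitzWith.of_dist_le_mul (K := Real.toNNReal Lf) fun x y => ?_).continuous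
  rw [dist_eq_norm, dist_eq_norm]
  refine (hS.lipschitz i x y).trans ?_
  gcongr
  exact Real.le_coe_toNNReal Lf

/-- The error of the stochastic gradient. -/
def gradNoise (𝒟 : ∀ i, Measure (Ξ i)) (F : ∀ i, Vec d → Ξ i → ℝ) (i : Fin n) (x : Vec d)
    (ξ : Ξ i) : Vec d :=
  stochGrad F i x ξ - gradient (localCost 𝒟 F i) x

lemma measurable_gradNoise (hS : IsSmoothProblem 𝒟 F Lf) (hO : IsGradientOracle 𝒟 F σ)
    (i : Fin n) : Measurable fun p : Vec d × Ξ i => gradNoise 𝒟 F i p.1 p.2 :=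
  (hO.measurable i).sub ((continuous_gradient_localCost hS i).measurable.comp measurable_fst)

lemma memLp_gradNoise (hO : IsGradientOracle 𝒟 F σ) (i : Fin n) (x : Vec d) :
    MemLp (gradNoise 𝒟 F i x) 2 (𝒟 i) := by
  have := hO.prob i
  exact (hO.memLp i x).sub (memLp_const _)

lemma integral_gradNoise (hO : IsGradientOracle 𝒟 F σ) (i : Fin n) (x : Vec d) :
    ∫ y, gradNoise 𝒟 F i x y ∂(𝒟 i) = 0 := by
  have := hO.prob i
  simp only [gradNoise]
  rw [integral_sub ((hO.memLp i x).integrable one_le_two) (integrable_const _), hO.unbiased]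
  simp

variable {k : ℕ}

lemma disjoint_past_singleton {i : Fin n} :
    Disjoint {p : Fin n × ℕ | p.2 < k} {(i, k)} := by
  rw [Set.disjoint_singleton_right]
  exact fun h => lt_irrefl k h

lemma gradNoise_moment (hS : IsSmoothProblem 𝒟 F Lf) (hO : IsGradientOracle 𝒟 F σ)
    (hs : IsFreshSampling P 𝒟 𝒬 ξ ζ) {i : Fin n} {x : Ω → Vec d}
    (hx : Measurable[sampleField ξ ζ {p | p.2 < k}] x) :
    MemLp (fun s => gradNoise 𝒟 F i (x s) (ξ i k s)) 2 P ∧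
      ∫ s, ‖gradNoise 𝒟 F i (x s) (ξ i k s)‖ ^ 2 ∂P ≤ σ ^ 2 := by
  have h := memLp_two_of_frozen (P := P) (hx.mono (sampleField_le hs _) le_rfl)
    (hs.measurable_data i k)
    (indepFun_of_measurable_sampleField hs disjoint_past_singleton hx
      (measurable_data_sampleField (Set.mem_singleton (i, k))))
    (G := gradNoise 𝒟 F i) (measurable_gradNoise hS hO i) (q := fun _ => σ ^ 2) measurable_const
    (integrable_const _) (fun x => by
      rw [hs.law_data]; exact (memLp_gradNoise hO i x).integrable_norm_pow two_ne_zero)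
    (fun x => by rw [hs.law_data]; exact hO.variance i x)
  simpa using h

/-- `B` may depend on every index except `(i, k)`, in particular on the samples of other agents at
the same time. This covers the cross terms between agents. -/
lemma integral_inner_gradNoise (hS : IsSmoothProblem 𝒟 F Lf) (hO : IsGradientOracle 𝒟 F σ)
    (hs : IsFreshSampling P 𝒟 𝒬 ξ ζ) {i : Fin n} {x B : Ω → Vec d}
    (hx : Measurable[sampleField ξ ζ {p | p.2 < k}] x)
    (hB : Measurable[sampleField ξ ζ {(i, k)}ᶜ] B) (hB2 : MemLp B 2 P) :
    ∫ s, (inner ℝ (B s) (gradNoise 𝒟 F i (x s) (ξ i k s)) : ℝ) ∂P = 0 := by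
  have hx' : Measurable[sampleField ξ ζ {(i, k)}ᶜ] x :=
    hx.mono (sampleField_mono (Set.subset_compl_iff_disjoint_right.2 disjoint_past_singleton)) le_rfl
  have hBx : Measurable[sampleField ξ ζ {(i, k)}ᶜ] fun s => (B s, x s) := hB.prodMk hx'
  have hp := hO.prob i
  exact integral_inner_eq_zero_of_frozen (hB.mono (sampleField_le hs _) le_rfl)
    (hx.mono (sampleField_le hs _) le_rfl) (hs.measurable_data i k)
    (indepFun_of_measurable_sampleField hs disjoint_compl_left hBx
      (measurable_data_sampleField (Set.mem_singleton (i, k))))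
    (G := gradNoise 𝒟 F i) (measurable_gradNoise hS hO i)
    (fun x => by rw [hs.law_data]; exact (memLp_gradNoise hO i x).integrable one_le_two)
    (fun x => by rw [hs.law_data]; exact integral_gradNoise hO i x) hB2
    (gradNoise_moment hS hO hs hx).1

lemma integral_inner_gradNoise_ne (hS : IsSmoothProblem 𝒟 F Lf) (hO : IsGradientOracle 𝒟 F σ)
    (hs : IsFreshSampling P 𝒟 𝒬 ξ ζ) {i j : Fin n} (hij : j ≠ i) {x y : Ω → Vec d}
    (hx : Measurable[sampleField ξ ζ {p | p.2 < k}] x)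
    (hy : Measurable[sampleField ξ ζ {p | p.2 < k}] y) :
    ∫ s, (inner ℝ (gradNoise 𝒟 F j (y s) (ξ j k s)) (gradNoise 𝒟 F i (x s) (ξ i k s)) : ℝ) ∂P
      = 0 := by
  refine integral_inner_gradNoise hS hO hs hx ?_ (gradNoise_moment hS hO hs hy).1
  have hy' : Measurable[sampleField ξ ζ {(i, k)}ᶜ] y :=
    hy.mono (sampleField_mono (Set.subset_compl_iff_disjoint_right.2 disjoint_past_singleton)) le_rfl
  have hj : Measurable[sampleField ξ ζ {(i, k)}ᶜ] (ξ j k) :=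
    measurable_data_sampleField (by simpa using hij)
  exact (measurable_gradNoise hS hO j).comp (hy'.prodMk hj)

/-- The noise of all agents, stacked. -/
def noiseStack (𝒟 : ∀ i, Measure (Ξ i)) (F : ∀ i, Vec d → Ξ i → ℝ) (x : Fin n → Vec d)
    (ξ : ∀ i, Ξ i) : Net n d :=
  stack fun i => gradNoise 𝒟 F i (x i) (ξ i)

variable {x : Ω → Fin n → Vec d}

lemma noiseStack_moment (hS : IsSmoothProblem 𝒟 F Lf) (hO : IsGradientOracle 𝒟 F σ)
    (hs : IsFreshSampling P 𝒟 𝒬 ξ ζ)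
    (hx : ∀ i, Measurable[sampleField ξ ζ {p | p.2 < k}] fun s => x s i) :
    MemLp (fun s => noiseStack 𝒟 F (x s) fun i => ξ i k s) 2 P ∧
      ∫ s, ‖noiseStack 𝒟 F (x s) fun i => ξ i k s‖ ^ 2 ∂P ≤ n * σ ^ 2 := by
  have h := fun i => gradNoise_moment hS hO hs (hx i) (i := i)
  refine ⟨memLp_piLp_iff.2 fun i => (h i).1, ?_⟩
  simp_rw [net_norm_sq]
  change ∫ s, ∑ i, ‖gradNoise 𝒟 F i (x s i) (ξ i k s)‖ ^ 2 ∂P ≤ _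
  rw [integral_finsetSum _ fun i _ => (h i).1.integrable_norm_pow two_ne_zero]
  simpa using Finset.sum_le_sum fun i (_ : i ∈ Finset.univ) => (h i).2

/-- The variance of the averaged noise decreases with the number of agents. -/
lemma avg_noiseStack_moment (hn : n ≠ 0) (hS : IsSmoothProblem 𝒟 F Lf)
    (hO : IsGradientOracle 𝒟 F σ) (hs : IsFreshSampling P 𝒟 𝒬 ξ ζ)
    (hx : ∀ i, Measurable[sampleField ξ ζ {p | p.2 < k}] fun s => x s i) :
    MemLp (fun s => avg (noiseStack 𝒟 F (x s) fun i => ξ i k s).ofLp) 2 P ∧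
      ∫ s, ‖avg (noiseStack 𝒟 F (x s) fun i => ξ i k s).ofLp‖ ^ 2 ∂P ≤ σ ^ 2 / n := by
  have h := fun i => gradNoise_moment hS hO hs (hx i) (i := i)
  have hn0 : (0 : ℝ) < n := Nat.cast_pos.2 (Nat.pos_of_ne_zero hn)
  constructor
  · exact (memLp_finsetSum _ fun i _ => (h i).1).const_smul (1 / (n : ℝ))
  have e : ∀ s, ‖avg (noiseStack 𝒟 F (x s) fun i => ξ i k s).ofLp‖ ^ 2 = (1 / (n : ℝ)) ^ 2 *
      ∑ i, ∑ j, inner ℝ (gradNoise 𝒟 F i (x s i) (ξ i k s)) (gradNoise 𝒟 F j (x s j) (ξ j k s)) := by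
    intro s
    rw [avg, norm_smul_sq, ← real_inner_self_eq_norm_sq, sum_inner]
    simp_rw [inner_sum]
    rfl
  have hint : ∀ i j, Integrable (fun s => (inner ℝ (gradNoise 𝒟 F i (x s i) (ξ i k s))
      (gradNoise 𝒟 F j (x s j) (ξ j k s)) : ℝ)) P :=
    fun i j => integrable_inner_of_memLp_two (h i).1 (h j).1
  simp_rw [e]
  rw [integral_const_mul, integral_finsetSum _ fun i _ => integrable_finsetSum _ fun j _ => hint i j]
  have h2 : ∀ i, ∫ s, ∑ j, (inner ℝ (gradNoise 𝒟 F i (x s i) (ξ i k s))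
      (gradNoise 𝒟 F j (x s j) (ξ j k s)) : ℝ) ∂P ≤ σ ^ 2 := by
    intro i
    -- Noises of different agents are uncorrelated, so only `n` of the `n ^ 2` terms survive; this
    -- is the source of the factor `1 / n`.
    rw [integral_finsetSum _ fun j _ => hint i j, Finset.sum_eq_single i]
    · simp_rw [real_inner_self_eq_norm_sq]
      exact (h i).2
    · intro j _ hj
      exact integral_inner_gradNoise_ne hS hO hs hj.symm (hx j) (hx i)
    · simp
  have h3 := Finset.sum_le_sum fun i (_ : i ∈ Finset.univ) => h2 i
  simp only [Finset.sum_const, Finset.card_univ, Fintype.card_fin, nsmul_eq_mul] at h3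
  calc _ ≤ (1 / (n : ℝ)) ^ 2 * (n * σ ^ 2) := by gcongr
    _ = σ ^ 2 / n := by field_simp

lemma integral_inner_avg_noiseStack (hS : IsSmoothProblem 𝒟 F Lf)
    (hO : IsGradientOracle 𝒟 F σ) (hs : IsFreshSampling P 𝒟 𝒬 ξ ζ)
    (hx : ∀ i, Measurable[sampleField ξ ζ {p | p.2 < k}] fun s => x s i) {B : Ω → Vec d}
    (hB : Measurable[sampleField ξ ζ {p | p.2 < k}] B) (hB2 : MemLp B 2 P) :
    ∫ s, (inner ℝ (B s) (avg (noiseStack 𝒟 F (x s) fun i => ξ i k s).ofLp) : ℝ) ∂P = 0 := by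
  have h := fun i => gradNoise_moment hS hO hs (hx i) (i := i)
  have e : ∀ s, (inner ℝ (B s) (avg (noiseStack 𝒟 F (x s) fun i => ξ i k s).ofLp) : ℝ) =
      (1 / (n : ℝ)) * ∑ i, inner ℝ (B s) (gradNoise 𝒟 F i (x s i) (ξ i k s)) := by
    intro s
    rw [avg, inner_smul_right, inner_sum]
    rfl
  simp_rw [e]
  rw [integral_const_mul,
    integral_finsetSum _ fun i _ => integrable_inner_of_memLp_two hB2 (h i).1,
    Finset.sum_eq_zero, mul_zero]
  intro i _
  exact integral_inner_gradNoise hS hO hs (hx i) (hB.mono (sampleField_mono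
    (Set.subset_compl_iff_disjoint_right.2 disjoint_past_singleton)) le_rfl) hB2

/-- Compressing at scale `h` keeps the relative error and multiplies the absolute one by `h ^ 2`. -/
lemma compressor_moment (hC : IsCompressor 𝒬 𝒞 φ r σC) (hr : 0 < r)
    (hs : IsFreshSampling P 𝒟 𝒬 ξ ζ) {i : Fin n} {y : Ω → Vec d} {h : ℝ} (hh : 0 < h)
    (hy : Measurable[sampleField ξ ζ {p | p.2 < k}] y) (hy2 : MemLp y 2 P) :
    MemLp (fun s => h • 𝒞 (h⁻¹ • y s) (ζ i k s)) 2 P ∧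
      ∫ s, ‖r⁻¹ • h • 𝒞 (h⁻¹ • y s) (ζ i k s) - y s‖ ^ 2 ∂P ≤
        (1 - φ) * ∫ s, ‖y s‖ ^ 2 ∂P + h ^ 2 * σC := by
  have e : ∀ (x : Vec d) (z : Z), r⁻¹ • h • 𝒞 (h⁻¹ • x) z - x
      = h • (r⁻¹ • 𝒞 (h⁻¹ • x) z - h⁻¹ • x) := by
    intro x z
    rw [smul_sub, smul_inv_smul₀ hh.ne', smul_comm]
  have hp := hC.prob
  have hint := (hy2.integrable_norm_pow two_ne_zero)
  have hmom := memLp_two_of_frozen (P := P) (hy.mono (sampleField_le hs _) le_rfl)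
    (hs.measurable_seed i k)
    (indepFun_of_measurable_sampleField hs disjoint_past_singleton hy
      (measurable_seed_sampleField (Set.mem_singleton (i, k))))
    (G := fun x z => r⁻¹ • h • 𝒞 (h⁻¹ • x) z - x)
    ((((hC.measurable.comp ((measurable_fst.fun_const_smul _).prodMk
      measurable_snd)).fun_const_smul _).fun_const_smul _).sub measurable_fst)
    (q := fun x => (1 - φ) * ‖x‖ ^ 2 + h ^ 2 * σC)
    (((measurable_norm.pow_const 2).const_mul _).add_const _)
    ((hint.const_mul _).add (integrable_const _))
    (fun x => by
      rw [hs.law_seed]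
      simp_rw [e, norm_smul_sq h]
      exact (hC.integrable _).const_mul _)
    (fun x => by
      rw [hs.law_seed]
      simp_rw [e, norm_smul_sq h]
      rw [integral_const_mul]
      have h1 := mul_le_mul_of_nonneg_left (hC.error (h⁻¹ • x)) (sq_nonneg h)
      rw [norm_smul_sq] at h1
      have h2 : h ^ 2 * ((1 - φ) * ((h⁻¹) ^ 2 * ‖x‖ ^ 2) + σC) =
          (1 - φ) * ‖x‖ ^ 2 + h ^ 2 * σC := by field_simp
      linarith)
  constructor
  · have h1 := (hmom.1.add hy2).const_smul r
    refine h1.ae_eq (Filter.Eventually.of_forall fun s => ?_)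
    simp [smul_inv_smul₀ hr.ne']
  · refine hmom.2.trans_eq ?_
    rw [integral_add (hint.const_mul _) (integrable_const _), integral_const_mul]
    simp

lemma compressorStack_moment (hC : IsCompressor 𝒬 𝒞 φ r σC) (hr : 0 < r)
    (hs : IsFreshSampling P 𝒟 𝒬 ξ ζ) {y : Ω → Fin n → Vec d} {h : ℝ} (hh : 0 < h)
    (hy : ∀ i, Measurable[sampleField ξ ζ {p | p.2 < k}] fun s => y s i)
    (hy2 : ∀ i, MemLp (fun s => y s i) 2 P) :
    MemLp (fun s => stack fun i => h • 𝒞 (h⁻¹ • y s i) (ζ i k s)) 2 P ∧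
      ∫ s, ‖r⁻¹ • (stack fun i => h • 𝒞 (h⁻¹ • y s i) (ζ i k s)) - stack (y s)‖ ^ 2 ∂P ≤
        (1 - φ) * ∫ s, ‖stack (y s)‖ ^ 2 ∂P + n * (h ^ 2 * σC) := by
  have hm := fun i => compressor_moment hC hr hs hh (hy i) (hy2 i) (i := i)
  refine ⟨memLp_piLp_iff.2 fun i => (hm i).1, ?_⟩
  simp_rw [net_norm_sq]
  rw [integral_finsetSum _ fun i _ => ?_, integral_finsetSum _ fun i _ => ?_]
  · refine (Finset.sum_le_sum fun i (_ : i ∈ Finset.univ) => (hm i).2).trans_eq ?_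
    rw [Finset.sum_add_distrib, ← Finset.mul_sum]
    simp
  · exact (hy2 i).integrable_norm_pow two_ne_zero
  · exact (((hm i).1.const_smul r⁻¹).sub (hy2 i)).integrable_norm_pow two_ne_zero

end Moments

/-! ### The iteration in stacked form and its disturbances -/

section Iteration

variable {n d : ℕ} {Ξ : Fin n → Type u} {Z : Type v}
  {F : ∀ i, Vec d → Ξ i → ℝ} {𝒞 : Vec d → Z → Vec d}

/-- The compressed and rescaled differences of one iteration. -/
def compressedStack (𝒞 : Vec d → Z → Vec d) (h : ℝ) (ζ : Fin n → Z) (S : AgentState n d) :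
    Net n d :=
  stack fun i => h • 𝒞 (h⁻¹ • (S.x i - S.xc i)) (ζ i)

/-- The stochastic gradients of one iteration. -/
def gradsStack (F : ∀ i, Vec d → Ξ i → ℝ) (ξ : ∀ i, Ξ i) (S : AgentState n d) : Net n d :=
  stack fun i => stochGrad F i (S.x i) (ξ i)

/-- The compression error `x - x^c` of all agents. -/
def lag (S : AgentState n d) : Net n d := stack fun i => S.x i - S.xc i

variable {L : Matrix (Fin n) (Fin n) ℝ} {αx η γ ω h b b₁ t : ℝ} (ξ : ∀ i, Ξ i) (ζ : Fin n → Z)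
  (S : AgentState n d)

/-- Written with the time-independent gains `b`, `b₁`, so that only the weight `t = 1 / ω` of the
gradients varies with the step. -/
lemma stack_rcpStep_x (hηγ : η * γ = b * b₁) (hηω : η * ω = b) (hη : η = b * t) :
    stack (rcpStep L (stochGrad F) 𝒞 αx η γ ω h ξ ζ S).x = stack S.x -
      b • (b₁ • agentOp L (stack S.x - lag S + compressedStack 𝒞 h ζ S) + stack S.v
        + t • gradsStack F ξ S) := by
  refine PiLp.ext fun i => ?_
  have e : ∀ j, (stack S.x - lag S + compressedStack 𝒞 h ζ S) j = xhat 𝒞 h ζ S j := by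
    intro j
    simp [lag, compressedStack, xhat]
  have e2 : agentOp L (stack S.x - lag S + compressedStack 𝒞 h ζ S) i
      = ∑ j, L i j • xhat 𝒞 h ζ S j := by
    rw [agentOp_apply]
    simp_rw [e]
  have e3 : (stack S.x - b • (b₁ • agentOp L (stack S.x - lag S + compressedStack 𝒞 h ζ S)
      + stack S.v + t • gradsStack F ξ S)) i = S.x i - b • (b₁ •
        agentOp L (stack S.x - lag S + compressedStack 𝒞 h ζ S) i + S.v i
        + t • stochGrad F i (S.x i) (ξ i)) := rfl
  rw [e3, e2]
  change S.x i - η • (γ • _ + ω • S.v i + _) = _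
  simp only [smul_add, smul_smul, hηγ, hηω]
  rw [hη]

lemma stack_rcpStep_v (hηω : η * ω = b) :
    stack (rcpStep L (stochGrad F) 𝒞 αx η γ ω h ξ ζ S).v = stack S.v +
      b • agentOp L (stack S.x - lag S + compressedStack 𝒞 h ζ S) := by
  refine PiLp.ext fun i => ?_
  have e : ∀ j, (stack S.x - lag S + compressedStack 𝒞 h ζ S) j = xhat 𝒞 h ζ S j := by
    intro j
    simp [lag, compressedStack, xhat]
  have e2 : agentOp L (stack S.x - lag S + compressedStack 𝒞 h ζ S) i
      = ∑ j, L i j • xhat 𝒞 h ζ S j := by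
    rw [agentOp_apply]
    simp_rw [e]
  have e3 : (stack S.v + b • agentOp L (stack S.x - lag S + compressedStack 𝒞 h ζ S)) i
      = S.v i + b • agentOp L (stack S.x - lag S + compressedStack 𝒞 h ζ S) i := rfl
  rw [e3, e2, ← hηω]
  rfl

lemma lag_rcpStep :
    lag (rcpStep L (stochGrad F) 𝒞 αx η γ ω h ξ ζ S) =
      stack (rcpStep L (stochGrad F) 𝒞 αx η γ ω h ξ ζ S).x -
        (stack S.x - lag S + αx • compressedStack 𝒞 h ζ S) := by
  refine PiLp.ext fun i => ?_
  have e : (stack S.x - lag S + αx • compressedStack 𝒞 h ζ S) i =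
      S.x i - (S.x i - S.xc i) + αx • h • 𝒞 (h⁻¹ • (S.x i - S.xc i)) (ζ i) := rfl
  have e2 : (rcpStep L (stochGrad F) 𝒞 αx η γ ω h ξ ζ S).xc i =
      (1 - αx) • S.xc i + αx • xhat 𝒞 h ζ S i := rfl
  rw [PiLp.sub_apply, e]
  change _ - (rcpStep L (stochGrad F) 𝒞 αx η γ ω h ξ ζ S).xc i = _
  rw [e2, xhat]
  module

lemma avg_smul (c : ℝ) (u : Net n d) : avg (c • u).ofLp = c • avg u.ofLp := by
  simp only [avg, PiLp.smul_apply, ← Finset.smul_sum]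
  rw [smul_comm]

variable {W : Matrix (Fin n) (Fin n) ℝ}

lemma avg_agentOp (hW : ∀ i j, W i j = W j i) (u : Net n d) :
    avg (agentOp (laplacian W) u).ofLp = 0 := avg_agentOp_laplacian hW _

/-- The Laplacian term has zero average whatever was transmitted, so compression does not affect the
average at all. -/
lemma avg_rcpStep_x (hW : ∀ i j, W i j = W j i) (hηγ : η * γ = b * b₁) (hηω : η * ω = b)
    (hη : η = b * t) (hv : avg S.v = 0) :
    avg (rcpStep (laplacian W) (stochGrad F) 𝒞 αx η γ ω h ξ ζ S).x =
      avg S.x - η • avg (gradsStack F ξ S).ofLp := by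
  have e := congrArg (fun u : Net n d => avg u.ofLp)
    (stack_rcpStep_x (L := laplacian W) (αx := αx) (h := h) (𝒞 := 𝒞) (F := F) ξ ζ S hηγ hηω hη)
  simp only at e
  rw [avg_sub, avg_smul, avg_add, avg_add, avg_smul, avg_smul, avg_agentOp hW] at e
  have e2 : avg (stack S.v : Net n d).ofLp = 0 := hv
  rw [e2, smul_zero, zero_add, zero_add, smul_smul, ← hη] at e
  exact e

lemma avg_rcpStep_v (hW : ∀ i j, W i j = W j i) (hηω : η * ω = b) (hv : avg S.v = 0) :
    avg (rcpStep (laplacian W) (stochGrad F) 𝒞 αx η γ ω h ξ ζ S).v = 0 := by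
  have e := congrArg (fun u : Net n d => avg u.ofLp)
    (stack_rcpStep_v (L := laplacian W) (αx := αx) (γ := γ) (h := h) (𝒞 := 𝒞) (F := F) ξ ζ S hηω)
  simp only at e
  rw [avg_add, avg_smul, avg_agentOp hW, smul_zero, add_zero] at e
  exact e.trans hv

variable [∀ i, MeasurableSpace (Ξ i)] {𝒟 : ∀ i, Measure (Ξ i)} {Lf ν : ℝ}

/-- The Lyapunov function of the iteration, with `t` the inverse of the dual weight. -/
def energy (𝒟 : ∀ i, Measure (Ξ i)) (F : ∀ i, Vec d → Ξ i → ℝ) (L : Matrix (Fin n) (Fin n) ℝ)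
    (ε t : ℝ) (S : AgentState n d) : ℝ :=
  lyapunov (agentOp L) ε (deviation (stack S.x))
    (stack S.v + t • deviation (gradStack 𝒟 F (avg S.x))) + ‖lag S‖ ^ 2


lemma gradsStack_sub_localGrads :
    gradsStack F ξ S - localGrads 𝒟 F (stack S.x) = noiseStack 𝒟 F S.x ξ := rfl

lemma deviation_eq_self {u : Net n d} (hu : avg u.ofLp = 0) : deviation u = u := by
  refine PiLp.ext fun i => ?_
  rw [deviation_apply, hu, sub_zero]

/-- The combination of noise, consensus error and optimality gap that drives the local gradients. -/
def drift (𝒟 : ∀ i, Measure (Ξ i)) (F : ∀ i, Vec d → Ξ i → ℝ) (ξ : ∀ i, Ξ i)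
    (S : AgentState n d) : ℝ :=
  ‖noiseStack 𝒟 F S.x ξ‖ ^ 2 + ‖deviation (stack S.x)‖ ^ 2 + n * gap 𝒟 F (avg S.x)

lemma drift_combination_le (hLf : 0 < Lf) (hP : IsPL 𝒟 F ν) :
    ‖noiseStack 𝒟 F S.x ξ‖ ^ 2 + Lf ^ 2 * ‖deviation (stack S.x)‖ ^ 2
      + Lf * (n * gap 𝒟 F (avg S.x)) ≤ (1 + Lf ^ 2 + Lf) * drift 𝒟 F ξ S := by
  have h1 := sq_nonneg ‖noiseStack 𝒟 F S.x ξ‖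
  have h2 := sq_nonneg ‖deviation (stack S.x)‖
  have h3 : 0 ≤ n * gap 𝒟 F (avg S.x) := mul_nonneg n.cast_nonneg (gap_nonneg hP _)
  rw [drift]
  generalize ‖noiseStack 𝒟 F S.x ξ‖ ^ 2 = X₁ at *
  generalize ‖deviation (stack S.x)‖ ^ 2 = X₂ at *
  generalize n * gap 𝒟 F (avg S.x) = X₃ at *
  have h4 : 0 ≤ (Lf ^ 2 + Lf) * X₁ := by positivity
  have h5 : 0 ≤ (1 + Lf) * X₂ := by positivity
  have h6 : 0 ≤ (1 + Lf ^ 2) * X₃ := by positivity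
  linarith

lemma gradStack_increment_le (hn : n ≠ 0) (hLf : 0 < Lf) (hS : IsSmoothProblem 𝒟 F Lf)
    (hP : IsPL 𝒟 F ν) :
    ‖gradStack 𝒟 F (avg S.x - η • avg (gradsStack F ξ S).ofLp) - gradStack 𝒟 F (avg S.x)‖ ^ 2 ≤
      4 * Lf ^ 2 * (1 + Lf ^ 2 + Lf) * η ^ 2 * drift 𝒟 F ξ S := by
  have h1 := norm_gradStack_step_sq_le hn hLf hS hP η (stack S.x) (gradsStack F ξ S)
  rw [gradsStack_sub_localGrads] at h1
  have h2 := mul_le_mul_of_nonneg_left (drift_combination_le ξ S hLf hP)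
    (by positivity : 0 ≤ 4 * Lf ^ 2 * η ^ 2)
  linarith

/-- Young's inequality with weight `1 / s` keeps the growth polynomial; the price `1 + s` is
affordable because `η ^ 2` is of order `s⁻²`. -/
lemma norm_gradStack_next_sq_le (hn : n ≠ 0) (hLf : 0 < Lf) (hS : IsSmoothProblem 𝒟 F Lf)
    (hP : IsPL 𝒟 F ν) {s : ℝ} (hs : 0 < s) :
    ‖gradStack 𝒟 F (avg S.x - η • avg (gradsStack F ξ S).ofLp)‖ ^ 2 ≤
      (1 + 1 / s) * ‖gradStack 𝒟 F (avg S.x)‖ ^ 2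
        + (1 + s) * (4 * Lf ^ 2 * (1 + Lf ^ 2 + Lf) * η ^ 2 * drift 𝒟 F ξ S) := by
  have h1 := norm_add_sq_le_young (gradStack 𝒟 F (avg S.x))
    (gradStack 𝒟 F (avg S.x - η • avg (gradsStack F ξ S).ofLp) - gradStack 𝒟 F (avg S.x))
    (one_div_pos.2 hs)
  rw [add_sub_cancel, one_div, inv_inv] at h1
  rw [one_div]
  have h2 := mul_le_mul_of_nonneg_left (gradStack_increment_le (η := η) ξ S hn hLf hS hP)
    (by linarith : 0 ≤ 1 + s)
  linarith

/-- The disturbances of one iteration in terms of the drift. -/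
lemma disturbance_le (hn : n ≠ 0) (hLf : 0 < Lf) (hS : IsSmoothProblem 𝒟 F Lf)
    (hP : IsPL 𝒟 F ν) {lo hi : ℝ}
    (hK : IsConsensusPair (agentOp L : Net n d →ₗ[ℝ] Net n d) deviation lo hi) (t' : ℝ) :
    t ^ 2 * ‖gradsStack F ξ S - gradStack 𝒟 F (avg S.x)‖ ^ 2
      + t ^ 2 * ‖gradStack 𝒟 F (avg S.x) - deviation (gradStack 𝒟 F (avg S.x))‖ ^ 2
      + ‖t' • deviation (gradStack 𝒟 F (avg S.x - η • avg (gradsStack F ξ S).ofLp))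
          - t • deviation (gradStack 𝒟 F (avg S.x))‖ ^ 2 ≤
      (2 * t ^ 2 + 8 * Lf ^ 2 * η ^ 2 * t' ^ 2) * (1 + Lf ^ 2 + Lf) * drift 𝒟 F ξ S
        + 2 * (t' - t) ^ 2 * ‖gradStack 𝒟 F (avg S.x)‖ ^ 2 := by
  have h1 := norm_sub_gradStack_sq_le hS (stack S.x) (gradsStack F ξ S)
  rw [gradsStack_sub_localGrads] at h1
  have h1' : ‖gradsStack F ξ S - gradStack 𝒟 F (avg S.x)‖ ^ 2 ≤
    2 * ‖noiseStack 𝒟 F S.x ξ‖ ^ 2 + 2 * (Lf ^ 2 * ‖deviation (stack S.x)‖ ^ 2) := h1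
  have h2 := card_mul_norm_gradient_sq_le hn hLf hS hP (avg S.x)
  have h3 := gradStack_increment_le (η := η) ξ S hn hLf hS hP
  have h4 := drift_combination_le ξ S hLf hP
  set m := gradStack 𝒟 F (avg S.x) with hm
  set m' := gradStack 𝒟 F (avg S.x - η • avg (gradsStack F ξ S).ofLp) with hm'
  -- The dual target moves for two reasons: the gradients change, by an amount of order `η`, and the
  -- weight changes from `t` to `t'`.
  have e : t' • deviation m' - t • deviation m =
      t' • deviation (m' - m) + (t' - t) • deviation m := by
    rw [map_sub]; module
  have h5 := norm_add_sq_le_two (t' • deviation (m' - m)) ((t' - t) • deviation m)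
  rw [← e, norm_smul_sq, norm_smul_sq] at h5
  have h6 := mul_le_mul_of_nonneg_left ((hK.norm_sq_le (m' - m)).trans h3)
    (by positivity : 0 ≤ 2 * t' ^ 2)
  have h7 := mul_le_mul_of_nonneg_left (hK.norm_sq_le m) (by positivity : 0 ≤ 2 * (t' - t) ^ 2)
  have h8 := mul_le_mul_of_nonneg_left (add_le_add h1' h2) (sq_nonneg t)
  have h9 := mul_le_mul_of_nonneg_left h4 (by positivity : 0 ≤ 2 * t ^ 2)
  linarith

end Iteration

/-! ### Pathwise recursions for energy, gradients and gap -/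

section EnergyStep

/-- The increment of the weight `1 / ω` is one order smaller than the weight, which is why unbounded
gradients enter with `s⁻⁴`. -/
lemma inv_dual_weight_sq {β₀ s : ℝ} (hβ : 0 < β₀) (hs : 1 ≤ s) :
    ((β₀ * s)⁻¹) ^ 2 = (β₀⁻¹) ^ 2 / s ^ 2 ∧ ((β₀ * (s + 1))⁻¹) ^ 2 ≤ (β₀⁻¹) ^ 2 ∧
      ((β₀ * (s + 1))⁻¹ - (β₀ * s)⁻¹) ^ 2 ≤ (β₀⁻¹) ^ 2 / s ^ 4 := by
  have hs0 : 0 < s := by linarith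
  refine ⟨by field_simp, ?_, ?_⟩
  · apply pow_le_pow_left₀ (by positivity)
    apply inv_anti₀ hβ
    nlinarith
  · have e : (β₀ * (s + 1))⁻¹ - (β₀ * s)⁻¹ = -(β₀⁻¹ * (s * (s + 1))⁻¹) := by
      field_simp; ring
    have h : (s * (s + 1))⁻¹ ≤ (s ^ 2)⁻¹ := by
      apply inv_anti₀ (by positivity)
      nlinarith
    have h2 : ((s * (s + 1))⁻¹) ^ 2 ≤ ((s ^ 2)⁻¹) ^ 2 := pow_le_pow_left₀ (by positivity) h 2
    rw [e, neg_sq, mul_pow, div_eq_mul_inv]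
    apply mul_le_mul_of_nonneg_left _ (by positivity)
    refine h2.trans_eq ?_
    rw [← inv_pow, ← inv_pow, ← pow_mul]

/-- The pathwise contraction of the energy along the iteration. -/
lemma exists_energy_step {lo hi b₁ φ r αx Lf : ℝ} (hlo : 0 < lo) (hlh : lo ≤ hi) (hb₁ : 0 < b₁)
    (hφ : 0 < φ) (hφ1 : φ ≤ 1) (hr : 0 < r) (hα : 0 < αx) (hαr : αx < 1 / r) (hLf : 0 < Lf) :
    ∃ ε b₀ : ℝ, 0 < ε ∧ ε ≤ 1 ∧ 4 * ε ^ 2 ≤ lo ∧ 0 < b₀ ∧ ∀ b β₀ : ℝ, 0 < b → b < b₀ → 0 < β₀ →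
      ∃ θ C ρ₁ ρ₂ : ℝ, 0 < θ ∧ θ ≤ 1 ∧ 0 < C ∧ 0 ≤ ρ₂ ∧ ρ₁ + ρ₂ * (1 - φ) ≤ 1 - θ ∧
      ∀ (n d : ℕ) (W : Matrix (Fin n) (Fin n) ℝ) (Ξ : Fin n → Type u)
        [∀ i, MeasurableSpace (Ξ i)] (𝒟 : ∀ i, Measure (Ξ i)) (F : ∀ i, Vec d → Ξ i → ℝ)
        (Z : Type v) (𝒞 : Vec d → Z → Vec d) (ν s η γ ω h : ℝ) (ξ : ∀ i, Ξ i) (ζ : Fin n → Z)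
        (S : AgentState n d), n ≠ 0 → (∀ i j, W i j = W j i) →
        IsConsensusPair (agentOp (laplacian W) : Net n d →ₗ[ℝ] Net n d) deviation lo hi →
        IsSmoothProblem 𝒟 F Lf → IsPL 𝒟 F ν → 1 ≤ s → ω = β₀ * s → γ = b₁ * ω → η = b / ω →
        avg S.v = 0 →
        energy 𝒟 F (laplacian W) ε (β₀ * (s + 1))⁻¹
            (rcpStep (laplacian W) (stochGrad F) 𝒞 αx η γ ω h ξ ζ S) ≤
          energy 𝒟 F (laplacian W) ε (β₀ * s)⁻¹ S
            - θ * (‖deviation (stack S.x)‖ ^ 2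
              + ‖stack S.v + (β₀ * s)⁻¹ • deviation (gradStack 𝒟 F (avg S.x))‖ ^ 2)
            + (ρ₁ - 1) * ‖lag S‖ ^ 2
            + ρ₂ * ‖r⁻¹ • compressedStack 𝒞 h ζ S - lag S‖ ^ 2
            + C / s ^ 2 * drift 𝒟 F ξ S + C / s ^ 4 * ‖gradStack 𝒟 F (avg S.x)‖ ^ 2 ∧
        ‖gradStack 𝒟 F (avg (rcpStep (laplacian W) (stochGrad F) 𝒞 αx η γ ω h ξ ζ S).x)‖ ^ 2 ≤
          (1 + 1 / s) * ‖gradStack 𝒟 F (avg S.x)‖ ^ 2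
            + (1 + s) / s ^ 2 * (C * drift 𝒟 F ξ S) := by
  obtain ⟨ε, b₀, hε, hε1, hε2, hb₀, hstep⟩ :=
    exists_step_contraction hlo hlh hb₁ hφ hφ1 hr hα hαr
  refine ⟨ε, b₀, hε, hε1, hε2, hb₀, fun b β₀ hb hbb hβ => ?_⟩
  obtain ⟨θ, C, ρ₁, ρ₂, hθ, hθ1, hC, hρ₂, hρ, hmain⟩ := hstep b hb hbb
  obtain ⟨Λ, hΛ⟩ : ∃ Λ : ℝ, Λ = 1 + Lf ^ 2 + Lf := ⟨_, rfl⟩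
  have hΛ0 : 0 < Λ := by rw [hΛ]; positivity
  obtain ⟨w, hw⟩ : ∃ w : ℝ, w = (β₀⁻¹) ^ 2 := ⟨_, rfl⟩
  have hw0 : 0 < w := by rw [hw]; positivity
  -- `C₁` and `C₂` weight the drift and the raw gradients in the energy, `C₃` the drift in the
  -- growth of the gradients; their sum serves everywhere.
  obtain ⟨C₁, hC₁⟩ : ∃ C₁ : ℝ, C₁ = C * ((2 * w + 8 * Lf ^ 2 * (b ^ 2 * w) * w) * Λ) := ⟨_, rfl⟩
  have hC₁0 : 0 < C₁ := by rw [hC₁]; positivity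
  obtain ⟨C₂, hC₂⟩ : ∃ C₂ : ℝ, C₂ = C * (2 * w) := ⟨_, rfl⟩
  have hC₂0 : 0 < C₂ := by rw [hC₂]; positivity
  obtain ⟨C₃, hC₃⟩ : ∃ C₃ : ℝ, C₃ = 4 * Lf ^ 2 * Λ * (b ^ 2 * w) := ⟨_, rfl⟩
  have hC₃0 : 0 < C₃ := by rw [hC₃]; positivity
  refine ⟨θ, C₁ + C₂ + C₃, ρ₁, ρ₂, hθ, hθ1, by positivity, hρ₂, hρ, ?_⟩
  intro n d W Ξ _ 𝒟 F Z 𝒞 ν s η γ ω h ξ ζ S hn hW hK hS hP hs hω hγ hη hv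
  have hs0 : 0 < s := by linarith
  have hω0 : ω ≠ 0 := by rw [hω]; positivity
  have hηγ : η * γ = b * b₁ := by rw [hη, hγ]; field_simp
  have hηω : η * ω = b := by rw [hη]; field_simp
  have hηt : η = b * (β₀ * s)⁻¹ := by rw [hη, hω, div_eq_mul_inv]
  have hη2 : η ^ 2 = b ^ 2 * w / s ^ 2 := by
    rw [hηt, mul_pow, (inv_dual_weight_sq hβ hs).1, hw]; ring
  have hdrift : 0 ≤ drift 𝒟 F ξ S := by
    have := mul_nonneg n.cast_nonneg (gap_nonneg hP (avg S.x)) (a := (n : ℝ))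
    rw [drift]; positivity
  have hM := sq_nonneg ‖gradStack 𝒟 F (avg S.x)‖
  have hx := stack_rcpStep_x (L := laplacian W) (αx := αx) (h := h) (𝒞 := 𝒞) (F := F) ξ ζ S
    hηγ hηω hηt
  have hvv := stack_rcpStep_v (L := laplacian W) (αx := αx) (γ := γ) (h := h) (𝒞 := 𝒞) (F := F)
    ξ ζ S hηω
  have hlag := lag_rcpStep (L := laplacian W) (αx := αx) (γ := γ) (η := η) (ω := ω) (h := h)
    (𝒞 := 𝒞) (F := F) ξ ζ S
  have havg := avg_rcpStep_x (αx := αx) (h := h) (𝒞 := 𝒞) (F := F) ξ ζ S hW hηγ hηω hηt hv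
  constructor
  · have h1 := hmain (Net n d) (agentOp (laplacian W)) deviation hK (β₀ * s)⁻¹ (β₀ * (s + 1))⁻¹
      (stack S.x) (stack S.v) (lag S) (compressedStack 𝒞 h ζ S) (gradsStack F ξ S)
      (gradStack 𝒟 F (avg S.x)) (gradStack 𝒟 F (avg S.x - η • avg (gradsStack F ξ S).ofLp))
      _ _ _ (deviation_eq_self hv) hx hvv hlag
    have h2 := disturbance_le (η := η) (t := (β₀ * s)⁻¹) ξ S hn hLf hS hP hK (β₀ * (s + 1))⁻¹
    obtain ⟨w1, w2, w3⟩ := inv_dual_weight_sq hβ hs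
    rw [← hw] at w1 w2 w3
    rw [← hΛ] at h2
    have h3 : (2 * ((β₀ * s)⁻¹) ^ 2 + 8 * Lf ^ 2 * η ^ 2 * ((β₀ * (s + 1))⁻¹) ^ 2) * Λ
        * drift 𝒟 F ξ S ≤ ((2 * w + 8 * Lf ^ 2 * (b ^ 2 * w) * w) * Λ) / s ^ 2
          * drift 𝒟 F ξ S := by
      apply mul_le_mul_of_nonneg_right _ hdrift
      rw [w1, hη2]
      calc (2 * (w / s ^ 2) + 8 * Lf ^ 2 * (b ^ 2 * w / s ^ 2) * ((β₀ * (s + 1))⁻¹) ^ 2) * Λ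
          ≤ (2 * (w / s ^ 2) + 8 * Lf ^ 2 * (b ^ 2 * w / s ^ 2) * w) * Λ := by gcongr
        _ = _ := by ring
    have h4 : 2 * ((β₀ * (s + 1))⁻¹ - (β₀ * s)⁻¹) ^ 2 * ‖gradStack 𝒟 F (avg S.x)‖ ^ 2 ≤
        2 * (w / s ^ 4) * ‖gradStack 𝒟 F (avg S.x)‖ ^ 2 := by gcongr
    have h5 := mul_le_mul_of_nonneg_left (h2.trans (add_le_add h3 h4)) hC.le
    have h6 : C * (((2 * w + 8 * Lf ^ 2 * (b ^ 2 * w) * w) * Λ) / s ^ 2 * drift 𝒟 F ξ S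
        + 2 * (w / s ^ 4) * ‖gradStack 𝒟 F (avg S.x)‖ ^ 2)
        = C₁ / s ^ 2 * drift 𝒟 F ξ S + C₂ / s ^ 4 * ‖gradStack 𝒟 F (avg S.x)‖ ^ 2 := by
      rw [hC₁, hC₂]; ring
    have h7 : C₁ / s ^ 2 * drift 𝒟 F ξ S ≤ (C₁ + C₂ + C₃) / s ^ 2 * drift 𝒟 F ξ S := by
      gcongr; linarith
    have h8 : C₂ / s ^ 4 * ‖gradStack 𝒟 F (avg S.x)‖ ^ 2 ≤
        (C₁ + C₂ + C₃) / s ^ 4 * ‖gradStack 𝒟 F (avg S.x)‖ ^ 2 := by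
      gcongr; linarith
    rw [h6] at h5
    simp only [energy]
    rw [havg]
    linarith
  · rw [havg]
    have h1 := norm_gradStack_next_sq_le (η := η) ξ S hn hLf hS hP hs0
    rw [hη2, ← hΛ] at h1
    have h2 : (1 + s) * (4 * Lf ^ 2 * Λ * (b ^ 2 * w / s ^ 2) * drift 𝒟 F ξ S)
        = (1 + s) / s ^ 2 * (C₃ * drift 𝒟 F ξ S) := by
      rw [hC₃]; ring
    have h3 : (1 + s) / s ^ 2 * (C₃ * drift 𝒟 F ξ S) ≤
        (1 + s) / s ^ 2 * ((C₁ + C₂ + C₃) * drift 𝒟 F ξ S) := by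
      gcongr; linarith
    linarith

/-- The pathwise descent of the optimality gap along the iteration. -/
lemma gap_step_le {n d : ℕ} {Ξ : Fin n → Type u} [∀ i, MeasurableSpace (Ξ i)]
    {𝒟 : ∀ i, Measure (Ξ i)} {F : ∀ i, Vec d → Ξ i → ℝ} {Lf ν η : ℝ} (hn : n ≠ 0) (hLf : 0 < Lf)
    (hS : IsSmoothProblem 𝒟 F Lf) (hP : IsPL 𝒟 F ν) (hη : 0 ≤ η) (hηL : η * Lf ≤ 1)
    (ξ : ∀ i, Ξ i) (S : AgentState n d) :
    gap 𝒟 F (avg S.x - η • avg (gradsStack F ξ S).ofLp) ≤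
      (1 - η * ν) * gap 𝒟 F (avg S.x)
        + η / 2 * (Lf ^ 2 * ((1 / (n : ℝ)) * ‖deviation (stack S.x)‖ ^ 2))
        + inner ℝ ((Lf * η ^ 2) • avg (localGrads 𝒟 F (stack S.x)).ofLp
            - η • gradient (globalCost 𝒟 F) (avg S.x)) (avg (noiseStack 𝒟 F S.x ξ).ofLp)
        + Lf * η ^ 2 / 2 * ‖avg (noiseStack 𝒟 F S.x ξ).ofLp‖ ^ 2 := by
  have h1 := perturbed_descent (differentiable_globalCost hS)
    (lipschitz_gradient_globalCost hn hLf hS) hη hηL (avg S.x)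
    (avg (localGrads 𝒟 F (stack S.x)).ofLp) (avg (noiseStack 𝒟 F S.x ξ).ofLp)
  have e : avg (gradsStack F ξ S).ofLp = avg (localGrads 𝒟 F (stack S.x)).ofLp
      + avg (noiseStack 𝒟 F S.x ξ).ofLp := by
    rw [← avg_add, ← gradsStack_sub_localGrads (𝒟 := 𝒟), add_sub_cancel]
  rw [← e] at h1
  have h2 := hP.pl (avg S.x)
  have h3 := card_mul_norm_avg_sq_le hn (gradStack 𝒟 F (avg S.x) - localGrads 𝒟 F (stack S.x))
  rw [avg_sub, ← gradient_globalCost hS, norm_sub_rev (gradStack 𝒟 F (avg S.x))] at h3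
  have h4 := h3.trans (norm_localGrads_sub_sq_le hS (stack S.x))
  have hn0 : (0 : ℝ) < n := Nat.cast_pos.2 (Nat.pos_of_ne_zero hn)
  -- The average of the gradients at the agents' own points is biased only through their
  -- disagreement.
  have h5 : ‖gradient (globalCost 𝒟 F) (avg S.x) - avg (localGrads 𝒟 F (stack S.x)).ofLp‖ ^ 2 ≤
      Lf ^ 2 * ((1 / (n : ℝ)) * ‖deviation (stack S.x)‖ ^ 2) := by
    rw [mul_left_comm, one_div, ← div_eq_inv_mul, le_div_iff₀ hn0]
    linarith
  have h6 := mul_le_mul_of_nonneg_left h5 (by positivity : 0 ≤ η / 2)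
  have h7 := mul_le_mul_of_nonneg_left h2 hη
  simp only [gap]
  linarith

end EnergyStep

/-! ### Square integrability along the iteration -/

section Expectation

variable {n d : ℕ} {Ξ : Fin n → Type u} [∀ i, MeasurableSpace (Ξ i)] {Z : Type v}
  [MeasurableSpace Z] {Ω : Type w} [MeasurableSpace Ω] {P : Measure Ω}
  {𝒟 : ∀ i, Measure (Ξ i)} {F : ∀ i, Vec d → Ξ i → ℝ} {𝒬 : Measure Z} {𝒞 : Vec d → Z → Vec d}
  {ξ : ∀ i, ℕ → Ω → Ξ i} {ζ : Fin n → ℕ → Ω → Z} {Lf ν σ φ r σC : ℝ}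

/-- A random state that depends on the samples before time `k` and is square integrable. -/
structure IsPastState (P : Measure Ω) (ξ : ∀ i, ℕ → Ω → Ξ i) (ζ : Fin n → ℕ → Ω → Z) (k : ℕ)
    (S : Ω → AgentState n d) : Prop where
  measurable_x : ∀ i, Measurable[sampleField ξ ζ {p | p.2 < k}] fun s => (S s).x i
  measurable_xc : ∀ i, Measurable[sampleField ξ ζ {p | p.2 < k}] fun s => (S s).xc i
  memLp_x : MemLp (fun s => (stack (S s).x : Net n d)) 2 P
  memLp_v : MemLp (fun s => (stack (S s).v : Net n d)) 2 P
  memLp_lag : MemLp (fun s => lag (S s)) 2 P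
  avg_v : ∀ s, avg (S s).v = 0

lemma memLp_linearMap {E E' : Type*} [NormedAddCommGroup E] [NormedSpace ℝ E]
    [FiniteDimensional ℝ E] [NormedAddCommGroup E'] [NormedSpace ℝ E'] (A : E →ₗ[ℝ] E')
    {u : Ω → E} (hu : MemLp u 2 P) : MemLp (fun s => A (u s)) 2 P :=
  (LinearMap.toContinuousLinearMap A).comp_memLp' hu

lemma memLp_avg {u : Ω → Net n d} (hu : MemLp u 2 P) : MemLp (fun s => avg (u s).ofLp) 2 P :=
  (memLp_finsetSum _ fun i _ => memLp_piLp_iff.1 hu i).const_smul (1 / (n : ℝ))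

variable [IsProbabilityMeasure P]

lemma memLp_gradient_localCost (hS : IsSmoothProblem 𝒟 F Lf) (i : Fin n) {u : Ω → Vec d}
    (hu : MemLp u 2 P) : MemLp (fun s => gradient (localCost 𝒟 F i) (u s)) 2 P := by
  refine ((memLp_const ‖gradient (localCost 𝒟 F i) 0‖).add (hu.norm.const_mul Lf)).mono
    ((continuous_gradient_localCost hS i).comp_aestronglyMeasurable hu.aestronglyMeasurable)
    (Filter.Eventually.of_forall fun s => ?_)
  have h1 := hS.lipschitz i (u s) 0
  rw [sub_zero] at h1
  have h2 := norm_sub_norm_le (gradient (localCost 𝒟 F i) (u s)) (gradient (localCost 𝒟 F i) 0)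
  simp only [Pi.add_apply, Real.norm_eq_abs]
  exact le_trans (by linarith) (le_abs_self _)

lemma memLp_gradStack (hS : IsSmoothProblem 𝒟 F Lf) {u : Ω → Vec d} (hu : MemLp u 2 P) :
    MemLp (fun s => gradStack 𝒟 F (u s)) 2 P :=
  memLp_piLp_iff.2 fun i => memLp_gradient_localCost hS i hu

lemma memLp_localGrads (hS : IsSmoothProblem 𝒟 F Lf) {u : Ω → Net n d} (hu : MemLp u 2 P) :
    MemLp (fun s => localGrads 𝒟 F (u s)) 2 P :=
  memLp_piLp_iff.2 fun i => memLp_gradient_localCost hS i (memLp_piLp_iff.1 hu i)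

lemma integrable_gap (hn : n ≠ 0) (hν : 0 < ν) (hS : IsSmoothProblem 𝒟 F Lf) (hP : IsPL 𝒟 F ν)
    {u : Ω → Vec d} (hu : MemLp u 2 P) : Integrable (fun s => gap 𝒟 F (u s)) P := by
  refine (((memLp_gradStack hS hu).integrable_norm_pow two_ne_zero).const_mul
    (1 / (2 * ν * n))).mono' ?_ (Filter.Eventually.of_forall fun s => ?_)
  · exact ((differentiable_globalCost hS).continuous.sub continuous_const).comp_aestronglyMeasurable
      hu.aestronglyMeasurable
  · rw [Real.norm_eq_abs, abs_of_nonneg (gap_nonneg hP _)]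
    exact gap_le_norm_gradStack hn hν hS hP _

lemma integrable_energy (hS : IsSmoothProblem 𝒟 F Lf) (L : Matrix (Fin n) (Fin n) ℝ) (ε t : ℝ)
    {S : Ω → AgentState n d} (hx : MemLp (fun s => (stack (S s).x : Net n d)) 2 P)
    (hv : MemLp (fun s => (stack (S s).v : Net n d)) 2 P) (hl : MemLp (fun s => lag (S s)) 2 P) :
    Integrable (fun s => energy 𝒟 F L ε t (S s)) P := by
  have he := memLp_linearMap deviation hx
  have hA := memLp_linearMap (agentOp L) he
  have hq : MemLp (fun s => (stack (S s).v : Net n d)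
      + t • deviation (gradStack 𝒟 F (avg (S s).x))) 2 P :=
    hv.add ((memLp_linearMap deviation (memLp_gradStack hS (memLp_avg hx))).const_smul t)
  exact (((integrable_inner_of_memLp_two he hA).add (hq.integrable_norm_pow two_ne_zero)).add
    ((integrable_inner_of_memLp_two he hq).const_mul (2 * ε))).add
      (hl.integrable_norm_pow two_ne_zero)

variable {k : ℕ} {S : Ω → AgentState n d}

lemma IsPastState.compressed_moment (hp : IsPastState P ξ ζ k S) (hC : IsCompressor 𝒬 𝒞 φ r σC)
    (hr : 0 < r) (hs : IsFreshSampling P 𝒟 𝒬 ξ ζ) {h : ℝ} (hh : 0 < h) :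
    MemLp (fun s => compressedStack 𝒞 h (fun i => ζ i k s) (S s)) 2 P ∧
      ∫ s, ‖r⁻¹ • compressedStack 𝒞 h (fun i => ζ i k s) (S s) - lag (S s)‖ ^ 2 ∂P ≤
        (1 - φ) * ∫ s, ‖lag (S s)‖ ^ 2 ∂P + n * (h ^ 2 * σC) :=
  compressorStack_moment hC hr hs hh (y := fun s i => (S s).x i - (S s).xc i)
    (fun i => (hp.measurable_x i).sub (hp.measurable_xc i)) (memLp_piLp_iff.1 hp.memLp_lag)

lemma IsPastState.noise_moment (hp : IsPastState P ξ ζ k S) (hS : IsSmoothProblem 𝒟 F Lf)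
    (hO : IsGradientOracle 𝒟 F σ) (hs : IsFreshSampling P 𝒟 𝒬 ξ ζ) :
    MemLp (fun s => noiseStack 𝒟 F (S s).x fun i => ξ i k s) 2 P ∧
      ∫ s, ‖noiseStack 𝒟 F (S s).x fun i => ξ i k s‖ ^ 2 ∂P ≤ n * σ ^ 2 :=
  noiseStack_moment hS hO hs (x := fun s => (S s).x) hp.measurable_x

lemma IsPastState.memLp_grads (hp : IsPastState P ξ ζ k S) (hS : IsSmoothProblem 𝒟 F Lf)
    (hO : IsGradientOracle 𝒟 F σ) (hs : IsFreshSampling P 𝒟 𝒬 ξ ζ) :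
    MemLp (fun s => gradsStack F (fun i => ξ i k s) (S s)) 2 P := by
  have h := (hp.noise_moment hS hO hs).1.add (memLp_localGrads hS hp.memLp_x)
  refine h.ae_eq (Filter.Eventually.of_forall fun s => ?_)
  simp only [Pi.add_apply]
  rw [← gradsStack_sub_localGrads, sub_add_cancel]

/-- Square integrability is preserved by an iteration. -/
lemma IsPastState.memLp_step (hp : IsPastState P ξ ζ k S) (hS : IsSmoothProblem 𝒟 F Lf)
    (hO : IsGradientOracle 𝒟 F σ) (hC : IsCompressor 𝒬 𝒞 φ r σC) (hr : 0 < r)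
    (hs : IsFreshSampling P 𝒟 𝒬 ξ ζ) (L : Matrix (Fin n) (Fin n) ℝ) {αx η γ ω h b b₁ t : ℝ}
    (hh : 0 < h) (hηγ : η * γ = b * b₁) (hηω : η * ω = b) (hη : η = b * t) :
    MemLp (fun s => (stack (rcpStep L (stochGrad F) 𝒞 αx η γ ω h (fun i => ξ i k s)
        (fun i => ζ i k s) (S s)).x : Net n d)) 2 P ∧
      MemLp (fun s => (stack (rcpStep L (stochGrad F) 𝒞 αx η γ ω h (fun i => ξ i k s)
        (fun i => ζ i k s) (S s)).v : Net n d)) 2 P ∧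
      MemLp (fun s => lag (rcpStep L (stochGrad F) 𝒞 αx η γ ω h (fun i => ξ i k s)
        (fun i => ζ i k s) (S s))) 2 P := by
  have hc := (hp.compressed_moment hC hr hs hh).1
  have hg := hp.memLp_grads hS hO hs
  have hA := memLp_linearMap (agentOp L) ((hp.memLp_x.sub hp.memLp_lag).add hc)
  have hx : MemLp (fun s => (stack (rcpStep L (stochGrad F) 𝒞 αx η γ ω h (fun i => ξ i k s)
        (fun i => ζ i k s) (S s)).x : Net n d)) 2 P := by
    simp_rw [stack_rcpStep_x _ _ _ hηγ hηω hη]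
    exact hp.memLp_x.sub ((((hA.const_smul b₁).add hp.memLp_v).add (hg.const_smul t)).const_smul b)
  refine ⟨hx, ?_, ?_⟩
  · simp_rw [stack_rcpStep_v _ _ _ hηω]
    exact hp.memLp_v.add (hA.const_smul b)
  · simp_rw [lag_rcpStep]
    exact hx.sub ((hp.memLp_x.sub hp.memLp_lag).add (hc.const_smul αx))

/-- The iterates are square integrable and depend on past samples only. -/
lemma isPastState_rcpSGD {W : Matrix (Fin n) (Fin n) ℝ} (hW : ∀ i j, W i j = W j i)
    (hS : IsSmoothProblem 𝒟 F Lf) (hO : IsGradientOracle 𝒟 F σ) (hC : IsCompressor 𝒬 𝒞 φ r σC)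
    (hr : 0 < r) (hs : IsFreshSampling P 𝒟 𝒬 ξ ζ) {αx b b₁ : ℝ} {η γ ω h : ℕ → ℝ}
    (hh : ∀ k, 0 < h k) (hω : ∀ k, ω k ≠ 0) (hγ : ∀ k, γ k = b₁ * ω k) (hη : ∀ k, η k = b / ω k)
    (x₀ : Fin n → Vec d) (k : ℕ) :
    IsPastState P ξ ζ k fun s => rcpSGD (laplacian W) (stochGrad F) 𝒞 αx η γ ω h x₀
      (fun i k => ξ i k s) (fun i k => ζ i k s) k := by
  -- Measurability is taken with respect to the samples strictly before time `k`, which makes the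
  -- samples at time `k` fresh.
  have hmeas := fun k i => @measurable_rcpSGD n d Ω Ξ _ Z _ (sampleField ξ ζ {p | p.2 < k})
    (laplacian W) (stochGrad F) 𝒞 hO.measurable hC.measurable αx η γ ω h x₀ ξ ζ k
    (fun i j hj => measurable_data_sampleField hj) (fun i j hj => measurable_seed_sampleField hj) i
  induction k with
  | zero =>
    exact ⟨fun i => (hmeas 0 i).1, fun i => (hmeas 0 i).2.2, memLp_const (stack x₀ : Net n d),
      memLp_const (stack fun _ => 0 : Net n d), memLp_const (lag (⟨x₀, fun _ => 0, fun _ => 0⟩ : AgentState n d)),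
      fun s => by simp [rcpSGD, avg]⟩
  | succ k ih =>
    have hηγ : η k * γ k = b * b₁ := by
      rw [hη, hγ]; field_simp [hω k]
    have hηω : η k * ω k = b := by rw [hη]; field_simp [hω k]
    have h1 := ih.memLp_step hS hO hC hr hs (laplacian W) (αx := αx) (hh k) hηγ hηω
      (by rw [hη, div_eq_mul_inv])
    exact ⟨fun i => (hmeas (k + 1) i).1, fun i => (hmeas (k + 1) i).2.2, h1.1, h1.2.1, h1.2.2,
      fun s => avg_rcpStep_v _ _ _ hW hηω (ih.avg_v s)⟩

lemma integrable_drift (hn : n ≠ 0) (hν : 0 < ν) (hp : IsPastState P ξ ζ k S)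
    (hS : IsSmoothProblem 𝒟 F Lf) (hP : IsPL 𝒟 F ν) (hO : IsGradientOracle 𝒟 F σ)
    (hs : IsFreshSampling P 𝒟 𝒬 ξ ζ) :
    Integrable (fun s => drift 𝒟 F (fun i => ξ i k s) (S s)) P :=
  (((hp.noise_moment hS hO hs).1.integrable_norm_pow two_ne_zero).add
    ((memLp_linearMap deviation hp.memLp_x).integrable_norm_pow two_ne_zero)).add
      ((integrable_gap hn hν hS hP (memLp_avg hp.memLp_x)).const_mul (n : ℝ))

lemma norm_deviation_sq_le_energy {L : Matrix (Fin n) (Fin n) ℝ} {lo hi ε t : ℝ} (hlo : 0 < lo)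
    (hK : IsConsensusPair (agentOp L : Net n d →ₗ[ℝ] Net n d) deviation lo hi)
    (hε : 4 * ε ^ 2 ≤ lo) (S : AgentState n d) :
    ‖deviation (stack S.x)‖ ^ 2 ≤ 2 / lo * energy 𝒟 F L ε t S := by
  have h := le_lyapunov hK hε (hK.idem (stack S.x))
    (stack S.v + t • deviation (gradStack 𝒟 F (avg S.x)))
  have h2 : lo / 2 * ‖deviation (stack S.x)‖ ^ 2 ≤ energy 𝒟 F L ε t S := by
    rw [energy]
    have := sq_nonneg ‖stack S.v + t • deviation (gradStack 𝒟 F (avg S.x))‖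
    have := sq_nonneg ‖lag S‖
    linarith
  calc _ = 2 / lo * (lo / 2 * ‖deviation (stack S.x)‖ ^ 2) := by field_simp
    _ ≤ _ := by gcongr

lemma energy_nonneg {L : Matrix (Fin n) (Fin n) ℝ} {lo hi ε t : ℝ} (hlo : 0 < lo)
    (hK : IsConsensusPair (agentOp L : Net n d →ₗ[ℝ] Net n d) deviation lo hi)
    (hε : 4 * ε ^ 2 ≤ lo) (S : AgentState n d) : 0 ≤ energy 𝒟 F L ε t S := by
  have h := norm_deviation_sq_le_energy (𝒟 := 𝒟) (F := F) (t := t) hlo hK hε S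
  exact nonneg_of_mul_nonneg_right ((sq_nonneg _).trans h) (by positivity)

lemma energy_le {L : Matrix (Fin n) (Fin n) ℝ} {lo hi ε t : ℝ} (hhi : 0 ≤ hi)
    (hK : IsConsensusPair (agentOp L : Net n d →ₗ[ℝ] Net n d) deviation lo hi)
    (hε : 0 < ε) (hε1 : ε ≤ 1) (S : AgentState n d) :
    energy 𝒟 F L ε t S ≤ (hi + 2) * (‖deviation (stack S.x)‖ ^ 2
      + ‖stack S.v + t • deviation (gradStack 𝒟 F (avg S.x))‖ ^ 2 + ‖lag S‖ ^ 2) := by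
  have h := lyapunov_le hK hε hε1 hhi (deviation (stack S.x))
    (stack S.v + t • deviation (gradStack 𝒟 F (avg S.x)))
  rw [energy]
  nlinarith [sq_nonneg ‖lag S‖]

lemma integral_drift_le (hn : n ≠ 0) (hν : 0 < ν) (hp : IsPastState P ξ ζ k S)
    (hS : IsSmoothProblem 𝒟 F Lf) (hP : IsPL 𝒟 F ν) (hO : IsGradientOracle 𝒟 F σ)
    (hs : IsFreshSampling P 𝒟 𝒬 ξ ζ) {L : Matrix (Fin n) (Fin n) ℝ} {lo hi ε : ℝ} (hlo : 0 < lo)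
    (hK : IsConsensusPair (agentOp L : Net n d →ₗ[ℝ] Net n d) deviation lo hi)
    (hε : 4 * ε ^ 2 ≤ lo) (t : ℝ) :
    ∫ s, drift 𝒟 F (fun i => ξ i k s) (S s) ∂P ≤ n * σ ^ 2
      + 2 / lo * ∫ s, energy 𝒟 F L ε t (S s) ∂P + n * ∫ s, gap 𝒟 F (avg (S s).x) ∂P := by
  have h1 := (hp.noise_moment hS hO hs).1.integrable_norm_pow two_ne_zero
  have h2 := (memLp_linearMap deviation hp.memLp_x).integrable_norm_pow two_ne_zero
  have h3 := integrable_gap hn hν hS hP (memLp_avg hp.memLp_x)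
  have h4 := integrable_energy hS L ε t hp.memLp_x hp.memLp_v hp.memLp_lag
  have e : ∫ s, drift 𝒟 F (fun i => ξ i k s) (S s) ∂P =
      ∫ s, ‖noiseStack 𝒟 F (S s).x fun i => ξ i k s‖ ^ 2 ∂P
        + ∫ s, ‖deviation (stack (S s).x : Net n d)‖ ^ 2 ∂P
        + n * ∫ s, gap 𝒟 F (avg (S s).x) ∂P := by
    have e1 : ∫ s, drift 𝒟 F (fun i => ξ i k s) (S s) ∂P =
        ∫ s, (‖noiseStack 𝒟 F (S s).x fun i => ξ i k s‖ ^ 2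
          + ‖deviation (stack (S s).x : Net n d)‖ ^ 2) ∂P + ∫ s, n * gap 𝒟 F (avg (S s).x) ∂P :=
      integral_add (h1.add h2) (h3.const_mul (n : ℝ))
    rw [e1, integral_const_mul, integral_add h1 h2]
  have h5 : ∫ s, ‖deviation (stack (S s).x : Net n d)‖ ^ 2 ∂P ≤
      2 / lo * ∫ s, energy 𝒟 F L ε t (S s) ∂P := by
    rw [← integral_const_mul]
    exact integral_mono h2 (h4.const_mul _) fun s => norm_deviation_sq_le_energy hlo hK hε (S s)
  have h6 := (hp.noise_moment hS hO hs).2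
  linarith

end Expectation

/-! ### Recursions in expectation -/

section Recursions

variable {n d : ℕ} {Ξ : Fin n → Type u} [∀ i, MeasurableSpace (Ξ i)] {Z : Type v}
  [MeasurableSpace Z] {Ω : Type w} [MeasurableSpace Ω] {P : Measure Ω} [IsProbabilityMeasure P]
  {𝒟 : ∀ i, Measure (Ξ i)} {F : ∀ i, Vec d → Ξ i → ℝ} {𝒬 : Measure Z} {𝒞 : Vec d → Z → Vec d}
  {ξ : ∀ i, ℕ → Ω → Ξ i} {ζ : Fin n → ℕ → Ω → Z} {Lf ν σ φ r σC : ℝ}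
  {k : ℕ} {S S' : Ω → AgentState n d} {L : Matrix (Fin n) (Fin n) ℝ} {lo hi ε : ℝ}

/-- The recursion of the expected energy. -/
lemma expected_energy_step (hn : n ≠ 0) (hν : 0 < ν) (hp : IsPastState P ξ ζ k S)
    (hp' : IsPastState P ξ ζ (k + 1) S')
    (hS : IsSmoothProblem 𝒟 F Lf) (hP : IsPL 𝒟 F ν) (hO : IsGradientOracle 𝒟 F σ)
    (hC : IsCompressor 𝒬 𝒞 φ r σC) (hr : 0 < r)
    (hs : IsFreshSampling P 𝒟 𝒬 ξ ζ) (hlo : 0 < lo) (hhi : 0 < hi)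
    (hK : IsConsensusPair (agentOp L : Net n d →ₗ[ℝ] Net n d) deviation lo hi)
    (hε0 : 0 < ε) (hε1 : ε ≤ 1) (hε : 4 * ε ^ 2 ≤ lo) {θ C ρ₁ ρ₂ t t' s h : ℝ} (hθ : 0 < θ)
    (hC0 : 0 < C) (hρ₂ : 0 ≤ ρ₂) (hρ : ρ₁ + ρ₂ * (1 - φ) ≤ 1 - θ) (hs0 : 0 < s) (hh : 0 < h)
    (hpath : ∀ x, energy 𝒟 F L ε t' (S' x) ≤ energy 𝒟 F L ε t (S x)
      - θ * (‖deviation (stack (S x).x)‖ ^ 2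
        + ‖stack (S x).v + t • deviation (gradStack 𝒟 F (avg (S x).x))‖ ^ 2)
      + (ρ₁ - 1) * ‖lag (S x)‖ ^ 2
      + ρ₂ * ‖r⁻¹ • compressedStack 𝒞 h (fun i => ζ i k x) (S x) - lag (S x)‖ ^ 2
      + C / s ^ 2 * drift 𝒟 F (fun i => ξ i k x) (S x)
      + C / s ^ 4 * ‖gradStack 𝒟 F (avg (S x).x)‖ ^ 2) :
    ∫ x, energy 𝒟 F L ε t' (S' x) ∂P ≤ (1 - θ / (hi + 2)) * ∫ x, energy 𝒟 F L ε t (S x) ∂P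
      + ρ₂ * (n * (h ^ 2 * σC))
      + C / s ^ 2 * (n * σ ^ 2 + 2 / lo * ∫ x, energy 𝒟 F L ε t (S x) ∂P
        + n * ∫ x, gap 𝒟 F (avg (S x).x) ∂P)
      + C / s ^ 4 * ∫ x, ‖gradStack 𝒟 F (avg (S x).x)‖ ^ 2 ∂P := by
  have i0 := integrable_energy hS L ε t' hp'.memLp_x hp'.memLp_v hp'.memLp_lag (F := F) (𝒟 := 𝒟)
  have i1 := integrable_energy hS L ε t hp.memLp_x hp.memLp_v hp.memLp_lag (F := F) (𝒟 := 𝒟)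
  have i2 := hp.memLp_lag.integrable_norm_pow two_ne_zero
  have i3 : Integrable (fun x =>
      ‖r⁻¹ • compressedStack 𝒞 h (fun i => ζ i k x) (S x) - lag (S x)‖ ^ 2) P :=
    (((hp.compressed_moment hC hr hs hh).1.const_smul r⁻¹).sub
      hp.memLp_lag).integrable_norm_pow two_ne_zero
  have i4 := integrable_drift hn hν hp hS hP hO hs
  have i5 := (memLp_gradStack (F := F) (𝒟 := 𝒟) hS (memLp_avg hp.memLp_x)).integrable_norm_pow
    two_ne_zero
  -- The decay of the squared norms becomes decay of the energy through `energy_le`. The lag then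
  -- carries `ρ₁ - 1 + θ`, which together with the `ρ₂ * (1 - φ)` from the compressor is
  -- nonpositive.
  have hpath' : ∀ x, energy 𝒟 F L ε t' (S' x) ≤ (1 - θ / (hi + 2)) * energy 𝒟 F L ε t (S x)
      + ((ρ₁ - 1 + θ) * ‖lag (S x)‖ ^ 2
      + (ρ₂ * ‖r⁻¹ • compressedStack 𝒞 h (fun i => ζ i k x) (S x) - lag (S x)‖ ^ 2
      + (C / s ^ 2 * drift 𝒟 F (fun i => ξ i k x) (S x)
      + C / s ^ 4 * ‖gradStack 𝒟 F (avg (S x).x)‖ ^ 2))) := by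
    intro x
    have h1 := hpath x
    have h2 := mul_le_mul_of_nonneg_left (energy_le (𝒟 := 𝒟) (F := F) (t := t) hhi.le hK hε0 hε1
      (S x)) (by positivity : 0 ≤ θ / (hi + 2))
    have h3 : ∀ Y : ℝ, θ / (hi + 2) * ((hi + 2) * Y) = θ * Y := fun Y => by
      field_simp
    rw [h3] at h2
    linarith
  have hint : ∫ x, energy 𝒟 F L ε t' (S' x) ∂P ≤
      (1 - θ / (hi + 2)) * ∫ x, energy 𝒟 F L ε t (S x) ∂P
      + ((ρ₁ - 1 + θ) * ∫ x, ‖lag (S x)‖ ^ 2 ∂P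
      + (ρ₂ * ∫ x, ‖r⁻¹ • compressedStack 𝒞 h (fun i => ζ i k x) (S x) - lag (S x)‖ ^ 2 ∂P
      + (C / s ^ 2 * ∫ x, drift 𝒟 F (fun i => ξ i k x) (S x) ∂P
      + C / s ^ 4 * ∫ x, ‖gradStack 𝒟 F (avg (S x).x)‖ ^ 2 ∂P))) := by
    have j5 := i5.const_mul (C / s ^ 4)
    have j4 := i4.const_mul (C / s ^ 2)
    have j3 := i3.const_mul ρ₂
    have j2 := i2.const_mul (ρ₁ - 1 + θ)
    have j1 := i1.const_mul (1 - θ / (hi + 2))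
    have hint := integral_mono i0 (j1.add (j2.add (j3.add (j4.add j5)))) hpath'
    have e1 := integral_add j1 (j2.add (j3.add (j4.add j5)))
    have e2 := integral_add j2 (j3.add (j4.add j5))
    have e3 := integral_add j3 (j4.add j5)
    have e4 := integral_add j4 j5
    rw [integral_const_mul] at e1 e2 e3 e4
    rw [integral_const_mul (C / s ^ 4)] at e4
    simp only [Pi.add_apply] at hint e1 e2 e3 e4
    rwa [e1, e2, e3, e4] at hint
  have h1 := mul_le_mul_of_nonneg_left (hp.compressed_moment hC hr hs hh).2 hρ₂
  have h2 := mul_le_mul_of_nonneg_left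
    (integral_drift_le hn hν hp hS hP hO hs hlo hK hε t) (by positivity : 0 ≤ C / s ^ 2)
  have h3 : 0 ≤ ∫ x, ‖lag (S x)‖ ^ 2 ∂P := integral_nonneg fun x => sq_nonneg _
  have h4 := mul_le_mul_of_nonneg_right hρ h3
  linarith

/-- The recursion of the expected squared gradients at the average. -/
lemma expected_gradStack_step (hn : n ≠ 0) (hν : 0 < ν) (hp : IsPastState P ξ ζ k S)
    (hp' : IsPastState P ξ ζ (k + 1) S')
    (hS : IsSmoothProblem 𝒟 F Lf) (hP : IsPL 𝒟 F ν) (hO : IsGradientOracle 𝒟 F σ)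
    (hs : IsFreshSampling P 𝒟 𝒬 ξ ζ) (hlo : 0 < lo)
    (hK : IsConsensusPair (agentOp L : Net n d →ₗ[ℝ] Net n d) deviation lo hi)
    (hε : 4 * ε ^ 2 ≤ lo) {C t s : ℝ} (hC0 : 0 < C) (hs0 : 0 < s)
    (hpath : ∀ x, ‖gradStack 𝒟 F (avg (S' x).x)‖ ^ 2 ≤
      (1 + 1 / s) * ‖gradStack 𝒟 F (avg (S x).x)‖ ^ 2
        + (1 + s) / s ^ 2 * (C * drift 𝒟 F (fun i => ξ i k x) (S x))) :
    ∫ x, ‖gradStack 𝒟 F (avg (S' x).x)‖ ^ 2 ∂P ≤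
      (1 + 1 / s) * ∫ x, ‖gradStack 𝒟 F (avg (S x).x)‖ ^ 2 ∂P
        + (1 + s) / s ^ 2 * (C * (n * σ ^ 2 + 2 / lo * ∫ x, energy 𝒟 F L ε t (S x) ∂P
        + n * ∫ x, gap 𝒟 F (avg (S x).x) ∂P)) := by
  have i0 := (memLp_gradStack (F := F) (𝒟 := 𝒟) hS (memLp_avg hp'.memLp_x)).integrable_norm_pow
    two_ne_zero
  have i1 := (memLp_gradStack (F := F) (𝒟 := 𝒟) hS (memLp_avg hp.memLp_x)).integrable_norm_pow
    two_ne_zero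
  have i4 := integrable_drift hn hν hp hS hP hO hs
  have hint := integral_mono i0 ((i1.const_mul (1 + 1 / s)).add
    ((i4.const_mul C).const_mul ((1 + s) / s ^ 2))) hpath
  have e : ∫ x, ((1 + 1 / s) * ‖gradStack 𝒟 F (avg (S x).x)‖ ^ 2
        + (1 + s) / s ^ 2 * (C * drift 𝒟 F (fun i => ξ i k x) (S x))) ∂P =
      (1 + 1 / s) * ∫ x, ‖gradStack 𝒟 F (avg (S x).x)‖ ^ 2 ∂P
        + (1 + s) / s ^ 2 * (C * ∫ x, drift 𝒟 F (fun i => ξ i k x) (S x) ∂P) := by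
    simp_rw [← integral_const_mul]
    exact integral_add (i1.const_mul (1 + 1 / s)) ((i4.const_mul C).const_mul ((1 + s) / s ^ 2))
  refine (hint.trans_eq e).trans ?_
  have h2 := mul_le_mul_of_nonneg_left
    (integral_drift_le hn hν hp hS hP hO hs hlo hK hε t) (by positivity : 0 ≤ (1 + s) / s ^ 2 * C)
  linarith

/-- The recursion of the expected optimality gap. -/
lemma expected_gap_step (hn : n ≠ 0) (hν : 0 < ν) (hLf : 0 < Lf) (hp : IsPastState P ξ ζ k S)
    (hp' : IsPastState P ξ ζ (k + 1) S')
    (hS : IsSmoothProblem 𝒟 F Lf) (hP : IsPL 𝒟 F ν) (hO : IsGradientOracle 𝒟 F σ)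
    (hs : IsFreshSampling P 𝒟 𝒬 ξ ζ) (hlo : 0 < lo)
    (hK : IsConsensusPair (agentOp L : Net n d →ₗ[ℝ] Net n d) deviation lo hi)
    (hε : 4 * ε ^ 2 ≤ lo) {t η : ℝ} (hη : 0 ≤ η) (hηL : η * Lf ≤ 1)
    (havg : ∀ x, avg (S' x).x =
      avg (S x).x - η • avg (gradsStack F (fun i => ξ i k x) (S x)).ofLp) :
    ∫ x, gap 𝒟 F (avg (S' x).x) ∂P ≤ (1 - η * ν) * ∫ x, gap 𝒟 F (avg (S x).x) ∂P
      + η / 2 * (Lf ^ 2 * ((1 / (n : ℝ)) * (2 / lo * ∫ x, energy 𝒟 F L ε t (S x) ∂P)))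
      + Lf * η ^ 2 / 2 * (σ ^ 2 / n) := by
  have i0 := integrable_gap hn hν hS hP (memLp_avg hp'.memLp_x)
  have i1 := integrable_gap hn hν hS hP (memLp_avg hp.memLp_x)
  have i2 := integrable_energy hS L ε t hp.memLp_x hp.memLp_v hp.memLp_lag (F := F) (𝒟 := 𝒟)
  obtain ⟨m3, h3⟩ := avg_noiseStack_moment hn hS hO hs (x := fun s => (S s).x) hp.measurable_x
  have i3 := m3.integrable_norm_pow two_ne_zero
  have mB : MemLp (fun x => (Lf * η ^ 2) • avg (localGrads 𝒟 F (stack (S x).x)).ofLp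
      - η • gradient (globalCost 𝒟 F) (avg (S x).x)) 2 P := by
    simp_rw [gradient_globalCost hS]
    exact ((memLp_avg (memLp_localGrads hS hp.memLp_x)).const_smul (Lf * η ^ 2)).sub
      ((memLp_avg (memLp_gradStack hS (memLp_avg hp.memLp_x))).const_smul η)
  have measB : Measurable[sampleField ξ ζ {p | p.2 < k}]
      (fun x => (Lf * η ^ 2) • avg (localGrads 𝒟 F (stack (S x).x)).ofLp
      - η • gradient (globalCost 𝒟 F) (avg (S x).x)) := by
    simp_rw [gradient_globalCost hS]
    have hg := fun i => (continuous_gradient_localCost hS i).measurable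
    have ha : Measurable[sampleField ξ ζ {p | p.2 < k}] (fun x => avg (S x).x) :=
      (Finset.measurable_sum _ fun i _ => hp.measurable_x i).fun_const_smul (1 / (n : ℝ))
    have h1 : Measurable[sampleField ξ ζ {p | p.2 < k}]
        (fun x => avg (localGrads 𝒟 F (stack (S x).x)).ofLp) :=
      (Finset.measurable_sum _ fun i _ =>
        (hg i).comp (hp.measurable_x i)).fun_const_smul (1 / (n : ℝ))
    have h2 : Measurable[sampleField ξ ζ {p | p.2 < k}]
        (fun x => avg (gradStack 𝒟 F (avg (S x).x)).ofLp) :=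
      (Finset.measurable_sum _ fun i _ => (hg i).comp ha).fun_const_smul (1 / (n : ℝ))
    exact (h1.fun_const_smul _).sub (h2.fun_const_smul _)
  -- The coefficient of the noise depends on the past only, so the linear term has zero mean and the
  -- noise contributes at order `η ^ 2`.
  have h4 := integral_inner_avg_noiseStack hS hO hs (x := fun s => (S s).x) hp.measurable_x measB mB
  have i4 := integrable_inner_of_memLp_two mB m3
  have hpath : ∀ x, gap 𝒟 F (avg (S' x).x) ≤ (1 - η * ν) * gap 𝒟 F (avg (S x).x)
      + (η / 2 * Lf ^ 2 * (1 / (n : ℝ)) * (2 / lo) * energy 𝒟 F L ε t (S x)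
      + (inner ℝ ((Lf * η ^ 2) • avg (localGrads 𝒟 F (stack (S x).x)).ofLp
        - η • gradient (globalCost 𝒟 F) (avg (S x).x))
          (avg (noiseStack 𝒟 F (S x).x fun i => ξ i k x).ofLp)
      + Lf * η ^ 2 / 2 * ‖avg (noiseStack 𝒟 F (S x).x fun i => ξ i k x).ofLp‖ ^ 2)) := by
    intro x
    have h5 := gap_step_le hn hLf hS hP hη hηL (fun i => ξ i k x) (S x)
    rw [← havg] at h5
    have h6 := mul_le_mul_of_nonneg_left (norm_deviation_sq_le_energy (𝒟 := 𝒟) (F := F) (t := t)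
      hlo hK hε (S x)) (by positivity : 0 ≤ η / 2 * Lf ^ 2 * (1 / (n : ℝ)))
    linarith
  have j1 := i1.const_mul (1 - η * ν)
  have j2 := i2.const_mul (η / 2 * Lf ^ 2 * (1 / (n : ℝ)) * (2 / lo))
  have j3 := i3.const_mul (Lf * η ^ 2 / 2)
  have hint := integral_mono i0 (j1.add (j2.add (i4.add j3))) hpath
  have e1 := integral_add j1 (j2.add (i4.add j3))
  have e2 := integral_add j2 (i4.add j3)
  have e3 := integral_add i4 j3
  rw [integral_const_mul] at e1 e2 e3
  simp only [Pi.add_apply] at hint e1 e2 e3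
  rw [e1, e2, e3, h4] at hint
  have h7 := mul_le_mul_of_nonneg_left h3 (by positivity : 0 ≤ Lf * η ^ 2 / 2)
  linarith

end Recursions

/-! ### Bounds on the initial values -/

section Initial

variable {n d : ℕ} {Ξ : Fin n → Type u} [∀ i, MeasurableSpace (Ξ i)]
  {𝒟 : ∀ i, Measure (Ξ i)} {F : ∀ i, Vec d → Ξ i → ℝ} {Lf ν R : ℝ} {x₀ : Fin n → Vec d}
  {L : Matrix (Fin n) (Fin n) ℝ} {lo hi ε : ℝ}

lemma initial_sum_le (hn : n ≠ 0)
    (hR : (1 / (n : ℝ)) * ∑ i, (‖x₀ i‖ ^ 2 + ‖gradient (localCost 𝒟 F i) (x₀ i)‖ ^ 2) ≤ R) :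
    ‖(stack x₀ : Net n d)‖ ^ 2 + ‖localGrads 𝒟 F (stack x₀)‖ ^ 2 ≤ n * R := by
  have hn0 : (0 : ℝ) < n := Nat.cast_pos.2 (Nat.pos_of_ne_zero hn)
  rw [net_norm_sq, net_norm_sq, ← Finset.sum_add_distrib]
  rw [one_div, ← div_eq_inv_mul, div_le_iff₀ hn0] at hR
  exact hR.trans_eq (mul_comm _ _)

lemma initial_gradStack_le (hn : n ≠ 0) (hS : IsSmoothProblem 𝒟 F Lf)
    (hK : IsConsensusPair (agentOp L : Net n d →ₗ[ℝ] Net n d) deviation lo hi)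
    (hR : (1 / (n : ℝ)) * ∑ i, (‖x₀ i‖ ^ 2 + ‖gradient (localCost 𝒟 F i) (x₀ i)‖ ^ 2) ≤ R) :
    ‖gradStack 𝒟 F (avg x₀)‖ ^ 2 ≤ n * ((2 + 2 * Lf ^ 2) * R) := by
  have h1 := initial_sum_le hn hR
  have h2 := norm_sub_sq_le_two (localGrads 𝒟 F (stack x₀))
    (localGrads 𝒟 F (stack x₀) - gradStack 𝒟 F (avg x₀))
  rw [sub_sub_cancel] at h2
  have h3 := norm_localGrads_sub_sq_le hS (stack x₀)
  have h4 := hK.norm_sq_le (stack x₀)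
  have h5 : ‖localGrads 𝒟 F (stack x₀) - gradStack 𝒟 F (avg x₀)‖ ^ 2 ≤
    Lf ^ 2 * ‖(stack x₀ : Net n d)‖ ^ 2 := h3.trans (mul_le_mul_of_nonneg_left h4 (sq_nonneg _))
  have h6 : 0 ≤ ‖(stack x₀ : Net n d)‖ ^ 2 := sq_nonneg _
  have h7 : 0 ≤ Lf ^ 2 * ‖localGrads 𝒟 F (stack x₀)‖ ^ 2 := by positivity
  have h8 := mul_le_mul_of_nonneg_left h1 (by positivity : 0 ≤ 2 + 2 * Lf ^ 2)
  linarith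

lemma initial_energy_le (hn : n ≠ 0) (hS : IsSmoothProblem 𝒟 F Lf) (hhi : 0 ≤ hi)
    (hK : IsConsensusPair (agentOp L : Net n d →ₗ[ℝ] Net n d) deviation lo hi)
    (hε : 0 < ε) (hε1 : ε ≤ 1) (t : ℝ)
    (hR : (1 / (n : ℝ)) * ∑ i, (‖x₀ i‖ ^ 2 + ‖gradient (localCost 𝒟 F i) (x₀ i)‖ ^ 2) ≤ R) :
    energy 𝒟 F L ε t ⟨x₀, fun _ => 0, fun _ => 0⟩ ≤
      n * ((hi + 2) * (2 + t ^ 2 * (2 + 2 * Lf ^ 2)) * R) := by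
  have h1 := initial_sum_le hn hR
  have h2 := initial_gradStack_le hn hS hK hR
  have h3 := energy_le (𝒟 := 𝒟) (F := F) (t := t) hhi hK hε hε1 ⟨x₀, fun _ => 0, fun _ => 0⟩
  have h4 := hK.norm_sq_le (stack x₀)
  have h5 : lag (⟨x₀, fun _ => 0, fun _ => 0⟩ : AgentState n d) = stack x₀ := by
    simp [lag]
  have h6 : (stack (fun _ => 0) : Net n d) = 0 := rfl
  simp only [h5] at h3
  rw [h6, zero_add, norm_smul_sq] at h3
  have h7 := mul_le_mul_of_nonneg_left ((hK.norm_sq_le (gradStack 𝒟 F (avg x₀))).trans h2)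
    (sq_nonneg t)
  have h8 := sq_nonneg ‖localGrads 𝒟 F (stack x₀)‖
  have h9 := mul_le_mul_of_nonneg_left (add_le_add (add_le_add h4 h7)
    (le_refl (‖(stack x₀ : Net n d)‖ ^ 2))) (by linarith : 0 ≤ hi + 2)
  have h10 : ‖(stack x₀ : Net n d)‖ ^ 2 ≤ n * R := by linarith
  have h11 := mul_le_mul_of_nonneg_left h10 (by linarith : 0 ≤ 2 * (hi + 2))
  linarith

lemma initial_gap_le (hn : n ≠ 0) (hν : 0 < ν) (hS : IsSmoothProblem 𝒟 F Lf) (hP : IsPL 𝒟 F ν)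
    (hK : IsConsensusPair (agentOp L : Net n d →ₗ[ℝ] Net n d) deviation lo hi)
    (hR : (1 / (n : ℝ)) * ∑ i, (‖x₀ i‖ ^ 2 + ‖gradient (localCost 𝒟 F i) (x₀ i)‖ ^ 2) ≤ R) :
    gap 𝒟 F (avg x₀) ≤ (1 + Lf ^ 2) / ν * R := by
  have hn0 : (0 : ℝ) < n := Nat.cast_pos.2 (Nat.pos_of_ne_zero hn)
  have h1 := gap_le_norm_gradStack hn hν hS hP (avg x₀)
  have h2 := mul_le_mul_of_nonneg_left (initial_gradStack_le hn hS hK hR)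
    (by positivity : 0 ≤ 1 / (2 * ν * n))
  refine h1.trans (h2.trans_eq ?_)
  field_simp

end Initial

/-- The geometric resolution `h₀ ^ k` makes the absolute compression error part of the `1 / s ^ 2`
forcing. -/
lemma pow_sq_le_div {h₀ t : ℝ} (h0 : 0 < h₀) (h2 : h₀ ≤ 1 / 2) (ht : 1 ≤ t) (k : ℕ) :
    (h₀ ^ k) ^ 2 ≤ t ^ 2 / ((k : ℝ) + t) ^ 2 := by
  have hk : (0 : ℝ) ≤ k := k.cast_nonneg
  rw [← div_pow]
  apply pow_le_pow_left₀ (by positivity)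
  have h1 : h₀ ^ k ≤ (1 / 2) ^ k := pow_le_pow_left₀ h0.le h2 k
  have h3 : (1 / 2 : ℝ) ^ k ≤ 1 / ((k : ℝ) + 1) := by
    rw [one_div_pow]
    apply one_div_le_one_div_of_le (by positivity)
    have := one_add_mul_le_pow (by norm_num : (-2 : ℝ) ≤ 1) k
    norm_num at this
    linarith
  refine (h1.trans h3).trans ?_
  rw [div_le_div_iff₀ (by positivity) (by positivity)]
  nlinarith

lemma consensusError_eq {n d : ℕ} (x : Fin n → Vec d) :
    consensusError x = (1 / (n : ℝ)) * ‖deviation (stack x)‖ ^ 2 := by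
  rw [net_norm_sq]
  rfl

end

/-! ### Choice of constants and conclusion -/

set_option maxHeartbeats 2000000 in
theorem theorem3 :
    ∃ C₁ : ℝ → ℝ → ℝ → ℝ → ℝ,
    ∀ lo hi φ r αx Lf β₁ : ℝ, 0 < lo → lo ≤ hi → 0 < φ → φ ≤ 1 → 0 < r → 0 < αx → αx < 1 / r →
      0 < Lf → 9 / (2 * lo) + 1 < β₁ →
    ∃ c₂ : ℝ, 0 < c₂ ∧
    ∀ ν ct β₂ β₀ : ℝ, 0 < ν → 0 < ct → ct < 1 → 0 < β₂ → β₂ < c₂ →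
      ct * ν * β₂ / 4 ≤ β₀ → β₀ < ν * β₂ / 4 →
    ∃ c₅ : ℝ, 2 ≤ c₅ ∧
    ∀ t₁ h₀ σ σC R : ℝ, c₅ < t₁ → 0 < h₀ → h₀ < 1 / t₁ → 0 < σ → 0 ≤ σC →
    ∃ C₂ : ℝ,
    ∀ (n d : ℕ) (W : Matrix (Fin n) (Fin n) ℝ)
      (Ξ : Fin n → Type u) [∀ i, MeasurableSpace (Ξ i)] (𝒟 : ∀ i, Measure (Ξ i))
      (F : ∀ i, Vec d → Ξ i → ℝ)
      (Z : Type v) [MeasurableSpace Z] (𝒬 : Measure Z) (𝒞 : Vec d → Z → Vec d)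
      (Ω : Type w) [MeasurableSpace Ω] (P : Measure Ω) [IsProbabilityMeasure P]
      (ξ : ∀ i, ℕ → Ω → Ξ i) (ζ : Fin n → ℕ → Ω → Z) (x₀ : Fin n → Vec d),
      IsConnectedCoupling W →
      PosEigenvaluesIn (laplacian W) lo hi →
      IsSmoothProblem 𝒟 F Lf →
      IsGradientOracle 𝒟 F σ →
      IsPL 𝒟 F ν →
      IsCompressor 𝒬 𝒞 φ r σC →
      IsFreshSampling P 𝒟 𝒬 ξ ζ →
      (1 / (n : ℝ)) * ∑ i, (‖x₀ i‖ ^ 2 + ‖gradient (localCost 𝒟 F i) (x₀ i)‖ ^ 2) ≤ R →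
      ∀ ω γ η h : ℕ → ℝ,
        (∀ k, ω k = β₀ * ((k : ℝ) + t₁)) → (∀ k, γ k = β₁ * ω k) → (∀ k, η k = β₂ / ω k) →
        (∀ k, h k = h₀ ^ k) →
      ∀ x : ℕ → Ω → Fin n → Vec d,
        (∀ k s, x k s = (rcpSGD (laplacian W) (stochGrad F) 𝒞 αx η γ ω h x₀
          (fun i k => ξ i k s) (fun i k => ζ i k s) k).x) →
      ∀ T : ℕ, 1 ≤ T →
        (Integrable (fun s => consensusError (x T s)) P ∧
          ∫ s, consensusError (x T s) ∂P ≤ C₂ / (T : ℝ) ^ 2) ∧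
        (Integrable (fun s => globalCost 𝒟 F (avg (x T s)) - optValue 𝒟 F) P ∧
          ∫ s, (globalCost 𝒟 F (avg (x T s)) - optValue 𝒟 F) ∂P ≤
            C₁ Lf σ ν ct / ((n : ℝ) * (T : ℝ)) + C₂ / (T : ℝ) ^ 2) := by
  -- This is `Lf * η ^ 2 / 2 * σ ^ 2` without the factor `1 / s ^ 2`, using `β₂ / β₀ ≤ 4 / (ct *
  -- ν)`.
  refine ⟨fun Lf σ ν ct => 8 * Lf * σ ^ 2 / (ct * ν) ^ 2, ?_⟩
  intro lo hi φ r αx Lf β₁ hlo hlh hφ hφ1 hr hα hαr hLf hβ₁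
  have hb₁ : 0 < β₁ := by
    have : 0 < 9 / (2 * lo) := by positivity
    linarith
  have hhi : 0 < hi := hlo.trans_le hlh
  obtain ⟨ε, c₂, hε, hε1, hε2, hc₂, hstep⟩ :=
    exists_energy_step.{u, v} hlo hlh hb₁ hφ hφ1 hr hα hαr hLf
  refine ⟨c₂, hc₂, ?_⟩
  intro ν ct β₂ β₀ hν hct hct1 hβ₂ hβc hβlo hβhi
  have hβ₀ : 0 < β₀ := lt_of_lt_of_le (by positivity) hβlo
  obtain ⟨θ, C, ρ₁, ρ₂, hθ, hθ1, hC, hρ₂, hρ, hmain⟩ := hstep β₂ β₀ hβ₂ hβc hβ₀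
  obtain ⟨κ, hκ⟩ : ∃ κ : ℝ, κ = θ / (hi + 2) := ⟨_, rfl⟩
  have hκ0 : 0 < κ := by rw [hκ]; positivity
  have hκ1 : κ ≤ 1 := by
    rw [hκ, div_le_one (by positivity)]
    linarith
  -- `G` dominates all coupling coefficients: `C` and `C * (2 / lo)` from the drift, and `β₂ * Lf ^
  -- 2 / (β₀ * lo)`, with which the energy enters the gap recursion.
  obtain ⟨G, hG⟩ : ∃ G : ℝ, G = C * (2 / lo + 1) + β₂ * Lf ^ 2 / (β₀ * lo) := ⟨_, rfl⟩
  have hG0 : 0 < G := by rw [hG]; positivity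
  have hp1 : 0 ≤ G / κ := by positivity
  have hp2 : 0 ≤ 6 / κ := by positivity
  have hp3 : 0 ≤ β₂ * Lf / β₀ := by positivity
  -- Each summand secures one requirement on `t₁`: `4 ≤ t₁`, `G ≤ κ * t₁`, `6 ≤ κ * t₁`, and `η k *
  -- Lf ≤ 1` for every `k`.
  refine ⟨4 + G / κ + 6 / κ + β₂ * Lf / β₀, by linarith, ?_⟩
  intro t₁ h₀ σ σC R ht hh0 hh1 hσ hσC
  have ht4 : 4 ≤ t₁ := by linarith
  have htG : G ≤ κ * t₁ := by
    rw [mul_comm, ← div_le_iff₀ hκ0]; linarith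
  have ht6 : 6 ≤ κ * t₁ := by
    rw [mul_comm, ← div_le_iff₀ hκ0]; linarith
  have htL : β₂ * Lf ≤ β₀ * t₁ := by
    rw [mul_comm β₀, ← div_le_iff₀ hβ₀]; linarith
  have hh2 : h₀ ≤ 1 / 2 :=
    hh1.le.trans (one_div_le_one_div_of_le (by norm_num) (by linarith))
  obtain ⟨A, hA⟩ : ∃ A : ℝ, A = 8 * Lf * σ ^ 2 / (ct * ν) ^ 2 := ⟨_, rfl⟩
  have hA0 : 0 ≤ A := by rw [hA]; positivity
  -- `D₁`, `D₂`, `D₃` bound the initial energy, squared gradients and gap, and `D₄` is the forcing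
  -- by compression and noise. The absolute value keeps them nonnegative, as the sign of `R` is not
  -- yet known.
  obtain ⟨D₁, hD₁⟩ : ∃ D₁ : ℝ, D₁ = (hi + 2) * (2 + ((β₀ * t₁)⁻¹) ^ 2 * (2 + 2 * Lf ^ 2)) * |R| :=
    ⟨_, rfl⟩
  obtain ⟨D₂, hD₂⟩ : ∃ D₂ : ℝ, D₂ = (2 + 2 * Lf ^ 2) * |R| := ⟨_, rfl⟩
  obtain ⟨D₃, hD₃⟩ : ∃ D₃ : ℝ, D₃ = (1 + Lf ^ 2) / ν * |R| := ⟨_, rfl⟩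
  obtain ⟨D₄, hD₄⟩ : ∃ D₄ : ℝ, D₄ = ρ₂ * (t₁ ^ 2 * σC) + C * σ ^ 2 := ⟨_, rfl⟩
  have hD₁0 : 0 ≤ D₁ := by rw [hD₁]; positivity
  have hD₂0 : 0 ≤ D₂ := by rw [hD₂]; positivity
  have hD₃0 : 0 ≤ D₃ := by rw [hD₃]; positivity
  have hD₄0 : 0 ≤ D₄ := by rw [hD₄]; positivity
  obtain ⟨D, hD⟩ : ∃ D : ℝ, D = D₁ + D₂ + D₃ + D₄ := ⟨_, rfl⟩
  have hD0 : 0 ≤ D := by rw [hD]; positivity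
  obtain ⟨B, hB0, hB⟩ := exists_rate_bound hκ0 hκ1 hG0.le hD0 hA0 ht4 htG ht6
  -- The consensus error is at most `2 / lo` times the energy; the second `B` serves the gap.
  refine ⟨2 / lo * B + B, ?_⟩
  intro n d W Ξ _ 𝒟 F Z _ 𝒬 𝒞 Ω _ P _ ξ ζ x₀ hW hev hS hO hP hCo hs hR ω γ η h hω hγ hη hh x hx
    T hT
  have hn : n ≠ 0 := by
    rintro rfl
    exact hW.connected.nonempty.elim fun i => i.elim0
  have hn0 : (0 : ℝ) < n := Nat.cast_pos.2 (Nat.pos_of_ne_zero hn)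
  have hn1 : (1 : ℝ) ≤ n := Nat.one_le_cast.2 (Nat.pos_of_ne_zero hn)
  have hK := isConsensusPair_laplacian (d := d) hlo hlh hW hev
  have hs4 : ∀ k : ℕ, t₁ ≤ (k : ℝ) + t₁ := fun k => by
    have : (0 : ℝ) ≤ k := k.cast_nonneg
    linarith
  have hω0 : ∀ k, ω k ≠ 0 := fun k => by
    rw [hω]
    have := hs4 k
    have : 0 < (k : ℝ) + t₁ := by linarith
    positivity
  have hhk : ∀ k, 0 < h k := fun k => by rw [hh]; positivity
  obtain ⟨st, hst⟩ : ∃ st : ℕ → Ω → AgentState n d, st = fun k s => rcpSGD (laplacian W)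
    (stochGrad F) 𝒞 αx η γ ω h x₀ (fun i k => ξ i k s) (fun i k => ζ i k s) k := ⟨_, rfl⟩
  have hpast : ∀ k, IsPastState P ξ ζ k (st k) := by
    rw [hst]
    exact isPastState_rcpSGD hW.symm hS hO hCo hr hs hhk hω0 hγ hη x₀
  have hsucc : ∀ k s, st (k + 1) s = rcpStep (laplacian W) (stochGrad F) 𝒞 αx (η k) (γ k) (ω k)
      (h k) (fun i => ξ i k s) (fun i => ζ i k s) (st k s) := by
    rw [hst]
    exact fun _ _ => rfl
  have hzero : ∀ s, st 0 s = ⟨x₀, fun _ => 0, fun _ => 0⟩ := by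
    rw [hst]
    exact fun _ => rfl
  have hxst : ∀ k s, x k s = (st k s).x := by
    rw [hst]
    exact hx
  have hpath := fun (k : ℕ) (s : Ω) => hmain n d W Ξ 𝒟 F Z 𝒞 ν ((k : ℝ) + t₁) (η k) (γ k) (ω k)
    (h k) (fun i => ξ i k s) (fun i => ζ i k s) (st k s) hn hW.symm hK hS hP
    (by have := hs4 k; linarith) (hω k) (hγ k) (hη k) ((hpast k).avg_v s)
  simp_rw [← hsucc] at hpath
  have hcast : ∀ k : ℕ, ((k + 1 : ℕ) : ℝ) + t₁ = (k : ℝ) + t₁ + 1 := fun k => by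
    push_cast; ring
  -- Energy and squared gradients are normalized per agent, which removes `n` from every coefficient
  -- except the noise term of the gap.
  obtain ⟨V, hV⟩ : ∃ V : ℕ → ℝ, V = fun k : ℕ => (1 / (n : ℝ)) *
    ∫ s, energy 𝒟 F (laplacian W) ε (β₀ * ((k : ℝ) + t₁))⁻¹ (st k s) ∂P := ⟨_, rfl⟩
  obtain ⟨M, hM⟩ : ∃ M : ℕ → ℝ, M = fun k : ℕ => (1 / (n : ℝ)) *
    ∫ s, ‖gradStack 𝒟 F (avg (st k s).x)‖ ^ 2 ∂P := ⟨_, rfl⟩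
  obtain ⟨a, ha⟩ : ∃ a : ℕ → ℝ, a = fun k : ℕ => ∫ s, gap 𝒟 F (avg (st k s).x) ∂P := ⟨_, rfl⟩
  have hVn : ∀ k : ℕ, ∫ s, energy 𝒟 F (laplacian W) ε (β₀ * ((k : ℝ) + t₁))⁻¹ (st k s) ∂P
      = n * V k := fun k => by rw [hV]; field_simp
  have hMn : ∀ k : ℕ, ∫ s, ‖gradStack 𝒟 F (avg (st k s).x)‖ ^ 2 ∂P = n * M k := fun k => by
    rw [hM]; field_simp
  have han : ∀ k : ℕ, ∫ s, gap 𝒟 F (avg (st k s).x) ∂P = a k := fun k => by rw [ha]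
  have hV0 : ∀ k, 0 ≤ V k := fun k => by
    rw [hV]
    exact mul_nonneg (by positivity) (integral_nonneg fun s => energy_nonneg hlo hK hε2 _)
  have hM0 : ∀ k, 0 ≤ M k := fun k => by
    rw [hM]
    exact mul_nonneg (by positivity) (integral_nonneg fun s => sq_nonneg _)
  have ha0 : ∀ k, 0 ≤ a k := fun k => by
    rw [ha]
    exact integral_nonneg fun s => gap_nonneg hP _
  have hR' := hR.trans (le_abs_self R)
  have hVi : V 0 ≤ D := by
    have h1 := initial_energy_le hn hS hhi.le hK hε hε1 (β₀ * t₁)⁻¹ hR'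
    have h2 := hVn 0
    simp only [hzero, Nat.cast_zero, zero_add, integral_const, probReal_univ, one_smul] at h2
    rw [h2, ← hD₁] at h1
    have := le_of_mul_le_mul_left h1 hn0
    rw [hD]; linarith
  have hMi : M 0 ≤ D := by
    have h1 := initial_gradStack_le hn hS hK hR'
    have h2 := hMn 0
    simp only [hzero, integral_const, probReal_univ, one_smul] at h2
    rw [h2, ← hD₂] at h1
    have := le_of_mul_le_mul_left h1 hn0
    rw [hD]; linarith
  have hai : a 0 ≤ D := by
    have h1 := initial_gap_le hn hν hS hP hK hR'
    have h2 := han 0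
    simp only [hzero, integral_const, probReal_univ, one_smul] at h2
    rw [h2, ← hD₃] at h1
    rw [hD]; linarith
  have hGC : C ≤ G := by
    have e1 : 0 ≤ C * (2 / lo) := by positivity
    have e2 : 0 ≤ β₂ * Lf ^ 2 / (β₀ * lo) := by positivity
    rw [hG]; linarith
  have hGC2 : C * (2 / lo) ≤ G := by
    have e2 : 0 ≤ β₂ * Lf ^ 2 / (β₀ * lo) := by positivity
    rw [hG]; linarith
  have hGL : β₂ * Lf ^ 2 / (β₀ * lo) ≤ G := by
    have e2 : 0 ≤ C * (2 / lo + 1) := by positivity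
    rw [hG]; linarith
  have hCσ : C * σ ^ 2 ≤ D := by
    have e1 : 0 ≤ ρ₂ * (t₁ ^ 2 * σC) := by positivity
    rw [hD]; linarith
  have hrecV : ∀ k : ℕ, V (k + 1) ≤ (1 - κ) * V k + G / ((k : ℝ) + t₁) ^ 2 * (a k + V k)
      + G / ((k : ℝ) + t₁) ^ 4 * M k + D / ((k : ℝ) + t₁) ^ 2 := by
    intro k
    have hts := hs4 k
    have h1 := expected_energy_step hn hν (hpast k) (hpast (k + 1)) hS hP hO hCo hr hs hlo hhi hK
      hε hε1 hε2 hθ hC hρ₂ hρ (by linarith : 0 < (k : ℝ) + t₁) (hhk k) fun s => (hpath k s).1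
    rw [← hcast, hVn, hVn, hMn, han, ← hκ] at h1
    have hhsq : h k ^ 2 ≤ t₁ ^ 2 / ((k : ℝ) + t₁) ^ 2 := by
      rw [hh]; exact pow_sq_le_div hh0 hh2 (by linarith) k
    generalize (k : ℝ) + t₁ = s at *
    have hs0 : 0 < s := by linarith
    have h2 : V (k + 1) ≤ (1 - κ) * V k + ρ₂ * (h k ^ 2 * σC)
        + C / s ^ 2 * (σ ^ 2 + 2 / lo * V k + a k) + C / s ^ 4 * M k := by
      refine le_of_mul_le_mul_left ?_ hn0
      linarith only [h1]
    have h3 : ρ₂ * (h k ^ 2 * σC) ≤ ρ₂ * (t₁ ^ 2 / s ^ 2 * σC) := by gcongr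
    have h4 : C / s ^ 4 * M k ≤ G / s ^ 4 * M k := by
      have := hM0 k
      gcongr
    have h5 : C / s ^ 2 * a k ≤ G / s ^ 2 * a k := by
      have := ha0 k
      gcongr
    have h6 : C * (2 / lo) / s ^ 2 * V k ≤ G / s ^ 2 * V k := by
      have := hV0 k
      gcongr
    have h7 : D₄ / s ^ 2 ≤ D / s ^ 2 := by
      gcongr
      rw [hD]; linarith
    have h8 : D₄ / s ^ 2 = ρ₂ * (t₁ ^ 2 / s ^ 2 * σC) + C / s ^ 2 * σ ^ 2 := by
      rw [hD₄]; ring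
    have h9 : C * (2 / lo) / s ^ 2 * V k = C / s ^ 2 * (2 / lo * V k) := by ring
    linarith only [h2, h3, h4, h5, h6, h7, h8, h9]
  have hrecM : ∀ k : ℕ, M (k + 1) ≤ (1 + 1 / ((k : ℝ) + t₁)) * M k
      + (1 + ((k : ℝ) + t₁)) / ((k : ℝ) + t₁) ^ 2 * (G * (V k + a k) + D) := by
    intro k
    have hts := hs4 k
    have h1 := expected_gradStack_step hn hν (hpast k) (hpast (k + 1)) hS hP hO hs hlo hK hε2
      (t := (β₀ * ((k : ℝ) + t₁))⁻¹) hC (by linarith : 0 < (k : ℝ) + t₁) fun s => (hpath k s).2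
    rw [hVn, hMn, hMn, han] at h1
    generalize (k : ℝ) + t₁ = s at *
    have hs0 : 0 < s := by linarith
    have h2 : M (k + 1) ≤ (1 + 1 / s) * M k
        + (1 + s) / s ^ 2 * (C * (σ ^ 2 + 2 / lo * V k + a k)) := by
      refine le_of_mul_le_mul_left ?_ hn0
      linarith only [h1]
    have h3 : C * (σ ^ 2 + 2 / lo * V k + a k) ≤ G * (V k + a k) + D := by
      have e1 := mul_le_mul_of_nonneg_right hGC2 (hV0 k)
      have e2 := mul_le_mul_of_nonneg_right hGC (ha0 k)
      linarith only [e1, e2, hCσ]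
    have h4 := mul_le_mul_of_nonneg_left h3 (by positivity : 0 ≤ (1 + s) / s ^ 2)
    linarith only [h2, h4]
  have hreca : ∀ k : ℕ, a (k + 1) ≤ (1 - 4 / ((k : ℝ) + t₁)) * a k + G / ((k : ℝ) + t₁) * V k
      + A / (n * ((k : ℝ) + t₁) ^ 2) := by
    intro k
    have hts := hs4 k
    have hs0 : 0 < (k : ℝ) + t₁ := by linarith
    have hηγ : η k * γ k = β₂ * β₁ := by
      rw [hη, hγ]; field_simp [hω0 k]
    have hηω : η k * ω k = β₂ := by rw [hη]; field_simp [hω0 k]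
    have hηs : η k = β₂ / β₀ / ((k : ℝ) + t₁) := by rw [hη, hω, div_div]
    have hη0 : 0 ≤ η k := by rw [hηs]; positivity
    have hηL : η k * Lf ≤ 1 := by
      rw [hη, hω, div_mul_eq_mul_div, div_le_one (by positivity)]
      exact htL.trans (mul_le_mul_of_nonneg_left hts hβ₀.le)
    have h1 := expected_gap_step hn hν hLf (hpast k) (hpast (k + 1)) hS hP hO hs hlo hK hε2
      (t := (β₀ * ((k : ℝ) + t₁))⁻¹) hη0 hηL fun s => by
        rw [hsucc]
        exact avg_rcpStep_x _ _ _ hW.symm hηγ hηω (by rw [hη, div_eq_mul_inv]) ((hpast k).avg_v s)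
    rw [hVn, han, han, hηs] at h1
    generalize (k : ℝ) + t₁ = s at *
    -- The upper bound on `β₀` gives the contraction `4 / s`; the lower bound, used next, keeps `C₁`
    -- free of `β₀` and `β₂`.
    have hr1 : 4 ≤ β₂ / β₀ * ν := by
      rw [div_mul_eq_mul_div, le_div_iff₀ hβ₀]; linarith
    have hr2 : β₂ / β₀ ≤ 4 / (ct * ν) := by
      rw [div_le_div_iff₀ hβ₀ (by positivity)]; linarith
    have h2 : 4 / s * a k ≤ β₂ / β₀ / s * ν * a k := by
      apply mul_le_mul_of_nonneg_right _ (ha0 k)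
      rw [div_mul_eq_mul_div]
      gcongr
    have h3 : β₂ / β₀ / s / 2 * (Lf ^ 2 * ((1 / (n : ℝ)) * (2 / lo * (n * V k))))
        = β₂ * Lf ^ 2 / (β₀ * lo) / s * V k := by
      field_simp
    have h4 : β₂ * Lf ^ 2 / (β₀ * lo) / s * V k ≤ G / s * V k := by
      have := hV0 k
      gcongr
    have h5 : Lf * (β₂ / β₀ / s) ^ 2 / 2 * (σ ^ 2 / n) ≤ A / (n * s ^ 2) := by
      calc Lf * (β₂ / β₀ / s) ^ 2 / 2 * (σ ^ 2 / n)
          ≤ Lf * (4 / (ct * ν) / s) ^ 2 / 2 * (σ ^ 2 / n) := by gcongr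
        _ = A / (n * s ^ 2) := by rw [hA]; field_simp; norm_num
    rw [h3] at h1
    linarith only [h1, h2, h4, h5]
  obtain ⟨hVT, haT⟩ := hB n V M a hn1 hV0 hM0 ha0 hVi hMi hai hrecV hrecM hreca T
  have hT0 : (0 : ℝ) < T := Nat.cast_pos.2 hT
  have hTs : (T : ℝ) ≤ (T : ℝ) + t₁ := by linarith
  have hBT : B / ((T : ℝ) + t₁) ^ 2 ≤ B / (T : ℝ) ^ 2 := by gcongr
  have hBlo : 0 ≤ 2 / lo * B := by positivity
  have hdev := (memLp_linearMap deviation (hpast T).memLp_x).integrable_norm_pow two_ne_zero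
  refine ⟨⟨?_, ?_⟩, ?_, ?_⟩
  · simp_rw [hxst, consensusError_eq]
    exact hdev.const_mul _
  · simp_rw [hxst, consensusError_eq]
    rw [integral_const_mul]
    have h1 := integral_mono hdev ((integrable_energy hS (laplacian W) ε
      (β₀ * ((T : ℝ) + t₁))⁻¹ (hpast T).memLp_x (hpast T).memLp_v (hpast T).memLp_lag).const_mul
      (2 / lo)) fun s => norm_deviation_sq_le_energy hlo hK hε2 (st T s)
    rw [integral_const_mul, hVn] at h1
    calc (1 / (n : ℝ)) * ∫ s, ‖deviation (stack (st T s).x)‖ ^ 2 ∂P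
        ≤ (1 / (n : ℝ)) * (2 / lo * (n * V T)) := mul_le_mul_of_nonneg_left h1 (by positivity)
      _ = 2 / lo * V T := by field_simp
      _ ≤ 2 / lo * (B / (T : ℝ) ^ 2) :=
          mul_le_mul_of_nonneg_left (hVT.trans hBT) (by positivity)
      _ = 2 / lo * B / (T : ℝ) ^ 2 := by ring
      _ ≤ (2 / lo * B + B) / (T : ℝ) ^ 2 := by gcongr; linarith
  · simp_rw [hxst]
    exact integrable_gap hn hν hS hP (memLp_avg (hpast T).memLp_x)
  · simp_rw [hxst]
    have h1 : ∫ s, (globalCost 𝒟 F (avg (st T s).x) - optValue 𝒟 F) ∂P = a T := han T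
    rw [h1]
    have h2 : A / (n * ((T : ℝ) + t₁)) ≤ A / (n * (T : ℝ)) := by gcongr
    have h3 : B / (T : ℝ) ^ 2 ≤ (2 / lo * B + B) / (T : ℝ) ^ 2 := by gcongr; linarith
    rw [← hA]
    linarith only [haT, hBT, h2, h3]
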